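/- Let $M$ be a hypercomplex Hermitian manifold: a smooth manifold with a smooth action of the quaternion algebra $\mathbb H$ on $TM$ such that every $L\in\mathbb H$ with $L^2=-1$ acts as an integrable almost complex structure, together with a Riemannian metric $s$ that is Hermitian with respect to every such $L$. Let $I,J,K=IJ$ be the standard quaternions, $\omega_L(x,y)=s(x,Ly)$, and $\Omega=\frac12(\omega_J+\sqrt{-1}\,\omega_K)$, a form of type $(2,0)$ on the complex manifold $(M,I)$. Let $\Lambda^{p,0}_I(M)$ be the space of smooth forms of type $(p,0)$ on $(M,I)$, and $\Lambda^{*,0}_I(M)=\bigoplus_p\Lambda^{p,0}_I(M)$, a graded commutative algebra over $\mathbb C$. Let $L_\Omega$ be the operator of multiplication by $\Omega$, let $\partial,\bar\partial$ be the Dolbeault differentials of $(M,I)$, and let $\partial^*$ be the Hermitian adjoint of $\partial$, that is, $\partial^*=-*\bar\partial\,*$, where $*$ is the complex-linear Hodge star operator (equivalently, $\partial^*=-\bar *\,\partial\,\bar *$ with $\bar *\eta=*\bar\eta$). Put $$\delta_J^*:=-[L_\Omega,\partial^*]=-(L_\Omega\partial^*-\partial^*L_\Omega).$$ Let $J$ act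 multiplicatively on forms, with $(J\alpha)(v)=\alpha(J^{-1}v)$ on $1$-forms, and let $\partial_J:\Lambda^{p,0}_I(M)\to\Lambda^{p+1,0}_I(M)$ be the operator $J\circ\bar\partial\circ J^{-1}$, which extends $f\mapsto J(\bar\partial f)$ by the graded Leibniz rule. Then $\delta_J^*$ and $\partial_J$ define $\mathbb C$-linear operators on $\Lambda^{*,0}_I(M)$ which map $\Lambda^{p,0}_I(M)$ to $\Lambda^{p+1,0}_I(M)$ for every $p$; both are differential operators of order at most $1$ over $C^\infty(M)$ (the usual notion), and they have the same symbol: $[\delta_J^*,f]=[\partial_J,f]$ for every smooth function $f$. Moreover, $\delta_J^*\in D_1(\Lambda^{*,0}_I(M))$. Here, for a graded commutative algebra $A$ over $\mathbb C$, $D_0(A)$ is the set of multiplications by elements of $A$, and $D_i(A)$ is the set of $\mathbb C$-linear maps $D:A\to A$ such that the supercommutator $[a,D]$ lies in $D_{i-1}(A)$ for all $a\in D_0(A)$. -/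

import Mathlib

open Module Manifold Bundle
open scoped ContDiff Quaternion

noncomputable section

/-! ### Complex-valued exterior algebra of a real vector space -/

section LinearAlgebra

variable {T T' : Type*} [AddCommGroup T] [Module ℝ T] [AddCommGroup T'] [Module ℝ T']

/-- The complexified dual `T* ⊗ ℂ`: real-linear maps `T → ℂ`. -/
abbrev CDual (T : Type*) [AddCommGroup T] [Module ℝ T] : Type _ := T →ₗ[ℝ] ℂ

/-- The algebra `Λ*(T* ⊗ ℂ)` of complex-valued exterior forms on `T`. -/
abbrev CExt (T : Type*) [AddCommGroup T] [Module ℝ T] : Type _ := ExteriorAlgebra ℂ (CDual T)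

/-- Precomposition of covectors with a linear map. -/
def covPull (A : T →ₗ[ℝ] T') : CDual T' →ₗ[ℂ] CDual T where
  toFun α := α ∘ₗ A
  map_add' _ _ := rfl
  map_smul' _ _ := rfl

/-- Pull-back of exterior forms by a linear map. -/
def extPull (A : T →ₗ[ℝ] T') : CExt T' →ₐ[ℂ] CExt T := ExteriorAlgebra.map (covPull A)

/-- Evaluation at a vector, as a complex functional on covectors. -/
def covEval (v : T) : CDual T →ₗ[ℂ] ℂ where
  toFun α := α v
  map_add' _ _ := rfl
  map_smul' _ _ := rfl

/-! #### Types with respect to a complex structure -/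

/-- The covectors of type `(1,0)` for a complex structure `I`: those with `α ∘ I = i α`. -/
def type10 (I : T →ₗ[ℝ] T) : Submodule ℂ (CDual T) where
  carrier := {α | covPull I α = Complex.I • α}
  add_mem' := by
    intro a b ha hb
    simp only [Set.mem_ofPred_eq] at ha hb ⊢
    rw [map_add, ha, hb, smul_add]
  zero_mem' := by simp
  smul_mem' := by
    intro c a ha
    simp only [Set.mem_ofPred_eq] at ha ⊢
    rw [map_smul, ha, smul_comm]

/-- `Λ^{p,0}`: the span of the products of `p` covectors of type `(1,0)`. -/
def extP0 (I : T →ₗ[ℝ] T) (p : ℕ) : Submodule ℂ (CExt T) :=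
  ((type10 I).map (ExteriorAlgebra.ι ℂ)) ^ p

/-- `Λ^{*,0}`: the subalgebra generated by the covectors of type `(1,0)`. -/
def extStar0 (I : T →ₗ[ℝ] T) : Subalgebra ℂ (CExt T) :=
  Algebra.adjoin ℂ (ExteriorAlgebra.ι ℂ '' (type10 I : Set (CDual T)))

/-- The projection `α ↦ (α - i α ∘ I) / 2` of covectors to type `(1,0)`. -/
def proj10 (I : T →ₗ[ℝ] T) : CDual T →ₗ[ℂ] CDual T :=
  (1 / 2 : ℂ) • (LinearMap.id - Complex.I • covPull I)

/-- The projection `α ↦ (α + i α ∘ I) / 2` of covectors to type `(0,1)`. -/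
def proj01 (I : T →ₗ[ℝ] T) : CDual T →ₗ[ℂ] CDual T :=
  (1 / 2 : ℂ) • (LinearMap.id + Complex.I • covPull I)

/-- `α ↦ α^{1,0} X + α^{0,1}`, with values in polynomials over the exterior algebra. -/
def holWeightAux (I : T →ₗ[ℝ] T) : CDual T →ₗ[ℂ] Polynomial (CExt T) where
  toFun α := Polynomial.monomial 1 (ExteriorAlgebra.ι ℂ (proj10 I α)) +
    Polynomial.monomial 0 (ExteriorAlgebra.ι ℂ (proj01 I α))
  map_add' := by
    intro a b
    simp only [map_add]
    abel
  map_smul' := by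
    intro c a
    simp only [map_smul, RingHom.id_apply, smul_add, Polynomial.smul_monomial]

theorem holWeightAux_sq (I : T →ₗ[ℝ] T) (α : CDual T) :
    holWeightAux I α * holWeightAux I α = 0 := by
  have h := ExteriorAlgebra.ι_add_mul_swap (R := ℂ) (proj10 I α) (proj01 I α)
  simp only [holWeightAux, LinearMap.coe_mk, AddHom.coe_mk, add_mul, mul_add,
    Polynomial.monomial_mul_monomial, ExteriorAlgebra.ι_sq_zero, map_zero, zero_add, add_zero]
  rw [← map_add, add_comm, h, map_zero]

/-- The algebra homomorphism that multiplies a form of type `(p,q)` by `X ^ p`. -/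
def holWeight (I : T →ₗ[ℝ] T) : CExt T →ₐ[ℂ] Polynomial (CExt T) :=
  ExteriorAlgebra.lift ℂ ⟨holWeightAux I, holWeightAux_sq I⟩

/-- The projection to `⨁_q Λ^{p,q}` along the other types. -/
def holPart (I : T →ₗ[ℝ] T) (p : ℕ) (η : CExt T) : CExt T := (holWeight I η).coeff p

/-! #### Coordinates, two-forms, the Hodge star operator -/

variable [Module.Finite ℝ T]

/-- The (complexified) dual basis `e^i` of a fixed basis `e_i` of `T`. -/
def coBasis (T : Type*) [AddCommGroup T] [Module ℝ T] [Module.Finite ℝ T] :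
    Basis (Fin (finrank ℝ T)) ℂ (CDual T) :=
  Basis.ofEquivFun ((finBasis ℝ T).constr ℂ).symm

/-- The coefficients of a form in the basis of the monomials `e^{i₁} ∧ ⋯ ∧ e^{i_k}`. -/
def extCoord (T : Type*) [AddCommGroup T] [Module ℝ T] [Module.Finite ℝ T] :
    CExt T ≃ₗ[ℂ] (Finset (Fin (finrank ℝ T)) → ℂ) :=
  (coBasis T).ExteriorAlgebra.equivFun

/-- The two-form `½ ∑ B(e_i, e_j) e^i ∧ e^j`, whose value on `(v, w)` is `B(v, w)` when `B` is an
alternating real bilinear function. -/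
def twoForm (B : T → T → ℝ) : CExt T :=
  ∑ i, ∑ j, ((1 / 2 : ℂ) * (B (finBasis ℝ T i) (finBasis ℝ T j) : ℂ)) •
    (ExteriorAlgebra.ι ℂ (coBasis T i) * ExteriorAlgebra.ι ℂ (coBasis T j))

/-- The Gram matrix of an inner product `s` in the basis `e_i`. -/
def gram (s : T → T → ℝ) : Matrix (Fin (finrank ℝ T)) (Fin (finrank ℝ T)) ℝ :=
  Matrix.of fun i j => s (finBasis ℝ T i) (finBasis ℝ T j)

/-- The complex-bilinear extension to `T* ⊗ ℂ` of the inner product on `T*` dual to `s`: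
`(α, β) = ∑ s^{ij} α(e_i) β(e_j)`. -/
def dualMetric (s : T → T → ℝ) : CDual T →ₗ[ℂ] CDual T →ₗ[ℂ] ℂ :=
  ∑ i, ∑ j, (((gram s)⁻¹ i j : ℝ) : ℂ) •
    (LinearMap.mul ℂ ℂ).compl₁₂ (covEval (finBasis ℝ T i)) (covEval (finBasis ℝ T j))

/-- Contraction of forms with the vector dual to a covector. -/
def contractAux (s : T → T → ℝ) : CDual T →ₗ[ℂ] (Module.End ℂ (CExt T))ᵐᵒᵖ :=
  (MulOpposite.opLinearEquiv ℂ).toLinearMap ∘ₗ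
    (CliffordAlgebra.contractLeft (Q := (0 : QuadraticForm ℂ (CDual T)))) ∘ₗ dualMetric s

theorem contractAux_sq (s : T → T → ℝ) (α : CDual T) :
    contractAux s α * contractAux s α = 0 := by
  apply MulOpposite.unop_injective
  refine LinearMap.ext fun x => ?_
  exact CliffordAlgebra.contractLeft_contractLeft (Q := (0 : QuadraticForm ℂ (CDual T)))
    (dualMetric s α) x

/-- Iterated contraction: `α₁ ∧ ⋯ ∧ α_k` acts as `ι_{α_k} ⋯ ι_{α₁}`, where `ι_α` is the contraction
with the vector dual to `α`. -/
def contract (s : T → T → ℝ) : CExt T →ₐ[ℂ] (Module.End ℂ (CExt T))ᵐᵒᵖ :=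
  ExteriorAlgebra.lift ℂ ⟨contractAux s, contractAux_sq s⟩

/-- The volume form of an inner product `s` for which the complex structure `I` is orthogonal,
with the orientation of `I`: the form `σ^m / m!`, where `σ(v, w) = s(I v, w)` and
`2 m = dim T`. -/
def volForm (s : T → T → ℝ) (I : T →ₗ[ℝ] T) : CExt T :=
  ((1 : ℂ) / ((finrank ℝ T / 2).factorial : ℂ)) •
    twoForm (fun v w => s (I v) w) ^ (finrank ℝ T / 2)

/-- The complex-linear Hodge star operator: `*(α₁ ∧ ⋯ ∧ α_k) = ι_{α_k} ⋯ ι_{α₁} vol`, that is,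
`α ∧ *β = (α, β) vol`. -/
def hodgeStar (s : T → T → ℝ) (I : T →ₗ[ℝ] T) (η : CExt T) : CExt T :=
  (contract s η).unop (volForm s I)

end LinearAlgebra

/-! ### Differential forms on a manifold -/

section Forms

variable {E : Type*} [NormedAddCommGroup E] [NormedSpace ℝ E] [FiniteDimensional ℝ E]

/-- The exterior derivative `∑ e^i ∧ ∂_i f` of a form `f` on (an open subset of) `E`. -/
def extDerivE (f : E → CExt E) (y : E) : CExt E :=
  ∑ i, ExteriorAlgebra.ι ℂ (coBasis E i) *
    (extCoord E).symm (fderiv ℝ (fun z => extCoord E (f z)) y (finBasis ℝ E i))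

variable {M : Type*} [TopologicalSpace M] [ChartedSpace E M]

instance tangentSpace_finite (x : M) : Module.Finite ℝ (TangentSpace 𝓘(ℝ, E) x) :=
  inferInstanceAs (Module.Finite ℝ E)

variable (E M) in
/-- Complex-valued, not necessarily smooth or homogeneous, differential forms on `M`. -/
abbrev CForm : Type _ := ∀ x : M, CExt (TangentSpace 𝓘(ℝ, E) x)

/-- The differential `T_x M → E` at `x` of the chart at `x`. -/
def chartDiff (x : M) : TangentSpace 𝓘(ℝ, E) x →ₗ[ℝ] E :=
  (mfderiv 𝓘(ℝ, E) 𝓘(ℝ, E) (extChartAt 𝓘(ℝ, E) x) x).toLinearMap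

/-- The differential at `y ∈ E` of the inverse of the chart at `x₀`. -/
def chartSymmDiff (x₀ : M) (y : E) :
    E →ₗ[ℝ] TangentSpace 𝓘(ℝ, E) ((extChartAt 𝓘(ℝ, E) x₀).symm y) :=
  (mfderiv 𝓘(ℝ, E) 𝓘(ℝ, E) (extChartAt 𝓘(ℝ, E) x₀).symm y).toLinearMap

/-- The expression of a form in the chart at `x₀`. -/
def CForm.inChart (x₀ : M) (η : CForm E M) (y : E) : CExt E :=
  extPull (chartSymmDiff x₀ y) (η ((extChartAt 𝓘(ℝ, E) x₀).symm y))

/-- A form is smooth if its coefficients in every chart are smooth. -/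
def CForm.IsSmooth (η : CForm E M) : Prop :=
  ∀ x₀ : M, ContDiffOn ℝ ∞ (fun y => extCoord E (CForm.inChart x₀ η y))
    (extChartAt 𝓘(ℝ, E) x₀).target

/-- The de Rham differential, computed at `x` in the chart at `x`. -/
def CForm.d (η : CForm E M) : CForm E M := fun x =>
  extPull (chartDiff x) (extDerivE (CForm.inChart x η) (extChartAt 𝓘(ℝ, E) x x))

end Forms

/-! ### Hypercomplex Hermitian manifolds -/

section Hypercomplex

variable {E : Type*} [NormedAddCommGroup E] [NormedSpace ℝ E]
variable {M : Type*} [TopologicalSpace M] [ChartedSpace E M] [IsManifold 𝓘(ℝ, E) ∞ M]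

/-- Integrability of an almost complex structure `L`: its Nijenhuis tensor
`[LX, LY] - L[LX, Y] - L[X, LY] - [X, Y]` vanishes. -/
def IsIntegrableACS (L : ∀ x : M, TangentSpace 𝓘(ℝ, E) x →L[ℝ] TangentSpace 𝓘(ℝ, E) x) : Prop :=
  ∀ (x : M) (X Y : ∀ y : M, TangentSpace 𝓘(ℝ, E) y),
    ContMDiffAt 𝓘(ℝ, E) (𝓘(ℝ, E).prod 𝓘(ℝ, E)) ∞ (fun y => (TotalSpace.mk' E y (X y) : TangentBundle 𝓘(ℝ, E) M)) x →
    ContMDiffAt 𝓘(ℝ, E) (𝓘(ℝ, E).prod 𝓘(ℝ, E)) ∞ (fun y => (TotalSpace.mk' E y (Y y) : TangentBundle 𝓘(ℝ, E) M)) x →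
    VectorField.mlieBracket 𝓘(ℝ, E) (fun y => L y (X y)) (fun y => L y (Y y)) x
      - L x (VectorField.mlieBracket 𝓘(ℝ, E) (fun y => L y (X y)) Y x)
      - L x (VectorField.mlieBracket 𝓘(ℝ, E) X (fun y => L y (Y y)) x)
      - VectorField.mlieBracket 𝓘(ℝ, E) X Y x = 0

variable (E M) in
/-- A hypercomplex structure on `M`: a smooth action of the quaternions on the tangent bundle such
that every `L` with `L² = -1` acts as an integrable almost complex structure. -/
structure HypercomplexStructure where
  act : ∀ x : M, ℍ[ℝ] →ₐ[ℝ] (TangentSpace 𝓘(ℝ, E) x →L[ℝ] TangentSpace 𝓘(ℝ, E) x)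
  smooth : ∀ q : ℍ[ℝ], ContMDiff 𝓘(ℝ, E) (𝓘(ℝ, E).prod 𝓘(ℝ, E →L[ℝ] E)) ∞
    (fun x => TotalSpace.mk' (E →L[ℝ] E)
      (E := fun x : M => TangentSpace 𝓘(ℝ, E) x →L[ℝ] TangentSpace 𝓘(ℝ, E) x) x (act x q))
  integrable : ∀ q : ℍ[ℝ], q * q = -1 → IsIntegrableACS (fun x => act x q)

variable (E M) in
/-- A hypercomplex Hermitian manifold: a hypercomplex manifold with a Riemannian metric that is
Hermitian for every complex structure `L ∈ ℍ`, `L² = -1`. -/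
structure HypercomplexHermitian extends HypercomplexStructure E M where
  metric : ContMDiffRiemannianMetric 𝓘(ℝ, E) ∞ E (fun x : M => TangentSpace 𝓘(ℝ, E) x)
  hermitian : ∀ q : ℍ[ℝ], q * q = -1 → ∀ (x : M) (v w : TangentSpace 𝓘(ℝ, E) x),
    metric.inner x (act x q v) (act x q w) = metric.inner x v w

/-- The quaternion `i`. -/
def quatI : ℍ[ℝ] := ⟨0, 1, 0, 0⟩
/-- The quaternion `j`. -/
def quatJ : ℍ[ℝ] := ⟨0, 0, 1, 0⟩
/-- The quaternion `k`. -/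
def quatK : ℍ[ℝ] := ⟨0, 0, 0, 1⟩

namespace HypercomplexHermitian

variable (H : HypercomplexHermitian E M)

/-- The endomorphism of `T_x M` given by a quaternion. -/
def op (q : ℍ[ℝ]) (x : M) : TangentSpace 𝓘(ℝ, E) x →ₗ[ℝ] TangentSpace 𝓘(ℝ, E) x :=
  (H.act x q).toLinearMap

/-- The Riemannian form `s` on `T_x M`. -/
def s (x : M) (v w : TangentSpace 𝓘(ℝ, E) x) : ℝ := H.metric.inner x v w

/-- The natural (contragredient, multiplicative) action of an invertible quaternion on forms:
on covectors `(q α)(v) = α(q⁻¹ v)`. -/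
def formAct (q : ℍ[ℝ]) (η : CForm E M) : CForm E M := fun x => extPull (H.op q⁻¹ x) (η x)

variable [FiniteDimensional ℝ E]

/-- The two-form `ω_L(v, w) = s(v, L w)`. -/
def omegaForm (q : ℍ[ℝ]) : CForm E M := fun x => twoForm (fun v w => H.s x v (H.op q x w))

/-- `Ω = ½ (ω_J + i ω_K)`. -/
def Omega : CForm E M :=
  (1 / 2 : ℂ) • (H.omegaForm quatJ + Complex.I • H.omegaForm quatK)

/-- The Dolbeault differential `∂̄` of `(M, I)`: on forms of type `(p,q)`, the part of type
`(p,q+1)` of the de Rham differential (the part with the same holomorphic degree `p`). -/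
def dbar (η : CForm E M) : CForm E M := fun x =>
  ∑ p ∈ Finset.range (finrank ℝ E + 1),
    holPart (H.op quatI x) p (CForm.d (fun y => holPart (H.op quatI y) p (η y)) x)

/-- The complex-linear Hodge star operator of the metric `s`. -/
def star (η : CForm E M) : CForm E M := fun x => hodgeStar (H.s x) (H.op quatI x) (η x)

/-- The Hermitian adjoint `∂* = - * ∂̄ *` of `∂`. Here `*` is complex-linear, so that
`∂̄` occurs: with `★ η = * (conj η)` this is the operator `- ★ ∂ ★`. -/
def delStar (η : CForm E M) : CForm E M := -H.star (H.dbar (H.star η))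

/-- `δ_J* = -[L_Ω, ∂*]`, where `L_Ω` is the multiplication by `Ω`. -/
def deltaJStar (η : CForm E M) : CForm E M :=
  -(H.Omega * H.delStar η - H.delStar (H.Omega * η))

/-- `∂_J = J ∘ ∂̄ ∘ J⁻¹`. Since `J` is multiplicative, this is the extension of `f ↦ J(∂̄ f)` to
forms of type `(p,0)` by the graded Leibniz rule. -/
def delJ (η : CForm E M) : CForm E M :=
  H.formAct quatJ (H.dbar (H.formAct quatJ⁻¹ η))

end HypercomplexHermitian

end Hypercomplex

/-! ### The algebra of smooth forms of type `(*,0)` -/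

section SmoothForms

variable {E : Type*} [NormedAddCommGroup E] [NormedSpace ℝ E] [FiniteDimensional ℝ E]
variable {M : Type*} [TopologicalSpace M] [ChartedSpace E M]

theorem extCoord_mul_contDiffOn {S : Set E} {f g : E → CExt E}
    (hf : ContDiffOn ℝ ∞ (fun y => extCoord E (f y)) S)
    (hg : ContDiffOn ℝ ∞ (fun y => extCoord E (g y)) S) :
    ContDiffOn ℝ ∞ (fun y => extCoord E (f y * g y)) S := by
  classical
  have key : ∀ y, extCoord E (f y * g y) = ∑ a, ∑ b,
      (extCoord E (f y) a * extCoord E (g y) b) •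
        extCoord E ((coBasis E).ExteriorAlgebra a * (coBasis E).ExteriorAlgebra b) := by
    intro y
    conv_lhs => rw [← (coBasis E).ExteriorAlgebra.sum_equivFun (f y),
      ← (coBasis E).ExteriorAlgebra.sum_equivFun (g y)]
    simp only [Finset.sum_mul, Finset.mul_sum, map_sum, smul_mul_smul_comm, map_smul]
    rw [Finset.sum_comm]
    rfl
  simp only [key]
  refine ContDiffOn.sum fun a _ => ContDiffOn.sum fun b _ => ?_
  exact ((contDiffOn_pi.1 hf a).mul (contDiffOn_pi.1 hg b)).smul contDiffOn_const

theorem CForm.IsSmooth.mul {α β : CForm E M} (hα : CForm.IsSmooth α) (hβ : CForm.IsSmooth β) :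
    CForm.IsSmooth (α * β) := by
  intro x₀
  have h := extCoord_mul_contDiffOn (hα x₀) (hβ x₀)
  simpa only [CForm.inChart, Pi.mul_apply, map_mul] using h

theorem CForm.IsSmooth.add {α β : CForm E M} (hα : CForm.IsSmooth α) (hβ : CForm.IsSmooth β) :
    CForm.IsSmooth (α + β) := by
  intro x₀
  have h := (hα x₀).add (hβ x₀)
  refine h.congr fun y _ => ?_
  simp only [CForm.inChart, Pi.add_apply, map_add]

/-- A complex-valued function as a form of degree zero. -/
def CForm.ofFun (f : M → ℂ) : CForm E M := fun x => algebraMap ℂ _ (f x)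

theorem CForm.isSmooth_ofFun {f : M → ℂ} [IsManifold 𝓘(ℝ, E) ∞ M]
    (hf : ContMDiff 𝓘(ℝ, E) 𝓘(ℝ, ℂ) ∞ f) : CForm.IsSmooth (CForm.ofFun f : CForm E M) := by
  intro x₀
  have h1 : ContDiffOn ℝ ∞ (f ∘ (extChartAt 𝓘(ℝ, E) x₀).symm) (extChartAt 𝓘(ℝ, E) x₀).target := by
    rw [← contMDiffOn_iff_contDiffOn]
    exact hf.comp_contMDiffOn (contMDiffOn_extChartAt_symm x₀)
  have h2 : ∀ y, extCoord E (CForm.inChart x₀ (CForm.ofFun f : CForm E M) y) =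
      (f ∘ (extChartAt 𝓘(ℝ, E) x₀).symm) y • extCoord E 1 := by
    intro y
    simp only [CForm.inChart, CForm.ofFun, map_one, Algebra.algebraMap_eq_smul_one,
      map_smul, Function.comp_apply]
  simp only [h2]
  exact h1.smul contDiffOn_const

variable [IsManifold 𝓘(ℝ, E) ∞ M] (H : HypercomplexHermitian E M)

/-- The graded commutative algebra `Λ^{*,0}_I(M)` of smooth forms of type `(*,0)` on `(M, I)`. -/
def LambdaStar0 : Subalgebra ℂ (CForm E M) where
  carrier := {η | CForm.IsSmooth η ∧ ∀ x, η x ∈ extStar0 (H.op quatI x)}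
  mul_mem' := fun ha hb => ⟨CForm.IsSmooth.mul ha.1 hb.1, fun x => mul_mem (ha.2 x) (hb.2 x)⟩
  add_mem' := fun ha hb => ⟨CForm.IsSmooth.add ha.1 hb.1, fun x => add_mem (ha.2 x) (hb.2 x)⟩
  algebraMap_mem' := fun c =>
    ⟨CForm.isSmooth_ofFun (f := fun _ => c) contMDiff_const,
      fun x => Subalgebra.algebraMap_mem (extStar0 (H.op quatI x)) c⟩

/-- The space `Λ^{p,0}_I(M)` of smooth forms of type `(p,0)`. -/
def LambdaP0 (p : ℕ) : Submodule ℂ (LambdaStar0 H) where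
  carrier := {η | ∀ x, (η : CForm E M) x ∈ extP0 (H.op quatI x) p}
  add_mem' := fun ha hb x => add_mem (ha x) (hb x)
  zero_mem' := fun _ => zero_mem _
  smul_mem' := fun c _ ha x => Submodule.smul_mem _ c (ha x)

/-- A smooth function, as an element of `Λ^{0,0}_I(M)`. -/
def smoothFun (f : C^∞⟮𝓘(ℝ, E), M; 𝓘(ℝ, ℂ), ℂ⟯) : LambdaStar0 H :=
  ⟨CForm.ofFun f, CForm.isSmooth_ofFun f.contMDiff,
    fun x => Subalgebra.algebraMap_mem (extStar0 (H.op quatI x)) (f x)⟩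

/-! ### Differential operators over smooth functions -/

/-- The commutator `[D, f]` with the multiplication by a smooth function `f`. -/
def funComm (D : Module.End ℂ (LambdaStar0 H)) (f : C^∞⟮𝓘(ℝ, E), M; 𝓘(ℝ, ℂ), ℂ⟯) :
    Module.End ℂ (LambdaStar0 H) :=
  D * LinearMap.mulLeft ℂ (smoothFun H f) - LinearMap.mulLeft ℂ (smoothFun H f) * D

/-- `D` is a differential operator of order at most `k` over `C^∞(M)` (in the usual sense). -/
def IsDiffOpOverFun : ℕ → Module.End ℂ (LambdaStar0 H) → Prop
  | 0, D => ∀ f, funComm H D f = 0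
  | k + 1, D => ∀ f, IsDiffOpOverFun k (funComm H D f)

/-- Equality of the symbols of two first-order operators. The symbol of such an operator `D` is the
bundle map `σ_D` with `σ_D(df) = [D, f]`; every covector at a point is some `df`. -/
def SameSymbol (D D' : Module.End ℂ (LambdaStar0 H)) : Prop :=
  ∀ f, funComm H D f = funComm H D' f

end SmoothForms

/-! ### Differential operators on a graded commutative algebra -/

section Grothendieck

variable {A : Type*} [Ring A] [Algebra ℂ A] (𝒜 : ℕ → Submodule ℂ A)

/-- The sum of the graded pieces of parity `c`. -/
def parityPart (c : ZMod 2) : Submodule ℂ A := ⨆ (p : ℕ) (_ : (p : ZMod 2) = c), 𝒜 p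

/-- `D` is a pure operator of parity `e`. -/
def HasParity (e : ZMod 2) (D : Module.End ℂ A) : Prop :=
  ∀ c, ∀ a ∈ parityPart 𝒜 c, D a ∈ parityPart 𝒜 (c + e)

/-- The sign `(-1)^c`. -/
def paritySign (c : ZMod 2) : ℂ := if c = 0 then 1 else -1

/-- The supercommutator `[P, Q] = P Q - (-1)^{c e} Q P` of pure operators of parities `c`, `e`. -/
def superComm (c e : ZMod 2) (P Q : Module.End ℂ A) : Module.End ℂ A :=
  P * Q - paritySign (c * e) • (Q * P)

/-- The set `D_k(A)` of differential operators of order at most `k` on a graded commutative algebra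
`A`. `D_0(A)` consists of the multiplications by elements of `A`, and `D ∈ D_{k+1}(A)` if the
supercommutators `[a, D]` with the multiplications by pure elements `a ∈ A` are in `D_k(A)`.
The supercommutator with `D` is the sum of those with its even and odd parts `D₀`, `D₁`. -/
def gradedDiffOp : ℕ → Set (Module.End ℂ A)
  | 0 => {D | ∃ a : A, D = LinearMap.mulLeft ℂ a}
  | k + 1 => {D | ∃ D₀ D₁ : Module.End ℂ A,
      HasParity 𝒜 0 D₀ ∧ HasParity 𝒜 1 D₁ ∧ D = D₀ + D₁ ∧
      ∀ c, ∀ a ∈ parityPart 𝒜 c,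
        superComm c 0 (LinearMap.mulLeft ℂ a) D₀ + superComm c 1 (LinearMap.mulLeft ℂ a) D₁
          ∈ gradedDiffOp k}

end Grothendieck

end

/-! Let n = 2m be the real dimension, and let θ♯ be the vector dual to a covector θ for the
complex-bilinear dual metric. Covectors of type (1,0) are isotropic, so contraction with θ♯ for θ of
type (1,0) preserves the holomorphic degree (`dualMetric_of_mem`, `holPart_intProd_of_proj10`). The
volume form has type (m,m); hence * sends forms of type (*,0) to forms of holomorphic degree m, on
which ∂̄ is the holomorphic degree m part of d. Moreover * exchanges right multiplication by a
covector with contraction by its dual vector (`hodgeL_mul_ι`, `hodgeL_intProd`), and ** = (-1)^k in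
degree k (`hodgeL_hodgeL`).

Symbols. Conjugating d(f *η) = df ∧ *η + f d*η by * gives [∂*, f] = -(contraction with (∂̄f)♯), by
`delStarE_smul`. Contraction is an antiderivation, so its commutator with the even form Ω is
multiplication by the contraction of Ω. For a (0,1)-covector α, contracting Ω with α♯ gives α ∘ J
(`intProd_holSympForm_proj01`), which is -Jα. The same multiplication arises from ∂_J, where the
Leibniz rule for ∂̄ is conjugated by J (`delJE_smul`). Hence the symbols agree, and both operators
have order at most 1 over functions.

Graded order. ∂* behaves like a Batalin-Vilkovisky operator of second order. By Cartan's formula the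
supercommutator of ∂* with a (1,0)-covector field θ is, up to sign, the Lie derivative along θ♯
conjugated by * (`delStarE_mul_ι`). The commutator of a Lie derivative with a contraction is a
contraction (`lieD_intProd`), which * turns back into a multiplication (`lieStar_mul_ι`). So the
commutator with θ is of first order (`lieStar_mul`). Since Ω is even, the Jacobi identity moves the
commutator with Ω outside and shows that [δ_J*, θ] is a multiplication (`deltaE_mul_ι`). Locally the
forms of type (*,0) are generated by functions and (1,0)-covector fields
(`IsLocalHermitian.holForm_induction`), so δ_J*(ab) = δ_J*(a) b ± a(δ_J*(b) - δ_J*(1) b) for pure a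
(`deltaE_mul_eq`). This is membership in D_1.

All this is proved for variable structures on an open subset of E and transported by charts; the
only analytic input there is that d commutes with pull-back (`CForm.IsSmooth.inChart_d`). Degrees
and types are detected throughout by the automorphisms that scale covectors, because their
eigenvalues 2^k are distinct. -/

noncomputable section

open ExteriorAlgebra

/-! ### Contractions and gradings of the exterior algebra -/

namespace ExteriorAlgebra

variable {V W : Type*} [AddCommGroup V] [Module ℂ V] [AddCommGroup W] [Module ℂ W]

/-- Contraction of an element of the exterior algebra with a functional. -/
abbrev intProd (d : Module.Dual ℂ V) : ExteriorAlgebra ℂ V →ₗ[ℂ] ExteriorAlgebra ℂ V :=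
  CliffordAlgebra.contractLeft (Q := (0 : QuadraticForm ℂ V)) d

theorem intProd_ι_mul (d : Module.Dual ℂ V) (a : V) (ξ : ExteriorAlgebra ℂ V) :
    intProd d (ι ℂ a * ξ) = d a • ξ - ι ℂ a * intProd d ξ :=
  CliffordAlgebra.contractLeft_ι_mul d a ξ

theorem intProd_algebraMap (d : Module.Dual ℂ V) (r : ℂ) :
    intProd d (algebraMap ℂ _ r) = 0 := CliffordAlgebra.contractLeft_algebraMap (0 : QuadraticForm ℂ V) d r

theorem intProd_one (d : Module.Dual ℂ V) : intProd d 1 = 0 :=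
  CliffordAlgebra.contractLeft_one (0 : QuadraticForm ℂ V) d

theorem intProd_add_left (d d' : Module.Dual ℂ V) (ξ : ExteriorAlgebra ℂ V) :
    intProd (d + d') ξ = intProd d ξ + intProd d' ξ := by
  simp [intProd]

theorem intProd_smul_left (c : ℂ) (d : Module.Dual ℂ V) (ξ : ExteriorAlgebra ℂ V) :
    intProd (c • d) ξ = c • intProd d ξ := by
  simp [intProd]

theorem intProd_comm (d d' : Module.Dual ℂ V) (ξ : ExteriorAlgebra ℂ V) :
    intProd d (intProd d' ξ) = -intProd d' (intProd d ξ) :=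
  CliffordAlgebra.contractLeft_comm d d' ξ

/-- Induction on elements of the exterior algebra, by multiplication with covectors on the left. -/
theorem left_induction {P : ExteriorAlgebra ℂ V → Prop}
    (scalar : ∀ r : ℂ, P (algebraMap ℂ _ r)) (add : ∀ x y, P x → P y → P (x + y))
    (ι_mul : ∀ m x, P x → P (ι ℂ m * x)) (x : ExteriorAlgebra ℂ V) : P x :=
  CliffordAlgebra.left_induction (0 : QuadraticForm ℂ V) scalar add (fun x m h => ι_mul m x h) x

/-- Induction on elements of the exterior algebra, by multiplication with covectors on the right. -/
theorem right_induction {P : ExteriorAlgebra ℂ V → Prop}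
    (scalar : ∀ r : ℂ, P (algebraMap ℂ _ r)) (add : ∀ x y, P x → P y → P (x + y))
    (mul_ι : ∀ m x, P x → P (x * ι ℂ m)) (x : ExteriorAlgebra ℂ V) : P x :=
  CliffordAlgebra.right_induction (0 : QuadraticForm ℂ V) scalar add mul_ι x

/-- Contraction is natural with respect to linear maps. -/
theorem map_intProd (f : V →ₗ[ℂ] W) (d : Module.Dual ℂ W) (ξ : ExteriorAlgebra ℂ V) :
    intProd d (map f ξ) = map f (intProd (d ∘ₗ f) ξ) := by
  induction ξ using left_induction with
  | scalar r => rw [AlgHom.commutes, intProd_algebraMap, intProd_algebraMap, map_zero]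
  | add x y hx hy => simp only [map_add, hx, hy]
  | ι_mul m x hx =>
    rw [map_mul, map_apply_ι, intProd_ι_mul, hx, intProd_ι_mul, map_sub, map_smul, map_mul,
      map_apply_ι, LinearMap.comp_apply]

theorem map_map_apply {X : Type*} [AddCommGroup X] [Module ℂ X] (f : V →ₗ[ℂ] W) (g : W →ₗ[ℂ] X)
    (ξ : ExteriorAlgebra ℂ V) : map g (map f ξ) = map (g ∘ₗ f) ξ := by
  rw [← map_comp_map, AlgHom.comp_apply]

theorem map_id_apply (ξ : ExteriorAlgebra ℂ V) :
    map (LinearMap.id : V →ₗ[ℂ] V) ξ = ξ := by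
  rw [map_id, AlgHom.id_apply]

/-- The automorphism that multiplies forms of degree `k` by `t ^ k`. -/
def scale (t : ℂ) : ExteriorAlgebra ℂ V →ₐ[ℂ] ExteriorAlgebra ℂ V := map (t • LinearMap.id)

theorem scale_ι (t : ℂ) (a : V) : scale t (ι ℂ a) = t • ι ℂ a := by
  rw [scale, map_apply_ι, LinearMap.smul_apply, LinearMap.id_apply, map_smul]

theorem scale_map (t : ℂ) (f : V →ₗ[ℂ] W) (ξ : ExteriorAlgebra ℂ V) :
    scale t (map f ξ) = map f (scale t ξ) := by
  rw [scale, scale, map_map_apply, map_map_apply]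
  congr 1
  ext; simp

/-- The grade involution. -/
abbrev invol : ExteriorAlgebra ℂ V →ₐ[ℂ] ExteriorAlgebra ℂ V := scale (-1)

theorem invol_ι (a : V) : invol (ι ℂ a) = -ι ℂ a := by
  rw [invol, scale_ι, neg_one_smul]

theorem invol_invol (ξ : ExteriorAlgebra ℂ V) : invol (invol ξ) = ξ := by
  rw [invol, scale, map_map_apply]
  convert map_id_apply ξ using 3
  ext; simp

/-- Covectors supercommute with forms. -/
theorem mul_ι_eq (a : V) (ξ : ExteriorAlgebra ℂ V) : ξ * ι ℂ a = ι ℂ a * invol ξ := by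
  induction ξ using left_induction with
  | scalar r => rw [AlgHom.commutes, Algebra.commutes]
  | add x y hx hy => rw [add_mul, hx, hy, map_add, mul_add]
  | ι_mul m x hx =>
    rw [mul_assoc, hx, map_mul, invol_ι, ← mul_assoc, neg_mul, mul_neg, ← mul_assoc,
      eq_neg_iff_add_eq_zero, ← add_mul, ι_add_mul_swap, zero_mul]

theorem ι_mul_eq (a : V) (ξ : ExteriorAlgebra ℂ V) : ι ℂ a * ξ = invol ξ * ι ℂ a := by
  rw [mul_ι_eq, invol_invol]

/-- Passing a covector across an even form costs no sign, and covectors generate. This makes Ω and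
the Hermitian form central. -/
theorem mul_comm_of_invol {b : ExteriorAlgebra ℂ V} (hb : invol b = b)
    (ξ : ExteriorAlgebra ℂ V) : b * ξ = ξ * b := by
  induction ξ using left_induction with
  | scalar r => rw [Algebra.commutes]
  | add x y hx hy => rw [add_mul, mul_add, hx, hy]
  | ι_mul m x hx => rw [← mul_assoc, mul_ι_eq, hb, mul_assoc, hx, mul_assoc]

theorem intProd_scale (t : ℂ) (d : Module.Dual ℂ V) (ξ : ExteriorAlgebra ℂ V) :
    intProd d (scale t ξ) = t • scale t (intProd d ξ) := by
  rw [scale, map_intProd, LinearMap.comp_smul, LinearMap.comp_id, intProd_smul_left, map_smul]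

/-- Contraction is an antiderivation. -/
theorem intProd_mul (d : Module.Dual ℂ V) (α β : ExteriorAlgebra ℂ V) :
    intProd d (α * β) = intProd d α * β + invol α * intProd d β := by
  induction α using left_induction with
  | scalar r =>
    rw [intProd_algebraMap, zero_mul, zero_add, AlgHom.commutes, ← Algebra.smul_def, map_smul,
      Algebra.smul_def]
  | add x y hx hy => rw [add_mul, map_add, hx, hy, map_add, map_add, add_mul, add_mul]; abel
  | ι_mul m x hx =>
    rw [mul_assoc, intProd_ι_mul, hx, intProd_ι_mul, map_mul, invol_ι, sub_mul, mul_add,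
      smul_mul_assoc, neg_mul, neg_mul, mul_assoc, mul_assoc]
    abel

end ExteriorAlgebra


/-! ### Types of forms -/

section Types

variable {T : Type*} [AddCommGroup T] [Module ℝ T]

theorem covPull_apply {T' : Type*} [AddCommGroup T'] [Module ℝ T'] (A : T →ₗ[ℝ] T')
    (α : CDual T') (v : T) : covPull A α v = α (A v) := rfl

theorem extPull_extPull {T' T'' : Type*} [AddCommGroup T'] [Module ℝ T'] [AddCommGroup T'']
    [Module ℝ T''] (A : T →ₗ[ℝ] T') (B : T' →ₗ[ℝ] T'') (ξ : CExt T'') :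
    extPull A (extPull B ξ) = extPull (B ∘ₗ A) ξ := by
  rw [extPull, extPull, map_map_apply]; rfl

theorem extPull_id (ξ : CExt T) : extPull LinearMap.id ξ = ξ := map_id_apply ξ

theorem extPull_ι {T' : Type*} [AddCommGroup T'] [Module ℝ T'] (A : T →ₗ[ℝ] T') (α : CDual T') :
    extPull A (ι ℂ α) = ι ℂ (covPull A α) := map_apply_ι _ _

variable (I : T →ₗ[ℝ] T)

theorem proj10_add_proj01 (α : CDual T) : proj10 I α + proj01 I α = α := by
  simp only [proj10, proj01, LinearMap.smul_apply, LinearMap.sub_apply, LinearMap.add_apply,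
    LinearMap.id_apply, ← smul_add]
  rw [sub_add_add_cancel, ← two_smul ℂ α, smul_smul]
  norm_num

theorem holPart_algebraMap_zero (r : ℂ) :
    holPart I 0 (algebraMap ℂ (CExt T) r) = algebraMap ℂ (CExt T) r := by
  rw [holPart, AlgHom.commutes, Polynomial.algebraMap_apply, Polynomial.coeff_C_zero]

theorem holPart_algebraMap_succ (r : ℂ) (p : ℕ) :
    holPart I (p + 1) (algebraMap ℂ (CExt T) r) = 0 := by
  rw [holPart, AlgHom.commutes, Polynomial.algebraMap_apply, Polynomial.coeff_C_succ]

theorem holWeight_ι (α : CDual T) : holWeight I (ι ℂ α) =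
    Polynomial.monomial 1 (ι ℂ (proj10 I α)) + Polynomial.monomial 0 (ι ℂ (proj01 I α)) :=
  lift_ι_apply ℂ _ _ _

/-- This recursion and `holPart_succ_ι_mul` read off the coefficients of a product with the linear
polynomial α^{1,0} X + α^{0,1}. They replace the polynomial in almost all later inductions. -/
theorem holPart_zero_ι_mul (α : CDual T) (ξ : CExt T) :
    holPart I 0 (ι ℂ α * ξ) = ι ℂ (proj01 I α) * holPart I 0 ξ := by
  rw [holPart, map_mul, holWeight_ι, Polynomial.mul_coeff_zero]
  simp [holPart]

theorem holPart_succ_ι_mul (p : ℕ) (α : CDual T) (ξ : CExt T) :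
    holPart I (p + 1) (ι ℂ α * ξ) =
      ι ℂ (proj10 I α) * holPart I p ξ + ι ℂ (proj01 I α) * holPart I (p + 1) ξ := by
  rw [holPart, map_mul, holWeight_ι, add_mul, Polynomial.coeff_add,
    Polynomial.coeff_monomial_mul, Polynomial.coeff_monomial_zero_mul]
  rfl

/-- The projection `holPart` as a linear map. -/
def holPartL (p : ℕ) : CExt T →ₗ[ℂ] CExt T where
  toFun := holPart I p
  map_add' a b := by simp [holPart]
  map_smul' c a := by simp [holPart]

theorem holPart_add (p : ℕ) (a b : CExt T) :
    holPart I p (a + b) = holPart I p a + holPart I p b := (holPartL I p).map_add a b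

theorem holPart_smul (p : ℕ) (c : ℂ) (a : CExt T) :
    holPart I p (c • a) = c • holPart I p a := (holPartL I p).map_smul c a

theorem holPart_sub (p : ℕ) (a b : CExt T) :
    holPart I p (a - b) = holPart I p a - holPart I p b := (holPartL I p).map_sub a b

theorem holPart_zero (p : ℕ) : holPart I p (0 : CExt T) = 0 := (holPartL I p).map_zero

/-- The constant coefficient is the value at X = 0, where the weight homomorphism becomes the one
induced by α ↦ α^{0,1}. -/
theorem holPart_zero_eq (ξ : CExt T) : holPart I 0 ξ = map (proj01 I) ξ := by
  induction ξ using left_induction with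
  | scalar r => rw [holPart_algebraMap_zero, AlgHom.commutes]
  | add x y hx hy => rw [holPart_add, hx, hy, map_add]
  | ι_mul m x hx => rw [holPart_zero_ι_mul, hx, map_mul, map_apply_ι]

/-- Contraction with a functional that vanishes on `(1,0)`-covectors preserves the holomorphic
degree. -/
theorem holPart_intProd_of_proj10 {d : Module.Dual ℂ (CDual T)} (hd : ∀ α, d (proj10 I α) = 0)
    (p : ℕ) (ξ : CExt T) : holPart I p (intProd d ξ) = intProd d (holPart I p ξ) := by
  have hd' : ∀ α, d (proj01 I α) = d α := fun α => by
    conv_rhs => rw [← proj10_add_proj01 I α, map_add, hd, zero_add]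
  induction ξ using left_induction generalizing p with
  | scalar r =>
    rw [intProd_algebraMap, holPart_zero]
    cases p with
    | zero => rw [holPart_algebraMap_zero, intProd_algebraMap]
    | succ p => rw [holPart_algebraMap_succ, map_zero]
  | add x y hx hy => rw [map_add, holPart_add, hx, hy, holPart_add, map_add]
  | ι_mul m x hx =>
    rw [intProd_ι_mul, holPart_sub, holPart_smul]
    cases p with
    | zero => rw [holPart_zero_ι_mul, holPart_zero_ι_mul, intProd_ι_mul, hx, hd']
    | succ p =>
      rw [holPart_succ_ι_mul, holPart_succ_ι_mul, map_add, intProd_ι_mul, intProd_ι_mul, hx, hx,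
        hd, hd', zero_smul]
      abel

/-- Contraction with a functional that vanishes on `(0,1)`-covectors lowers the holomorphic
degree by one. -/
theorem holPart_intProd_of_proj01 {d : Module.Dual ℂ (CDual T)} (hd : ∀ α, d (proj01 I α) = 0)
    (p : ℕ) (ξ : CExt T) : holPart I p (intProd d ξ) = intProd d (holPart I (p + 1) ξ) := by
  have hd' : ∀ α, d (proj10 I α) = d α := fun α => by
    conv_rhs => rw [← proj10_add_proj01 I α, map_add, hd, add_zero]
  induction ξ using left_induction generalizing p with
  | scalar r =>
    rw [intProd_algebraMap, holPart_zero, holPart_algebraMap_succ, map_zero]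
  | add x y hx hy => rw [map_add, holPart_add, hx, hy, holPart_add, map_add]
  | ι_mul m x hx =>
    rw [intProd_ι_mul, holPart_sub, holPart_smul, holPart_succ_ι_mul, map_add, intProd_ι_mul,
      intProd_ι_mul, hd, hd', zero_smul]
    cases p with
    | zero =>
      -- The bottom case has no lower holomorphic part to cancel this term; it vanishes because a
      -- (0,*)-form contains only (0,1)-covectors, which `d` kills.
      have h0 : intProd d (holPart I 0 x) = 0 := by
        have : d ∘ₗ proj01 I = 0 := LinearMap.ext hd
        rw [holPart_zero_eq, map_intProd, this]
        simp [intProd]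
      rw [holPart_zero_ι_mul, hx, h0, mul_zero, sub_zero, zero_sub, ← sub_eq_add_neg]
    | succ p => rw [holPart_succ_ι_mul, hx, hx]; abel

/-! #### Decomposition into types -/

theorem covPull_neg (α : CDual T) : covPull (-I) α = -covPull I α := by
  ext v; simp [covPull_apply]

/-- Passing to the conjugate structure -I swaps the two types, so each fact about (1,0) also yields
its (0,1) version. -/
theorem proj10_neg : proj10 (-I) = proj01 I := by
  ext α v
  simp [proj10, proj01, covPull_neg]

theorem proj01_neg : proj01 (-I) = proj10 I := by
  ext α v
  simp [proj10, proj01, covPull_neg, sub_eq_add_neg]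

theorem proj10_apply_eq (α : CDual T) :
    proj10 I α = (1 / 2 : ℂ) • (α - Complex.I • covPull I α) := rfl

theorem proj01_apply_eq (α : CDual T) :
    proj01 I α = (1 / 2 : ℂ) • (α + Complex.I • covPull I α) := rfl

variable {I}

theorem mem_type10 {α : CDual T} : α ∈ type10 I ↔ covPull I α = Complex.I • α := Iff.rfl

theorem proj10_of_mem {α : CDual T} (h : α ∈ type10 I) : proj10 I α = α := by
  rw [mem_type10] at h
  rw [proj10_apply_eq, h, smul_smul, Complex.I_mul_I, neg_one_smul, sub_neg_eq_add,
    ← two_smul ℂ α, smul_smul]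
  norm_num

theorem proj01_of_mem {α : CDual T} (h : α ∈ type10 I) : proj01 I α = 0 := by
  have := proj10_add_proj01 I α
  rwa [proj10_of_mem h, add_eq_left] at this

theorem covPull_I_I (hI : ∀ v, I (I v) = -v) (α : CDual T) : covPull I (covPull I α) = -α := by
  ext v; simp [covPull_apply, hI]

theorem proj10_mem (hI : ∀ v, I (I v) = -v) (α : CDual T) : proj10 I α ∈ type10 I := by
  rw [mem_type10, proj10_apply_eq, map_smul, map_sub, map_smul, covPull_I_I hI, smul_comm]
  congr 1
  rw [smul_sub, smul_smul, Complex.I_mul_I, smul_neg, neg_one_smul, sub_neg_eq_add,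
    sub_neg_eq_add, add_comm]

theorem proj10_proj10 (hI : ∀ v, I (I v) = -v) (α : CDual T) :
    proj10 I (proj10 I α) = proj10 I α := proj10_of_mem (proj10_mem hI α)

theorem proj01_proj10 (hI : ∀ v, I (I v) = -v) (α : CDual T) :
    proj01 I (proj10 I α) = 0 := proj01_of_mem (proj10_mem hI α)

theorem proj01_proj01 (hI : ∀ v, I (I v) = -v) (α : CDual T) :
    proj01 I (proj01 I α) = proj01 I α := by
  rw [← proj10_neg]
  exact proj10_proj10 (I := -I) (fun v => by simp [hI]) α

theorem proj10_proj01 (hI : ∀ v, I (I v) = -v) (α : CDual T) :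
    proj10 I (proj01 I α) = 0 := by
  rw [← proj10_neg, ← proj01_neg]
  exact proj01_proj10 (I := -I) (fun v => by simp [hI]) α

theorem scale_holPart (t : ℂ) (p : ℕ) (ξ : CExt T) :
    scale t (holPart I p ξ) = holPart I p (scale t ξ) := by
  induction ξ using left_induction generalizing p with
  | scalar r =>
    rw [AlgHom.commutes]
    cases p with
    | zero => rw [holPart_algebraMap_zero, AlgHom.commutes]
    | succ p => rw [holPart_algebraMap_succ, map_zero]
  | add x y hx hy => rw [map_add, holPart_add, map_add, hx, hy, holPart_add]
  | ι_mul m x hx =>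
    rw [map_mul, scale_ι, smul_mul_assoc, holPart_smul]
    cases p with
    | zero => rw [holPart_zero_ι_mul, holPart_zero_ι_mul, map_mul, scale_ι, hx, smul_mul_assoc]
    | succ p =>
      rw [holPart_succ_ι_mul, holPart_succ_ι_mul, map_add, map_mul, map_mul, scale_ι, scale_ι,
        hx, hx, smul_add, smul_mul_assoc, smul_mul_assoc]

/-- The sum of all coefficients of the weight polynomial is the original form. -/
theorem holWeight_eval (ξ : CExt T) :
    Polynomial.eval₂RingHom' (RingHom.id (CExt T)) 1 (fun a => Commute.one_right a)
      (holWeight I ξ) = ξ := by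
  induction ξ using left_induction with
  | scalar r =>
    rw [AlgHom.commutes, Polynomial.algebraMap_apply]
    exact (Polynomial.eval₂_C _ _)
  | add x y hx hy => rw [map_add, map_add, hx, hy]
  | ι_mul m x hx =>
    rw [map_mul, map_mul, hx, holWeight_ι]
    congr 1
    rw [map_add]
    have h : ∀ (k : ℕ) (a : CExt T), Polynomial.eval₂RingHom' (RingHom.id (CExt T)) 1
        (fun a => Commute.one_right a) (Polynomial.monomial k a) = a := fun k a => by
      refine (Polynomial.eval₂_monomial _ _).trans ?_
      rw [one_pow, mul_one, RingHom.id_apply]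
    rw [h, h, ← map_add, proj10_add_proj01]

/-- The weight polynomial is then a single monomial, and its value at X = 1 is the form itself. -/
theorem holPart_eq_self {p : ℕ} {ξ : CExt T} (h : ∀ q, q ≠ p → holPart I q ξ = 0) :
    holPart I p ξ = ξ := by
  have h1 : holWeight I ξ = Polynomial.monomial p (holPart I p ξ) := by
    ext1 q
    rw [Polynomial.coeff_monomial]
    split_ifs with hq
    · rw [hq]; rfl
    · exact h q (Ne.symm hq)
  have h2 := holWeight_eval (I := I) ξ
  rw [h1] at h2
  refine Eq.trans ?_ h2
  refine Eq.trans ?_ (Polynomial.eval₂_monomial _ _).symm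
  rw [one_pow, mul_one, RingHom.id_apply]

/-- Here `I² = -1` enters: it makes `proj10` and `proj01` complementary idempotents, so a
coefficient of the weight polynomial is itself homogeneous. -/
theorem holWeight_holPart (hI : ∀ v, I (I v) = -v) (q : ℕ) (ξ : CExt T) :
    holWeight I (holPart I q ξ) = Polynomial.monomial q (holPart I q ξ) := by
  induction ξ using left_induction generalizing q with
  | scalar r =>
    cases q with
    | zero => rw [holPart_algebraMap_zero, AlgHom.commutes, Polynomial.algebraMap_apply]; rfl
    | succ q => rw [holPart_algebraMap_succ, map_zero, map_zero]
  | add x y hx hy => rw [holPart_add, map_add, hx, hy, map_add]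
  | ι_mul m x hx =>
    cases q with
    | zero =>
      rw [holPart_zero_ι_mul, map_mul, hx, holWeight_ι, proj10_proj01 hI, proj01_proj01 hI,
        map_zero, map_zero, zero_add, Polynomial.monomial_mul_monomial]
    | succ q =>
      rw [holPart_succ_ι_mul, map_add, map_mul, map_mul, hx, hx, holWeight_ι, holWeight_ι,
        proj10_proj01 hI, proj01_proj01 hI, proj10_proj10 hI, proj01_proj10 hI,
        map_zero, map_zero, map_zero, zero_add, add_zero, Polynomial.monomial_mul_monomial,
        Polynomial.monomial_mul_monomial, zero_add, map_add, add_comm 1 q]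

theorem holPart_holPart_of_ne (hI : ∀ v, I (I v) = -v) {p q : ℕ} (h : p ≠ q) (ξ : CExt T) :
    holPart I p (holPart I q ξ) = 0 := by
  rw [holPart, holWeight_holPart hI, Polynomial.coeff_monomial_of_ne _ h]

/-- The automorphism that multiplies forms of type `(p,q)` by `s ^ p * t ^ q`. -/
def typeScale (I : T →ₗ[ℝ] T) (s t : ℂ) : CExt T →ₐ[ℂ] CExt T :=
  map (s • proj10 I + t • proj01 I)

theorem typeScale_ι (s t : ℂ) (α : CDual T) :
    typeScale I s t (ι ℂ α) = s • ι ℂ (proj10 I α) + t • ι ℂ (proj01 I α) := by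
  rw [typeScale, map_apply_ι]
  simp

/-- Holomorphic parts are eigenvectors of the type scaling. With `holPart_typeScale` this converts
between statements about types and statements about eigenvalues. -/
theorem typeScale_holPart (hI : ∀ v, I (I v) = -v) (t : ℂ) (p : ℕ) (ξ : CExt T) :
    typeScale I t 1 (holPart I p ξ) = t ^ p • holPart I p ξ := by
  induction ξ using left_induction generalizing p with
  | scalar r =>
    cases p with
    | zero => rw [holPart_algebraMap_zero, AlgHom.commutes, pow_zero, one_smul]
    | succ p => rw [holPart_algebraMap_succ, map_zero, smul_zero]
  | add x y hx hy => rw [holPart_add, map_add, hx, hy, smul_add]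
  | ι_mul m x hx =>
    cases p with
    | zero =>
      rw [holPart_zero_ι_mul, map_mul, hx, typeScale_ι, proj10_proj01 hI, proj01_proj01 hI,
        map_zero, smul_zero, zero_add, one_smul, pow_zero, one_smul, one_smul]
    | succ p =>
      rw [holPart_succ_ι_mul, map_add, map_mul, map_mul, hx, hx, typeScale_ι, typeScale_ι,
        proj10_proj01 hI, proj01_proj01 hI, proj10_proj10 hI, proj01_proj10 hI,
        map_zero, smul_zero, smul_zero, zero_add, add_zero, one_smul, smul_mul_smul_comm,
        mul_smul_comm, smul_add, pow_succ']

theorem holPart_typeScale (hI : ∀ v, I (I v) = -v) (t : ℂ) (p : ℕ) (ξ : CExt T) :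
    holPart I p (typeScale I t 1 ξ) = t ^ p • holPart I p ξ := by
  induction ξ using left_induction generalizing p with
  | scalar r =>
    rw [AlgHom.commutes]
    cases p with
    | zero => rw [pow_zero, one_smul]
    | succ p => rw [holPart_algebraMap_succ, smul_zero]
  | add x y hx hy => rw [map_add, holPart_add, hx, hy, holPart_add, smul_add]
  | ι_mul m x hx =>
    rw [map_mul, typeScale_ι, add_mul, holPart_add, smul_mul_assoc, smul_mul_assoc, holPart_smul,
      holPart_smul]
    cases p with
    | zero =>
      rw [holPart_zero_ι_mul, holPart_zero_ι_mul, holPart_zero_ι_mul, hx,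
        proj01_proj10 hI, proj01_proj01 hI, map_zero, zero_mul, smul_zero, zero_add, one_smul,
        pow_zero, one_smul, one_smul]
    | succ p =>
      rw [holPart_succ_ι_mul, holPart_succ_ι_mul, holPart_succ_ι_mul, hx, hx,
        proj01_proj10 hI, proj01_proj01 hI, proj10_proj01 hI, proj10_proj10 hI,
        map_zero, zero_mul, zero_mul, add_zero, zero_add, one_smul, smul_add, mul_smul_comm,
        mul_smul_comm, smul_smul, pow_succ']

/-! #### Forms of type `(*,0)` -/

/-- Together with `map_proj10_mem`, this exhibits Λ^{*,0} as the image of an idempotent algebra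
endomorphism. As that endomorphism varies smoothly with I, it also provides smooth generators of the
(*,0)-forms. -/
theorem map_proj10_of_mem {ξ : CExt T} (h : ξ ∈ extStar0 I) : map (proj10 I) ξ = ξ := by
  induction h using Algebra.adjoin_induction with
  | mem x hx =>
    obtain ⟨α, hα, rfl⟩ := hx
    rw [map_apply_ι, proj10_of_mem hα]
  | algebraMap r => rw [AlgHom.commutes]
  | add x y _ _ hx hy => rw [map_add, hx, hy]
  | mul x y _ _ hx hy => rw [map_mul, hx, hy]

theorem map_proj10_mem (hI : ∀ v, I (I v) = -v) (ξ : CExt T) :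
    map (proj10 I) ξ ∈ extStar0 I := by
  induction ξ using left_induction with
  | scalar r => rw [AlgHom.commutes]; exact Subalgebra.algebraMap_mem _ _
  | add x y hx hy => rw [map_add]; exact add_mem hx hy
  | ι_mul m x hx =>
    rw [map_mul, map_apply_ι]
    exact mul_mem (Algebra.subset_adjoin ⟨_, proj10_mem hI m, rfl⟩) hx

/-- The scaling multiplies type (p,q) by 2^q, so a fixed form has only q = 0. The antiholomorphic
degree is measured as the holomorphic degree for -I. -/
theorem mem_extStar0_of_typeScale (hI : ∀ v, I (I v) = -v) {ξ : CExt T}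
    (h : typeScale I 1 2 ξ = ξ) : ξ ∈ extStar0 I := by
  have hI' : ∀ v, (-I) ((-I) v) = -v := fun v => by simp [hI]
  have h1 : typeScale (-I) 2 1 ξ = ξ := by
    rw [typeScale, proj10_neg, proj01_neg, add_comm]
    exact h
  have h2 : holPart (-I) 0 ξ = ξ := by
    refine holPart_eq_self fun q hq => ?_
    have h3 := holPart_typeScale hI' 2 q ξ
    rw [h1] at h3
    by_contra h4
    have h5 : ((2 : ℂ) ^ q - 1) • holPart (-I) q ξ = 0 := by
      rw [sub_smul, one_smul, ← h3, sub_self]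
    rcases smul_eq_zero.1 h5 with h6 | h6
    · have h7 : ((2 ^ q : ℕ) : ℂ) = ((1 : ℕ) : ℂ) := by
        push_cast
        linear_combination h6
      rw [Nat.cast_inj] at h7
      exact hq (by simpa using h7)
    · exact h4 h6
  rw [holPart_zero_eq, proj01_neg] at h2
  rw [← h2]
  exact map_proj10_mem hI ξ

/-- On products of (1,0)-covectors the holomorphic degree is the total degree; the product case is
the convolution formula for coefficients. -/
theorem holPart_mem_extP0 {ξ : CExt T} (h : ξ ∈ extStar0 I) (p : ℕ) :
    holPart I p ξ ∈ extP0 I p := by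
  induction h using Algebra.adjoin_induction generalizing p with
  | mem x hx =>
    obtain ⟨α, hα, rfl⟩ := hx
    rw [holPart, holWeight_ι, proj10_of_mem hα, proj01_of_mem hα, map_zero, map_zero, add_zero,
      Polynomial.coeff_monomial]
    split_ifs with hp
    · rw [← hp, extP0, pow_one]
      exact Submodule.mem_map_of_mem hα
    · exact zero_mem _
  | algebraMap r =>
    cases p with
    | zero => rw [holPart_algebraMap_zero, extP0, pow_zero]; exact Submodule.algebraMap_mem r
    | succ p => rw [holPart_algebraMap_succ]; exact zero_mem _
  | add x y _ _ hx hy => rw [holPart_add]; exact add_mem (hx p) (hy p)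
  | mul x y _ _ hx hy =>
    rw [holPart, map_mul, Polynomial.coeff_mul]
    refine sum_mem fun ij hij => ?_
    rw [← Finset.HasAntidiagonal.mem_antidiagonal.1 hij, extP0, pow_add]
    exact Submodule.mul_mem_mul (hx ij.1) (hy ij.2)

theorem scale_of_mem_extP0 (t : ℂ) {p : ℕ} {ξ : CExt T} (h : ξ ∈ extP0 I p) :
    scale t ξ = t ^ p • ξ := by
  rw [extP0] at h
  induction h using Submodule.pow_induction_on_left' with
  | algebraMap r => rw [AlgHom.commutes, pow_zero, one_smul]
  | add x y i _ _ hx hy => rw [map_add, hx, hy, smul_add]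
  | mem_mul m hm i x _ hx =>
    obtain ⟨α, -, rfl⟩ := hm
    rw [map_mul, scale_ι, hx, smul_mul_smul_comm, pow_succ']

/-- A holomorphic part of degree q has eigenvalue 2^q, and q ↦ 2^q is injective, so only the part
with q = p survives. This gives a test for the degree that commutes with all constructions. -/
theorem mem_extP0_of_scale {p : ℕ} {ξ : CExt T} (h : ξ ∈ extStar0 I)
    (hs : scale 2 ξ = (2 : ℂ) ^ p • ξ) : ξ ∈ extP0 I p := by
  have h2 : holPart I p ξ = ξ := by
    refine holPart_eq_self fun q hq => ?_
    have h3 := scale_of_mem_extP0 2 (holPart_mem_extP0 h q)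
    rw [scale_holPart, hs, holPart_smul] at h3
    by_contra h4
    have h5 : ((2 : ℂ) ^ q - 2 ^ p) • holPart I q ξ = 0 := by rw [sub_smul, ← h3, sub_self]
    rcases smul_eq_zero.1 h5 with h6 | h6
    · have h7 : ((2 ^ q : ℕ) : ℂ) = ((2 ^ p : ℕ) : ℂ) := by
        push_cast
        linear_combination h6
      rw [Nat.cast_inj] at h7
      exact hq (Nat.pow_right_injective le_rfl h7)
    · exact h4 h6
  rw [← h2]
  exact holPart_mem_extP0 h p

end Types

/-! ### Coordinate expansions of covectors and two-forms. -/

section Coordinates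

variable {T : Type*} [AddCommGroup T] [Module ℝ T]
variable {T' : Type*} [AddCommGroup T'] [Module ℝ T']

/-- A real covector as a complex-valued covector. -/
def realCov (φ : T →ₗ[ℝ] ℝ) : CDual T := Complex.ofRealCLM.toLinearMap ∘ₗ φ

theorem realCov_apply (φ : T →ₗ[ℝ] ℝ) (v : T) : realCov φ v = (φ v : ℂ) := rfl

variable [Module.Finite ℝ T] [Module.Finite ℝ T']

theorem coBasis_apply_finBasis (i j : Fin (finrank ℝ T)) :
    coBasis T i (finBasis ℝ T j) = if i = j then 1 else 0 := by
  rw [coBasis, Basis.coe_ofEquivFun]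
  simp [Pi.single_apply, eq_comm]

theorem sum_coBasis (α : CDual T) : ∑ i, α (finBasis ℝ T i) • coBasis T i = α := by
  refine (finBasis ℝ T).ext fun j => ?_
  simp only [LinearMap.sum_apply, LinearMap.smul_apply, coBasis_apply_finBasis, smul_eq_mul,
    mul_ite, mul_one, mul_zero, Finset.sum_ite_eq', Finset.mem_univ, if_true]

theorem sum_map_coBasis {Z : Type*} [AddCommGroup Z] [Module ℂ Z] (X : CDual T →ₗ[ℂ] Z)
    (α : CDual T) : ∑ i, α (finBasis ℝ T i) • X (coBasis T i) = X α := by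
  conv_rhs => rw [← sum_coBasis α, map_sum]
  simp only [map_smul]

/-- The values of a bilinear form on basis vectors, tensored with linear images of the dual
basis. -/
theorem sum_covPull_mul_covPull (G : T' →ₗ[ℝ] T' →ₗ[ℝ] ℝ) (A A' : T →ₗ[ℝ] T') :
    ∑ i, ∑ j, (G (finBasis ℝ T' i) (finBasis ℝ T' j) : ℂ) •
      (ι ℂ (covPull A (coBasis T' i)) * ι ℂ (covPull A' (coBasis T' j))) =
    ∑ k, ∑ l, (G (A (finBasis ℝ T k)) (A' (finBasis ℝ T l)) : ℂ) •
      (ι ℂ (coBasis T k) * ι ℂ (coBasis T l)) := by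
  have h : ∀ (A : T →ₗ[ℝ] T') (φ : T' →ₗ[ℝ] ℝ),
      ∑ i, (φ (finBasis ℝ T' i) : ℂ) • ι ℂ (covPull A (coBasis T' i)) =
      ∑ k, (φ (A (finBasis ℝ T k)) : ℂ) • ι ℂ (coBasis T k) := fun A φ =>
    (sum_map_coBasis (ι ℂ ∘ₗ covPull A) (realCov φ)).trans
      (sum_map_coBasis (ι ℂ) (covPull A (realCov φ))).symm
  calc _ = ∑ j, (∑ i, (G.flip (finBasis ℝ T' j) (finBasis ℝ T' i) : ℂ) •
          ι ℂ (covPull A (coBasis T' i))) * ι ℂ (covPull A' (coBasis T' j)) := by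
        rw [Finset.sum_comm]
        simp only [Finset.sum_mul, smul_mul_assoc, LinearMap.flip_apply]
    _ = ∑ k, ι ℂ (coBasis T k) * ∑ j, (G (A (finBasis ℝ T k)) (finBasis ℝ T' j) : ℂ) •
          ι ℂ (covPull A' (coBasis T' j)) := by
        have h' := fun j => h A (G.flip (finBasis ℝ T' j))
        simp only [h']
        simp only [LinearMap.flip_apply, Finset.sum_mul, Finset.mul_sum, smul_mul_assoc,
          mul_smul_comm]
        rw [Finset.sum_comm]
    _ = _ := by
        simp only [h, Finset.mul_sum, mul_smul_comm]

theorem twoForm_eq (G : T →ₗ[ℝ] T →ₗ[ℝ] ℝ) : twoForm (fun v w => G v w) =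
    (1 / 2 : ℂ) • ∑ i, ∑ j, (G (finBasis ℝ T i) (finBasis ℝ T j) : ℂ) •
      (ι ℂ (coBasis T i) * ι ℂ (coBasis T j)) := by
  simp only [twoForm, mul_smul, Finset.smul_sum]

theorem extPull_twoForm (G : T' →ₗ[ℝ] T' →ₗ[ℝ] ℝ) (A : T →ₗ[ℝ] T') :
    extPull A (twoForm fun v w => G v w) = twoForm fun v w => G (A v) (A w) := by
  rw [twoForm_eq]
  refine Eq.trans ?_ (twoForm_eq (G.compl₁₂ A A)).symm
  simp only [map_smul, map_sum, map_mul, extPull_ι, LinearMap.compl₁₂_apply,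
    sum_covPull_mul_covPull]

/-- The contraction of an alternating two-form. -/
theorem intProd_twoForm (G : T →ₗ[ℝ] T →ₗ[ℝ] ℝ) (hG : ∀ v w, G v w = -G w v)
    (d : Module.Dual ℂ (CDual T)) :
    intProd d (twoForm fun v w => G v w) =
      ∑ i, d (coBasis T i) • ι ℂ (realCov (G (finBasis ℝ T i))) := by
  have h1 : ∀ i, ι ℂ (realCov (G (finBasis ℝ T i))) =
      ∑ j, (G (finBasis ℝ T i) (finBasis ℝ T j) : ℂ) • ι ℂ (coBasis T j) := fun i =>
    (sum_map_coBasis (ι ℂ) (realCov (G (finBasis ℝ T i)))).symm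
  -- By the alternation of `G`, the two terms of the contraction of e^i ∧ e^j contribute equally,
  -- which cancels the factor 1/2.
  have h2 : ∑ i, ∑ j, (G (finBasis ℝ T i) (finBasis ℝ T j) : ℂ) •
      (d (coBasis T j) • ι ℂ (coBasis T i)) =
      -∑ i, ∑ j, (G (finBasis ℝ T i) (finBasis ℝ T j) : ℂ) •
      (d (coBasis T i) • ι ℂ (coBasis T j)) := by
    rw [Finset.sum_comm, ← Finset.sum_neg_distrib]
    refine Finset.sum_congr rfl fun i _ => ?_
    rw [← Finset.sum_neg_distrib]
    refine Finset.sum_congr rfl fun j _ => ?_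
    rw [hG, Complex.ofReal_neg, neg_smul]
  rw [twoForm_eq]
  have h3 : ∀ i j : Fin (finrank ℝ T), intProd d (ι ℂ (coBasis T i) * ι ℂ (coBasis T j)) =
      d (coBasis T i) • ι ℂ (coBasis T j) - d (coBasis T j) • ι ℂ (coBasis T i) := fun i j => by
    have := intProd_ι_mul d (coBasis T j) 1
    rw [mul_one, intProd_one, mul_zero, sub_zero] at this
    rw [intProd_ι_mul, this, mul_smul_comm, mul_one]
  simp only [map_smul, map_sum, h3, smul_sub, Finset.sum_sub_distrib]
  rw [h2, ← smul_sub, sub_neg_eq_add, ← two_smul ℂ, smul_smul]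
  norm_num only [one_smul]
  refine Finset.sum_congr rfl fun i _ => ?_
  rw [h1, Finset.smul_sum]
  refine Finset.sum_congr rfl fun j _ => ?_
  rw [smul_comm]

/-- Forms of degree larger than the dimension vanish. -/
theorem eq_zero_of_scale {ξ : CExt T} {k : ℕ} (hk : finrank ℝ T < k)
    (h : scale 2 ξ = (2 : ℂ) ^ k • ξ) : ξ = 0 := by
  -- The monomials form an eigenbasis with eigenvalues 2^|S|. Since |S| is at most the dimension,
  -- 2^k is not an eigenvalue.
  have hb : ∀ S, scale 2 ((coBasis T).ExteriorAlgebra S) =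
      (2 : ℂ) ^ S.card • (coBasis T).ExteriorAlgebra S := fun S => by
    have h1 : (coBasis T).ExteriorAlgebra S ∈ LinearMap.range (ι ℂ : CDual T →ₗ[ℂ] _) ^ S.card := by
      rw [ExteriorAlgebra.basis_apply]
      exact ExteriorAlgebra.ιMulti_range ℂ S.card ⟨_, rfl⟩
    generalize (coBasis T).ExteriorAlgebra S = x at h1 ⊢
    generalize S.card = n at h1 ⊢
    induction h1 using Submodule.pow_induction_on_left' with
    | algebraMap r => rw [AlgHom.commutes, pow_zero, one_smul]
    | add x y i _ _ hx hy => rw [map_add, hx, hy, smul_add]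
    | mem_mul m hm i x _ hx =>
      obtain ⟨α, rfl⟩ := hm
      rw [map_mul, scale_ι, hx, smul_mul_smul_comm, pow_succ']
  have hrep : ∀ S, (coBasis T).ExteriorAlgebra.repr (scale 2 ξ) S =
      2 ^ S.card * (coBasis T).ExteriorAlgebra.repr ξ S := fun S => by
    conv_lhs => rw [← (coBasis T).ExteriorAlgebra.sum_repr ξ]
    simp only [map_sum, map_smul, hb]
    rw [Finsupp.finsetSum_apply, Finset.sum_eq_single S]
    · simp [mul_comm]
    · intro S' _ hS
      simp [hS]
    · simp
  refine (coBasis T).ExteriorAlgebra.repr.map_eq_zero_iff.1 (Finsupp.ext fun S => ?_)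
  have h1 := hrep S
  rw [h, map_smul, Finsupp.smul_apply, smul_eq_mul] at h1
  have h2 : ((2 : ℂ) ^ k - 2 ^ S.card) * (coBasis T).ExteriorAlgebra.repr ξ S = 0 := by
    linear_combination h1
  rcases mul_eq_zero.1 h2 with h3 | h3
  · exfalso
    have h4 : ((2 ^ k : ℕ) : ℂ) = ((2 ^ S.card : ℕ) : ℂ) := by
      push_cast
      linear_combination h3
    rw [Nat.cast_inj] at h4
    have h5 := Nat.pow_right_injective le_rfl h4
    have h6 := S.card_le_univ
    rw [Fintype.card_fin] at h6
    omega
  · exact h3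

end Coordinates

/-! ### The dual metric and iterated contractions -/

section Contraction

variable {T : Type*} [AddCommGroup T] [Module ℝ T] [Module.Finite ℝ T]

/-- Iterated contraction with the vectors dual to the factors of a form. -/
def ctr (s : T → T → ℝ) (η : CExt T) : Module.End ℂ (CExt T) := (contract s η).unop

theorem ctr_add (s : T → T → ℝ) (η η' : CExt T) : ctr s (η + η') = ctr s η + ctr s η' := by
  rw [ctr, map_add]; rfl

theorem ctr_smul (s : T → T → ℝ) (c : ℂ) (η : CExt T) : ctr s (c • η) = c • ctr s η := by
  rw [ctr, map_smul]; rfl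

theorem ctr_neg (s : T → T → ℝ) (η : CExt T) : ctr s (-η) = -ctr s η := by
  rw [ctr, map_neg]; rfl

theorem ctr_mul (s : T → T → ℝ) (η η' : CExt T) (ξ : CExt T) :
    ctr s (η * η') ξ = ctr s η' (ctr s η ξ) := by
  rw [ctr, map_mul]; rfl

theorem ctr_algebraMap (s : T → T → ℝ) (r : ℂ) (ξ : CExt T) :
    ctr s (algebraMap ℂ _ r) ξ = r • ξ := by
  rw [ctr, AlgHom.commutes]; rfl

theorem ctr_one (s : T → T → ℝ) (ξ : CExt T) : ctr s 1 ξ = ξ := by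
  rw [ctr, map_one]; rfl

theorem ctr_ι (s : T → T → ℝ) (a : CDual T) (ξ : CExt T) :
    ctr s (ι ℂ a) ξ = intProd (dualMetric s a) ξ := by
  rw [ctr, contract, lift_ι_apply]; rfl

theorem hodgeStar_eq (s : T → T → ℝ) (I : T →ₗ[ℝ] T) (η : CExt T) :
    hodgeStar s I η = ctr s η (volForm s I) := rfl

/-- Iterated contraction intertwines adjoint maps of covectors. -/
theorem ctr_map {T' : Type*} [AddCommGroup T'] [Module ℝ T'] [Module.Finite ℝ T']
    {s : T → T → ℝ} {s' : T' → T' → ℝ} {f : CDual T →ₗ[ℂ] CDual T'} {g : CDual T' →ₗ[ℂ] CDual T}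
    (hfg : ∀ a b, dualMetric s (g a) b = dualMetric s' a (f b)) (η : CExt T') (ξ : CExt T) :
    ctr s' η (map f ξ) = map f (ctr s (map g η) ξ) := by
  induction η using right_induction generalizing ξ with
  | scalar r => rw [AlgHom.commutes, ctr_algebraMap, ctr_algebraMap, map_smul]
  | add x y hx hy => rw [map_add, ctr_add, ctr_add, LinearMap.add_apply, LinearMap.add_apply, hx,
      hy, map_add]
  | mul_ι m x hx =>
    rw [map_mul, map_apply_ι, ctr_mul, ctr_mul, hx, ctr_ι, ctr_ι, map_intProd]
    -- What remains is that the functional (m, ·) composed with f is (g m, ·), which is the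
    -- adjointness hypothesis.
    congr 3
    ext b
    exact (hfg m b).symm

/-- Contracting the contracting form: the supercommutator of contractions and multiplications. -/
theorem ctr_intProd (s : T → T → ℝ) (hs : ∀ a b, dualMetric s a b = dualMetric s b a)
    (a : CDual T) (β ξ : CExt T) :
    ctr s (intProd (dualMetric s a) β) ξ =
      ctr s β (ι ℂ a * ξ) - ι ℂ a * ctr s (invol β) ξ := by
  induction β using left_induction generalizing ξ with
  | scalar r =>
    have h0 : ctr s 0 = 0 := by rw [ctr, map_zero]; rfl
    rw [intProd_algebraMap, h0, AlgHom.commutes, ctr_algebraMap, ctr_algebraMap, mul_smul_comm,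
      sub_self, LinearMap.zero_apply]
  | add x y hx hy =>
    rw [map_add, ctr_add, LinearMap.add_apply, hx, hy, ctr_add, map_add, ctr_add,
      LinearMap.add_apply, LinearMap.add_apply, mul_add]
    abel
  | ι_mul b x hx =>
    rw [intProd_ι_mul, sub_eq_add_neg, ctr_add, ctr_neg, ctr_smul, LinearMap.add_apply,
      LinearMap.neg_apply, LinearMap.smul_apply, ctr_mul, ctr_mul, hx, ctr_ι, ctr_ι, map_mul invol, ctr_mul,
      invol_ι, ctr_neg, LinearMap.neg_apply, ctr_ι, intProd_ι_mul, LinearMap.map_sub,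
      LinearMap.map_smul, hs a b, LinearMap.map_neg, mul_neg]
    abel

end Contraction

/-! ### Hermitian vector spaces: the dual metric and the volume form. -/

section Hermitian

variable {T : Type*} [AddCommGroup T] [Module ℝ T]

/-- `B` is an inner product for which the complex structure `I` is orthogonal. -/
structure IsHermitianPair (B : T →ₗ[ℝ] T →ₗ[ℝ] ℝ) (I : T →ₗ[ℝ] T) : Prop where
  symm : ∀ v w, B v w = B w v
  pos : ∀ v, v ≠ 0 → 0 < B v v
  sq : ∀ v, I (I v) = -v
  inv : ∀ v w, B (I v) (I w) = B v w

variable {B : T →ₗ[ℝ] T →ₗ[ℝ] ℝ} {I : T →ₗ[ℝ] T} (h : IsHermitianPair B I)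

include h in
theorem IsHermitianPair.skew (v w : T) : B (I v) w = -B v (I w) := by
  rw [← h.inv v (I w), h.sq, map_neg, neg_neg]

include h in
theorem covPull_realCov (v : T) : covPull I (realCov (B v)) = -realCov (B (I v)) := by
  ext w
  simp [covPull_apply, realCov_apply, h.skew]

variable [Module.Finite ℝ T]

include h in
-- In odd dimension `I² = -1` would give (det I)² = -1.
theorem IsHermitianPair.even_finrank : Even (finrank ℝ T) := by
  by_contra hodd
  have h1 : I * I = (-1 : ℝ) • LinearMap.id := LinearMap.ext fun v => by simp [h.sq]
  have h2 := congrArg LinearMap.det h1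
  rw [map_mul, LinearMap.det_smul, LinearMap.det_id, mul_one,
    (Nat.not_even_iff_odd.1 hodd).neg_one_pow] at h2
  nlinarith [mul_self_nonneg (LinearMap.det I)]

omit [Module.Finite ℝ T] in
theorem gram_apply [Module.Finite ℝ T] (i j : Fin (finrank ℝ T)) :
    gram (fun v w => B v w) i j = B (finBasis ℝ T i) (finBasis ℝ T j) := rfl

include h in
-- A vector in the kernel of the Gram matrix would have length zero.
theorem isUnit_det_gram : IsUnit (gram fun v w => B v w).det := by
  rw [isUnit_iff_ne_zero, Ne, ← Matrix.exists_mulVec_eq_zero_iff]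
  rintro ⟨c, hc, h0⟩
  have h1 : B (∑ i, c i • finBasis ℝ T i) (∑ i, c i • finBasis ℝ T i) = 0 := by
    simp only [map_sum, map_smul, LinearMap.sum_apply, LinearMap.smul_apply, smul_eq_mul]
    refine Finset.sum_eq_zero fun i _ => ?_
    have h2 := congrFun h0 i
    simp only [Matrix.mulVec, dotProduct, gram_apply, Pi.zero_apply] at h2
    rw [mul_eq_zero, ← h2]
    exact Or.inr (Finset.sum_congr rfl fun j _ => by rw [h.symm, mul_comm])
  have h2 : ∑ i, c i • finBasis ℝ T i ≠ 0 := fun h3 =>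
    hc (funext (Fintype.linearIndependent_iff.1 (finBasis ℝ T).linearIndependent c h3))
  exact (h.pos _ h2).ne' h1

theorem dualMetric_apply (s : T → T → ℝ) (α β : CDual T) :
    dualMetric s α β = ∑ i, ∑ j, (((gram s)⁻¹ i j : ℝ) : ℂ) *
      (α (finBasis ℝ T i) * β (finBasis ℝ T j)) := by
  simp [dualMetric, LinearMap.sum_apply, covEval]

include h in
/-- The dual metric on covectors, characterized by `(s(v, ·), β) = β(v)`. -/
theorem dualMetric_realCov (v : T) (β : CDual T) :
    dualMetric (fun v w => B v w) (realCov (B v)) β = β v := by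
  have hg := Matrix.mul_nonsing_inv _ (isUnit_det_gram h)
  have key : ∀ k, dualMetric (fun v w => B v w) (realCov (B (finBasis ℝ T k))) β =
      β (finBasis ℝ T k) := fun k => by
    rw [dualMetric_apply, Finset.sum_comm]
    have h1 : ∀ j, ∑ i, ((((gram fun v w => B v w)⁻¹ i j : ℝ) : ℂ) *
        (realCov (B (finBasis ℝ T k)) (finBasis ℝ T i) * β (finBasis ℝ T j))) =
        if k = j then β (finBasis ℝ T j) else 0 := fun j => by
      have h2 := congrFun (congrFun hg k) j
      rw [Matrix.mul_apply, Matrix.one_apply] at h2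
      calc _ = ((∑ i, gram (fun v w => B v w) k i * (gram fun v w => B v w)⁻¹ i j : ℝ) : ℂ) *
            β (finBasis ℝ T j) := by
            rw [Complex.ofReal_sum, Finset.sum_mul]
            refine Finset.sum_congr rfl fun i _ => ?_
            rw [gram_apply, Complex.ofReal_mul, realCov_apply]
            ring
        _ = _ := by rw [h2]; split_ifs <;> simp
    simp only [h1, Finset.sum_ite_eq, Finset.mem_univ, if_true]
  have h2 : realCov (B v) = ∑ k, ((finBasis ℝ T).repr v k : ℂ) • realCov (B (finBasis ℝ T k)) := by
    ext w
    have h3 : B v w = ∑ k, (finBasis ℝ T).repr v k * B (finBasis ℝ T k) w := by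
      conv_lhs => rw [← (finBasis ℝ T).sum_repr v]
      simp only [map_sum, map_smul, LinearMap.sum_apply, LinearMap.smul_apply, smul_eq_mul]
    rw [realCov_apply, h3, LinearMap.sum_apply, Complex.ofReal_sum]
    exact Finset.sum_congr rfl fun k _ => Complex.ofReal_mul _ _
  rw [h2, map_sum, LinearMap.sum_apply]
  simp only [map_smul, LinearMap.smul_apply, key]
  conv_rhs => rw [← (finBasis ℝ T).sum_repr v, map_sum]
  simp

include h in
/-- Covectors are complex combinations of the covectors `s(v, ·)`. -/
theorem eq_of_realCov {X : Type*} [AddCommGroup X] [Module ℂ X] {f g : CDual T →ₗ[ℂ] X}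
    (hfg : ∀ v, f (realCov (B v)) = g (realCov (B v))) : f = g := by
  have hg := Matrix.nonsing_inv_mul _ (isUnit_det_gram h)
  refine (coBasis T).ext fun i => ?_
  have h1 : coBasis T i = ∑ j, (((gram fun v w => B v w)⁻¹ i j : ℝ) : ℂ) •
      realCov (B (finBasis ℝ T j)) := by
    refine (finBasis ℝ T).ext fun k => ?_
    have h2 := congrFun (congrFun hg i) k
    rw [Matrix.mul_apply, Matrix.one_apply] at h2
    rw [coBasis_apply_finBasis, LinearMap.sum_apply]
    calc (if i = k then (1 : ℂ) else 0) = ((if i = k then (1 : ℝ) else 0 : ℝ) : ℂ) := by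
          split_ifs <;> simp
      _ = _ := by
          rw [← h2, Complex.ofReal_sum]
          refine Finset.sum_congr rfl fun j _ => ?_
          rw [gram_apply, Complex.ofReal_mul]
          rfl
  rw [h1, map_sum, map_sum]
  simp only [map_smul, hfg]

include h in
theorem dualMetric_comm (a b : CDual T) :
    dualMetric (fun v w => B v w) a b = dualMetric (fun v w => B v w) b a := by
  -- Both sides are bilinear, so it suffices to compare them on the covectors s(v, ·), where
  -- symmetry is that of the metric.
  have : dualMetric (fun v w => B v w) = (dualMetric (fun v w => B v w)).flip := by
    refine eq_of_realCov h fun v => ?_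
    refine eq_of_realCov h fun w => ?_
    rw [dualMetric_realCov h, LinearMap.flip_apply, dualMetric_realCov h, realCov_apply,
      realCov_apply, h.symm]
  rw [this, LinearMap.flip_apply, ← this]

/-- Naturality of the dual metric. -/
theorem dualMetric_covPull {T' : Type*} [AddCommGroup T'] [Module ℝ T'] [Module.Finite ℝ T']
    {B' : T' →ₗ[ℝ] T' →ₗ[ℝ] ℝ} {I' : T' →ₗ[ℝ] T'} (h' : IsHermitianPair B' I')
    (h : IsHermitianPair B I) (A : T ≃ₗ[ℝ] T') (hA : ∀ v w, B v w = B' (A v) (A w))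
    (a : CDual T') (b : CDual T) :
    dualMetric (fun v w => B' v w) a (covPull A.symm.toLinearMap b) =
      dualMetric (fun v w => B v w) (covPull A.toLinearMap a) b := by
  suffices hs : (dualMetric fun v w => B' v w).compl₂ (covPull A.symm.toLinearMap) =
      (dualMetric fun v w => B v w) ∘ₗ covPull A.toLinearMap from
    congrArg (fun f => f a b) hs
  refine eq_of_realCov h' fun v => ?_
  ext b
  have h1 : covPull A.toLinearMap (realCov (B' v)) = realCov (B (A.symm v)) := by
    ext w
    simp [covPull_apply, realCov_apply, hA]
  rw [LinearMap.compl₂_apply, dualMetric_realCov h', LinearMap.comp_apply, h1,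
    dualMetric_realCov h]
  rfl

include h in
theorem dualMetric_covPull_I (a b : CDual T) :
    dualMetric (fun v w => B v w) (covPull I a) b =
      -dualMetric (fun v w => B v w) a (covPull I b) := by
  suffices hs : (dualMetric fun v w => B v w) ∘ₗ covPull I =
      -(dualMetric fun v w => B v w).compl₂ (covPull I) from
    congrArg (fun f => f a b) hs
  refine eq_of_realCov h fun v => ?_
  ext b
  rw [LinearMap.comp_apply, covPull_realCov h, map_neg, LinearMap.neg_apply,
    dualMetric_realCov h, LinearMap.neg_apply, LinearMap.neg_apply, LinearMap.compl₂_apply,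
    dualMetric_realCov h]
  rfl

include h in
-- I is skew for the bilinear dual metric, so the adjoint of the projection to type (1,0) is the
-- projection to type (0,1).
theorem dualMetric_proj10 (a b : CDual T) :
    dualMetric (fun v w => B v w) (proj10 I a) b =
      dualMetric (fun v w => B v w) a (proj01 I b) := by
  simp only [proj10_apply_eq, proj01_apply_eq, map_smul, map_sub, map_add, LinearMap.smul_apply,
    LinearMap.sub_apply, dualMetric_covPull_I h, smul_neg, sub_neg_eq_add]

include h in
theorem dualMetric_proj01 (a b : CDual T) :
    dualMetric (fun v w => B v w) (proj01 I a) b =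
      dualMetric (fun v w => B v w) a (proj10 I b) := by
  rw [dualMetric_comm h, ← dualMetric_proj10 h, dualMetric_comm h]

include h in
-- The (1,0)-covectors are isotropic: the vector dual to one of them pairs only with
-- (0,1)-covectors. This is why contraction with it leaves the holomorphic degree unchanged.
theorem dualMetric_of_mem {a : CDual T} (ha : a ∈ type10 I) (b : CDual T) :
    dualMetric (fun v w => B v w) a (proj10 I b) = 0 := by
  rw [← dualMetric_proj01 h, proj01_of_mem ha, map_zero, LinearMap.zero_apply]

/-- Every functional on covectors is represented by a covector. -/
theorem exists_dualMetric (h : IsHermitianPair B I) (d : Module.Dual ℂ (CDual T)) :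
    ∃ a, d = dualMetric (fun v w => B v w) a := by
  refine ⟨∑ i, d (coBasis T i) • realCov (B (finBasis ℝ T i)), LinearMap.ext fun b => ?_⟩
  rw [map_sum, LinearMap.sum_apply]
  simp only [map_smul, LinearMap.smul_apply, dualMetric_realCov h, smul_eq_mul]
  rw [← sum_map_coBasis d b]
  exact Finset.sum_congr rfl fun i _ => mul_comm _ _

include h in
theorem sum_dualMetric_coBasis (a : CDual T) :
    ∑ i, dualMetric (fun v w => B v w) a (coBasis T i) • realCov (B (finBasis ℝ T i)) = a := by
  ext v
  rw [← dualMetric_realCov h v a, dualMetric_comm h,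
    ← sum_map_coBasis (dualMetric (fun v w => B v w) a) (realCov (B v)), LinearMap.sum_apply]
  refine Finset.sum_congr rfl fun i _ => ?_
  rw [LinearMap.smul_apply, realCov_apply, realCov_apply, h.symm, smul_eq_mul, smul_eq_mul,
    mul_comm]

/-! #### The Hermitian form and the volume form -/

/-- The Hermitian form `σ(v, w) = s(I v, w)`. -/
def hermForm (B : T →ₗ[ℝ] T →ₗ[ℝ] ℝ) (I : T →ₗ[ℝ] T) : CExt T := twoForm fun v w => B (I v) w

theorem hermForm_eq : hermForm B I = (1 / 2 : ℂ) • ∑ i, ∑ j,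
    (B (I (finBasis ℝ T i)) (finBasis ℝ T j) : ℂ) • (ι ℂ (coBasis T i) * ι ℂ (coBasis T j)) :=
  twoForm_eq (B ∘ₗ I)

include h in
theorem intProd_hermForm (a : CDual T) :
    intProd (dualMetric (fun v w => B v w) a) (hermForm B I) = -ι ℂ (covPull I a) := by
  refine (intProd_twoForm (B ∘ₗ I) (fun v w => ?_) _).trans ?_
  · simp only [LinearMap.comp_apply]
    rw [h.skew, h.symm]
  · conv_rhs => rw [← sum_dualMetric_coBasis h a, map_sum, map_sum, ← Finset.sum_neg_distrib]
    refine Finset.sum_congr rfl fun i _ => ?_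
    rw [map_smul, covPull_realCov h, map_smul, map_neg, smul_neg, neg_neg]
    rfl

theorem scale_twoForm (t : ℂ) (G : T → T → ℝ) : scale t (twoForm G) = t ^ 2 • twoForm G := by
  simp only [twoForm, map_sum, map_smul, map_mul, scale_ι, smul_mul_smul_comm, Finset.smul_sum]
  refine Finset.sum_congr rfl fun i _ => Finset.sum_congr rfl fun j _ => ?_
  rw [smul_comm, sq]

theorem invol_twoForm (G : T → T → ℝ) : invol (twoForm G) = twoForm G := by
  rw [invol, scale_twoForm]; norm_num

include h in
theorem extPull_hermForm : extPull I (hermForm B I) = hermForm B I := by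
  refine (extPull_twoForm (B ∘ₗ I) I).trans ?_
  simp only [LinearMap.comp_apply, h.inv]
  rfl

include h in
-- Contraction acts as a derivation on powers of σ, because σ is even and central.
theorem intProd_hermForm_pow (a : CDual T) (k : ℕ) :
    intProd (dualMetric (fun v w => B v w) a) (hermForm B I ^ (k + 1)) =
      -((k + 1 : ℂ) • (ι ℂ (covPull I a) * hermForm B I ^ k)) := by
  induction k with
  | zero => simp [intProd_hermForm h]
  | succ k ih =>
    have hσ : invol (hermForm B I) = hermForm B I := invol_twoForm _
    rw [pow_succ', intProd_mul, ih, intProd_hermForm h, hσ, mul_neg, mul_smul_comm, ← mul_assoc,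
      mul_comm_of_invol hσ (ι ℂ (covPull I a)), mul_assoc, ← pow_succ', neg_mul]
    push_cast
    rw [add_smul, add_smul, one_smul, add_smul, one_smul]
    abel

/-- Contraction with the Hermitian form: the dual Lefschetz operator. -/
theorem ctr_hermForm (ξ : CExt T) : ctr (fun v w => B v w) (hermForm B I) ξ =
    (1 / 2 : ℂ) • ∑ i, ∑ j, (B (I (finBasis ℝ T i)) (finBasis ℝ T j) : ℂ) •
      intProd (dualMetric (fun v w => B v w) (coBasis T j))
        (intProd (dualMetric (fun v w => B v w) (coBasis T i)) ξ) := by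
  have hlin : ∀ η, ctr (fun v w => B v w) η ξ =
      (LinearMap.applyₗ ξ ∘ₗ (MulOpposite.opLinearEquiv ℂ).symm.toLinearMap ∘ₗ
        (contract (fun v w => B v w)).toLinearMap) η := fun η => rfl
  rw [hlin, hermForm_eq]
  simp only [map_smul, map_sum]
  simp only [← hlin, ctr_mul, ctr_ι]

include h in
-- For fixed i the sum over j evaluates e^i ∘ I at I e_i, which is e^i(-e_i) = -1; the total is
-- minus the trace of the identity.
theorem sum_hermForm_dualMetric :
    ∑ i, ∑ j, (B (I (finBasis ℝ T i)) (finBasis ℝ T j) : ℂ) *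
      dualMetric (fun v w => B v w) (coBasis T j) (covPull I (coBasis T i)) =
    -(finrank ℝ T : ℂ) := by
  have h1 : ∀ i, ∑ j, (B (I (finBasis ℝ T i)) (finBasis ℝ T j) : ℂ) *
      dualMetric (fun v w => B v w) (coBasis T j) (covPull I (coBasis T i)) = -1 := fun i => by
    have h2 := sum_map_coBasis ((dualMetric (fun v w => B v w)).flip (covPull I (coBasis T i)))
      (realCov (B (I (finBasis ℝ T i))))
    simp only [LinearMap.flip_apply, dualMetric_realCov h, covPull_apply, h.sq, map_neg,
      coBasis_apply_finBasis, if_true] at h2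
    exact h2
  simp [h1]

include h in
-- The Lefschetz identity Λ σ^{k+1} = (k+1)(m-k) σ^k. Of the two contractions, the second hits
-- either the covector left by the first, which gives the trace, or another factor σ, which rebuilds
-- σ by its I-invariance.
theorem ctr_hermForm_pow (k : ℕ) :
    ctr (fun v w => B v w) (hermForm B I) (hermForm B I ^ (k + 1)) =
      ((k + 1 : ℂ) * (finrank ℝ T / 2 - k)) • hermForm B I ^ k := by
  -- For k = 0 the truncated exponent `k - 1` is harmless, because its term carries the factor k.
  have h1 : ∀ a b, intProd (dualMetric (fun v w => B v w) b)
      (intProd (dualMetric (fun v w => B v w) a) (hermForm B I ^ (k + 1))) =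
      -((k + 1 : ℂ) • (dualMetric (fun v w => B v w) b (covPull I a) • hermForm B I ^ k
        + (k : ℂ) • (ι ℂ (covPull I a) * ι ℂ (covPull I b) * hermForm B I ^ (k - 1)))) := by
    intro a b
    rw [intProd_hermForm_pow h, map_neg, map_smul, intProd_ι_mul]
    congr 2
    cases k with
    | zero => simp
    | succ k =>
      rw [intProd_hermForm_pow h, mul_neg, sub_neg_eq_add, mul_smul_comm, mul_assoc]
      push_cast
      rfl
  have h2 : (1 / 2 : ℂ) • ∑ i, ∑ j, (B (I (finBasis ℝ T i)) (finBasis ℝ T j) : ℂ) •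
      (ι ℂ (covPull I (coBasis T i)) * ι ℂ (covPull I (coBasis T j))) = hermForm B I := by
    conv_rhs => rw [← extPull_hermForm h, hermForm_eq]
    simp only [map_smul, map_sum, map_mul, extPull_ι]
  calc _ = -((k + 1 : ℂ) • (((1 / 2 : ℂ) * ∑ i, ∑ j,
            (B (I (finBasis ℝ T i)) (finBasis ℝ T j) : ℂ) *
              dualMetric (fun v w => B v w) (coBasis T j) (covPull I (coBasis T i))) •
                hermForm B I ^ k +
          (k : ℂ) • (((1 / 2 : ℂ) • ∑ i, ∑ j,
            (B (I (finBasis ℝ T i)) (finBasis ℝ T j) : ℂ) •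
              (ι ℂ (covPull I (coBasis T i)) * ι ℂ (covPull I (coBasis T j)))) *
                hermForm B I ^ (k - 1)))) := by
        rw [ctr_hermForm]
        simp only [h1, Finset.mul_sum, Finset.sum_mul, Finset.smul_sum, Finset.sum_smul,
          smul_mul_assoc, ← Finset.sum_add_distrib, ← Finset.sum_neg_distrib]
        refine Finset.sum_congr rfl fun i _ => Finset.sum_congr rfl fun j _ => ?_
        module
    _ = -((k + 1 : ℂ) • (((1 / 2 : ℂ) * -(finrank ℝ T : ℂ)) • hermForm B I ^ k +
          (k : ℂ) • hermForm B I ^ k)) := by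
        rw [sum_hermForm_dualMetric h, h2]
        cases k with
        | zero => simp
        | succ k => rw [Nat.add_sub_cancel, ← pow_succ']
    _ = _ := by module

include h in
-- The volume form has length one: iterating the Lefschetz identity gives (σ^m, σ^m) = (m!)², which
-- the normalization of vol cancels.
theorem ctr_volForm : ctr (fun v w => B v w) (volForm (fun v w => B v w) I)
    (volForm (fun v w => B v w) I) = 1 := by
  obtain ⟨n, hn⟩ := h.even_finrank
  have hn2 : finrank ℝ T / 2 = n := by omega
  have hv : volForm (fun v w => B v w) I = ((1 : ℂ) / (n.factorial : ℂ)) • hermForm B I ^ n := by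
    rw [volForm, hn2]; rfl
  -- At k = n this is n! · n!. The falling factorial collects the factors n - j that the successive
  -- contractions produce.
  have h1 : ∀ k, k ≤ n → ctr (fun v w => B v w) (hermForm B I ^ k) (hermForm B I ^ k) =
      ((k.factorial : ℂ) * (n.descFactorial k : ℂ)) • (1 : CExt T) := by
    intro k
    induction k with
    | zero => intro _; simp [ctr_one]
    | succ k ih =>
      intro hk
      have h2 : hermForm B I ^ (k + 1) = hermForm B I * hermForm B I ^ k := pow_succ' _ _
      conv_lhs => arg 1; rw [h2]
      rw [ctr_mul, ctr_hermForm_pow h, map_smul, ih (by omega), smul_smul, hn,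
        Nat.descFactorial_succ, Nat.factorial_succ]
      congr 1
      push_cast [Nat.cast_sub (show k ≤ n by omega)]
      ring
  rw [hv, ctr_smul, LinearMap.smul_apply, map_smul, h1 n le_rfl, Nat.descFactorial_self,
    smul_smul, smul_smul]
  have hf : (n.factorial : ℂ) ≠ 0 := by exact_mod_cast n.factorial_ne_zero
  field_simp
  rw [one_smul]

theorem scale_volForm (h : IsHermitianPair B I) (t : ℂ) :
    scale t (volForm (fun v w => B v w) I) =
    t ^ finrank ℝ T • volForm (fun v w => B v w) I := by
  obtain ⟨n, hn⟩ := h.even_finrank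
  have hn2 : finrank ℝ T / 2 = n := by omega
  rw [volForm, hn2, map_smul, map_pow, scale_twoForm, smul_pow, smul_comm, ← pow_mul, hn,
    ← two_mul]

include h in
-- Its degree exceeds the dimension.
theorem ι_mul_volForm (a : CDual T) : ι ℂ a * volForm (fun v w => B v w) I = 0 := by
  refine eq_zero_of_scale (Nat.lt_succ_self _) ?_
  rw [map_mul, scale_ι, scale_volForm h, smul_mul_smul_comm, pow_succ']

end Hermitian

/-! ### The type of the volume form and the algebra of the star operator. -/

section Star

variable {T : Type*} [AddCommGroup T] [Module ℝ T] [Module.Finite ℝ T]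
variable {B : T →ₗ[ℝ] T →ₗ[ℝ] ℝ} {I : T →ₗ[ℝ] T}

/-- The I-invariance of σ makes the two mixed sums cancel, and makes the pure sums differ by the
factor c² = -1. With c = i this kills the (0,2)-part of σ, with c = -i the (2,0)-part. -/
theorem sum_hermForm_proj (h : IsHermitianPair B I) (c : ℂ) (hc : c * c = -1) :
    ∑ i, ∑ j, (B (I (finBasis ℝ T i)) (finBasis ℝ T j) : ℂ) •
      (ι ℂ (coBasis T i + c • covPull I (coBasis T i)) *
        ι ℂ (coBasis T j + c • covPull I (coBasis T j))) = 0 := by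
  have e1 := sum_covPull_mul_covPull (B ∘ₗ I) LinearMap.id I
  have e2 := sum_covPull_mul_covPull (B ∘ₗ I) I LinearMap.id
  have e3 := sum_covPull_mul_covPull (B ∘ₗ I) I I
  simp only [LinearMap.comp_apply, LinearMap.id_apply, h.inv] at e1 e2 e3
  have e2' : ∑ k, ∑ l, (B (I (I (finBasis ℝ T k))) (finBasis ℝ T l) : ℂ) •
      (ι ℂ (coBasis T k) * ι ℂ (coBasis T l)) =
      -∑ k, ∑ l, (B (finBasis ℝ T k) (finBasis ℝ T l) : ℂ) •
      (ι ℂ (coBasis T k) * ι ℂ (coBasis T l)) := by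
    simp [h.sq]
  rw [e2'] at e2
  have hid : ∀ α : CDual T, covPull LinearMap.id α = α := fun α => rfl
  simp only [hid] at e1 e2
  calc _ = ∑ i, ∑ j, (B (I (finBasis ℝ T i)) (finBasis ℝ T j) : ℂ) •
          (ι ℂ (coBasis T i) * ι ℂ (coBasis T j)) +
        c • (∑ i, ∑ j, (B (I (finBasis ℝ T i)) (finBasis ℝ T j) : ℂ) •
          (ι ℂ (coBasis T i) * ι ℂ (covPull I (coBasis T j)))) +
        c • (∑ i, ∑ j, (B (I (finBasis ℝ T i)) (finBasis ℝ T j) : ℂ) •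
          (ι ℂ (covPull I (coBasis T i)) * ι ℂ (coBasis T j))) +
        (c * c) • (∑ i, ∑ j, (B (I (finBasis ℝ T i)) (finBasis ℝ T j) : ℂ) •
          (ι ℂ (covPull I (coBasis T i)) * ι ℂ (covPull I (coBasis T j)))) := by
        simp only [Finset.smul_sum, ← Finset.sum_add_distrib]
        refine Finset.sum_congr rfl fun i _ => Finset.sum_congr rfl fun j _ => ?_
        simp only [map_add, map_smul, add_mul, mul_add, smul_mul_assoc, mul_smul_comm]
        module
    _ = 0 := by
        rw [e1, e2, e3, hc]
        module

theorem holPart_zero_hermForm (h : IsHermitianPair B I) : holPart I 0 (hermForm B I) = 0 := by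
  have := sum_hermForm_proj h Complex.I Complex.I_mul_I
  rw [holPart_zero_eq, hermForm_eq]
  simp only [map_smul, map_sum, map_mul, map_apply_ι, proj01_apply_eq, smul_mul_smul_comm]
  simp only [smul_comm _ ((1 / 2 : ℂ) * (1 / 2)), ← Finset.smul_sum, this, smul_zero]

theorem holPart_two_hermForm (h : IsHermitianPair B I) : holPart I 2 (hermForm B I) = 0 := by
  have := sum_hermForm_proj h (-Complex.I) (by simp)
  have h2 : ∀ a b : CDual T, holPartL I 2 (ι ℂ a * ι ℂ b) =
      ι ℂ (proj10 I a) * ι ℂ (proj10 I b) := fun a b => by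
    show holPart I (1 + 1) _ = _
    rw [← mul_one (ι ℂ b), holPart_succ_ι_mul, holPart_succ_ι_mul, holPart_succ_ι_mul, ← map_one
      (algebraMap ℂ (CExt T)), holPart_algebraMap_succ, holPart_algebraMap_zero,
      holPart_algebraMap_succ]
    simp
  show holPartL I 2 _ = 0
  rw [hermForm_eq]
  simp only [map_smul, map_sum, h2, proj10_apply_eq, sub_eq_add_neg, ← neg_smul,
    smul_mul_smul_comm]
  simp only [smul_comm _ ((1 / 2 : ℂ) * (1 / 2)), ← Finset.smul_sum, this, smul_zero]

omit [Module.Finite ℝ T] in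
theorem holPart_add_three_ι_mul_ι (p : ℕ) (a b : CDual T) :
    holPart I (p + 3) (ι ℂ a * ι ℂ b) = 0 := by
  rw [← mul_one (ι ℂ b), holPart_succ_ι_mul, holPart_succ_ι_mul, holPart_succ_ι_mul, ← map_one
      (algebraMap ℂ (CExt T)), holPart_algebraMap_succ, holPart_algebraMap_succ,
      holPart_algebraMap_succ]
  simp

theorem holWeight_hermForm (h : IsHermitianPair B I) :
    holWeight I (hermForm B I) = Polynomial.monomial 1 (hermForm B I) := by
  have h1 : ∀ q, q ≠ 1 → holPart I q (hermForm B I) = 0 := fun q hq => by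
    match q, hq with
    | 0, _ => exact holPart_zero_hermForm h
    | 2, _ => exact holPart_two_hermForm h
    | p + 3, _ =>
      show holPartL I (p + 3) _ = 0
      rw [hermForm_eq]
      have h3 : ∀ a b : CDual T, holPartL I (p + 3) (ι ℂ a * ι ℂ b) = 0 :=
        holPart_add_three_ι_mul_ι p
      simp only [map_smul, map_sum, h3, smul_zero, Finset.sum_const_zero]
  ext1 q
  rw [Polynomial.coeff_monomial]
  split_ifs with hq
  · rw [← hq]; exact holPart_eq_self h1
  · exact h1 q (Ne.symm hq)

theorem holWeight_volForm (h : IsHermitianPair B I) :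
    holWeight I (volForm (fun v w => B v w) I) =
      Polynomial.monomial (finrank ℝ T / 2) (volForm (fun v w => B v w) I) := by
  have h1 : volForm (fun v w => B v w) I =
    ((1 : ℂ) / ((finrank ℝ T / 2).factorial : ℂ)) • hermForm B I ^ (finrank ℝ T / 2) := rfl
  rw [h1, map_smul, map_pow, holWeight_hermForm h, Polynomial.monomial_pow, one_mul,
    Polynomial.smul_monomial]

theorem holPart_volForm (h : IsHermitianPair B I) :
    holPart I (finrank ℝ T / 2) (volForm (fun v w => B v w) I) =
      volForm (fun v w => B v w) I := by
  rw [holPart, holWeight_volForm h, Polynomial.coeff_monomial_same]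

theorem holPart_volForm_of_ne (h : IsHermitianPair B I) {p : ℕ} (hp : p ≠ finrank ℝ T / 2) :
    holPart I p (volForm (fun v w => B v w) I) = 0 := by
  rw [holPart, holWeight_volForm h, Polynomial.coeff_monomial_of_ne _ hp]

/-- Only scalings of the holomorphic covectors have been computed so far, so the scaling of the
antiholomorphic ones is factored as scaling everything by 2 and the holomorphic covectors by 1/2. On
type (m,m) this gives 4^m · 2^{-m}. -/
theorem typeScale_volForm (h : IsHermitianPair B I) :
    typeScale I 1 2 (volForm (fun v w => B v w) I) =
      (2 : ℂ) ^ (finrank ℝ T / 2) • volForm (fun v w => B v w) I := by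
  have h1 : ∀ ξ : CExt T, typeScale I 1 2 ξ = scale 2 (typeScale I (1 / 2) 1 ξ) := fun ξ => by
    rw [typeScale, typeScale, scale_map, scale, map_map_apply]
    congr 2
    ext α
    simp
  obtain ⟨n, hn⟩ := h.even_finrank
  have hn2 : finrank ℝ T / 2 = n := by omega
  have h2 := typeScale_holPart h.sq (1 / 2) (finrank ℝ T / 2) (volForm (fun v w => B v w) I)
  rw [holPart_volForm h] at h2
  rw [h1, h2, map_smul, scale_volForm h, hn2, smul_smul]
  congr 1
  rw [hn, pow_add, ← mul_assoc, ← mul_pow]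
  norm_num

/-! #### Properties of the star operator -/

variable (B I) in
/-- The star operator as a linear map. -/
def hodgeL : CExt T →ₗ[ℂ] CExt T where
  toFun η := hodgeStar (fun v w => B v w) I η
  map_add' a b := by rw [hodgeStar_eq, ctr_add]; rfl
  map_smul' c a := by rw [hodgeStar_eq, ctr_smul]; rfl

theorem hodgeL_apply (η : CExt T) : hodgeL B I η =
    ctr (fun v w => B v w) η (volForm (fun v w => B v w) I) := rfl

/-- The first half of the exchange between multiplication and contraction, immediate from the order
of contractions in the definition of *. It is the reason for multiplying by covectors on the right
below. -/
theorem hodgeL_mul_ι (η : CExt T) (a : CDual T) :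
    hodgeL B I (η * ι ℂ a) = intProd (dualMetric (fun v w => B v w) a) (hodgeL B I η) := by
  rw [hodgeL_apply, ctr_mul, ctr_ι]; rfl

/-- A form of the statement that * sends degree k to degree n - k which needs no homogeneous
argument. -/
theorem hodgeL_scale (h : IsHermitianPair B I) (t : ℂ) (η : CExt T) :
    scale t (hodgeL B I (scale t η)) = t ^ finrank ℝ T • hodgeL B I η := by
  have h1 : ∀ a b, dualMetric (fun v w => B v w) ((t • LinearMap.id : _ →ₗ[ℂ] CDual T) a) b =
      dualMetric (fun v w => B v w) a ((t • LinearMap.id : _ →ₗ[ℂ] CDual T) b) := fun a b => by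
    simp
  rw [hodgeL_apply, hodgeL_apply, ← map_smul, ← scale_volForm h]
  exact (ctr_map h1 η _).symm

theorem hodgeL_invol (h : IsHermitianPair B I) (η : CExt T) :
    hodgeL B I (invol η) = invol (hodgeL B I η) := by
  have h1 := hodgeL_scale h (-1) η
  rw [h.even_finrank.neg_one_pow, one_smul] at h1
  rw [← h1, invol_invol]

/-- The second half of the exchange: in the formula for contracting the contracting form, the term
containing a ∧ vol vanishes for degree reasons. -/
theorem hodgeL_intProd (h : IsHermitianPair B I) (a : CDual T) (β : CExt T) :
    hodgeL B I (intProd (dualMetric (fun v w => B v w) a) β) = -(hodgeL B I β * ι ℂ a) := by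
  rw [hodgeL_apply, ctr_intProd _ (dualMetric_comm h), ι_mul_volForm h, map_zero, zero_sub,
    ← hodgeL_apply, hodgeL_invol h, mul_ι_eq]

/-- The two exchange rules carry ** past each covector at the cost of a sign, and ** 1 = * vol = 1
starts the induction. In even dimension no further sign appears. -/
theorem hodgeL_hodgeL (h : IsHermitianPair B I) (η : CExt T) :
    hodgeL B I (hodgeL B I η) = invol η := by
  induction η using right_induction with
  | scalar r =>
    rw [hodgeL_apply, hodgeL_apply, ctr_algebraMap, ctr_smul, LinearMap.smul_apply, ctr_volForm h,
      AlgHom.commutes, Algebra.algebraMap_eq_smul_one]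
  | add x y hx hy => rw [map_add, map_add, hx, hy, map_add]
  | mul_ι m x hx => rw [hodgeL_mul_ι, hodgeL_intProd h, hx, map_mul, invol_ι, mul_neg]

theorem ι_mul_hodgeL (h : IsHermitianPair B I) (b : CDual T) (η : CExt T) :
    hodgeL B I (ι ℂ b * hodgeL B I η) = intProd (dualMetric (fun v w => B v w) b) η := by
  have h1 : ι ℂ b * hodgeL B I η = hodgeL B I (-intProd (dualMetric (fun v w => B v w) b)
      (invol η)) := by
    rw [map_neg, hodgeL_intProd h, neg_neg, mul_ι_eq, hodgeL_invol h, invol_invol]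
  rw [h1, hodgeL_hodgeL h, map_neg, intProd_scale, map_smul, ← invol, invol_invol, neg_one_smul,
    neg_neg]

/-- The factors of η are of type (1,0), and contraction with their duals preserves the holomorphic
degree. Applied to vol, this puts *η in holomorphic degree m. -/
theorem holPart_ctr {η : CExt T} (h : IsHermitianPair B I) (hη : η ∈ extStar0 I) (p : ℕ)
    (ξ : CExt T) :
    holPart I p (ctr (fun v w => B v w) η ξ) = ctr (fun v w => B v w) η (holPart I p ξ) := by
  induction hη using Algebra.adjoin_induction generalizing ξ with
  | mem x hx =>
    obtain ⟨α, hα, rfl⟩ := hx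
    rw [ctr_ι, ctr_ι, holPart_intProd_of_proj10 I (dualMetric_of_mem h hα)]
  | algebraMap r => rw [ctr_algebraMap, ctr_algebraMap, holPart_smul]
  | add x y _ _ hx hy =>
    rw [ctr_add, LinearMap.add_apply, LinearMap.add_apply, holPart_add, hx, hy]
  | mul x y _ _ hx hy => rw [ctr_mul, hy, hx, ctr_mul]

theorem holPart_hodgeL {η : CExt T} (h : IsHermitianPair B I) (hη : η ∈ extStar0 I) :
    holPart I (finrank ℝ T / 2) (hodgeL B I η) = hodgeL B I η := by
  rw [hodgeL_apply, holPart_ctr h hη, holPart_volForm h]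

theorem holPart_hodgeL_of_ne {η : CExt T} (h : IsHermitianPair B I) (hη : η ∈ extStar0 I) {p : ℕ}
    (hp : p ≠ finrank ℝ T / 2) : holPart I p (hodgeL B I η) = 0 := by
  rw [hodgeL_apply, holPart_ctr h hη, holPart_volForm_of_ne h hp, map_zero]

omit [Module.Finite ℝ T] in
-- A complex vector splits into a part that preserves the holomorphic degree and a part that lowers
-- it by one.
theorem holPart_intProd_split (d : Module.Dual ℂ (CDual T)) (hI : ∀ v, I (I v) = -v) (p : ℕ)
    (ξ : CExt T) :
    holPart I p (intProd d ξ) = intProd (d ∘ₗ proj01 I) (holPart I p ξ) +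
      intProd (d ∘ₗ proj10 I) (holPart I (p + 1) ξ) := by
  have hd : d = d ∘ₗ proj01 I + d ∘ₗ proj10 I := by
    ext α
    rw [LinearMap.add_apply, LinearMap.comp_apply, LinearMap.comp_apply, ← map_add, add_comm,
      proj10_add_proj01]
  conv_lhs => rw [hd, intProd_add_left, holPart_add]
  rw [holPart_intProd_of_proj10, holPart_intProd_of_proj01]
  · intro α; rw [LinearMap.comp_apply, proj10_proj01 hI, map_zero]
  · intro α; rw [LinearMap.comp_apply, proj01_proj10 hI, map_zero]

/-- The star operator maps forms of top holomorphic degree to forms of type `(*,0)`. -/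
theorem hodgeL_mem_extStar0 (h : IsHermitianPair B I) (ξ : CExt T) :
    hodgeL B I (holPart I (finrank ℝ T / 2) ξ) ∈ extStar0 I := by
  refine mem_extStar0_of_typeScale h.sq ?_
  set β := holPart I (finrank ℝ T / 2) ξ with hβ
  -- The scalings (2,1) and (1,2) of the two types are adjoint. On β the first is 2^m, and on vol
  -- the second is 2^m, so the scaling (1,2) fixes *β and no antiholomorphic covectors occur in it.
  have h1 : ∀ a b, dualMetric (fun v w => B v w)
      (((2 : ℂ) • proj10 I + (1 : ℂ) • proj01 I : _ →ₗ[ℂ] CDual T) a) b =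
      dualMetric (fun v w => B v w) a
        (((1 : ℂ) • proj10 I + (2 : ℂ) • proj01 I : _ →ₗ[ℂ] CDual T) b) := fun a b => by
    simp only [LinearMap.add_apply, LinearMap.smul_apply, map_add, map_smul,
      dualMetric_proj10 h, dualMetric_proj01 h]
    abel
  have h2 := ctr_map h1 β (volForm (fun v w => B v w) I)
  have h3 : typeScale I 2 1 β = (2 : ℂ) ^ (finrank ℝ T / 2) • β := by
    rw [hβ, typeScale_holPart h.sq]
  change ctr _ β (typeScale I 1 2 _) = typeScale I 1 2 (ctr _ (typeScale I 2 1 β) _) at h2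
  rw [typeScale_volForm h, h3, ctr_smul, LinearMap.smul_apply, map_smul, map_smul] at h2
  exact (smul_right_injective _ (pow_ne_zero _ two_ne_zero) h2).symm

end Star

/-! #### The holomorphic symplectic form -/

section Omega

variable {T : Type*} [AddCommGroup T] [Module ℝ T] [Module.Finite ℝ T]

/-- A metric that is Hermitian for a quaternionic triple `I, J, IJ`. -/
structure IsQuaternionHermitian (B : T →ₗ[ℝ] T →ₗ[ℝ] ℝ) (I J : T →ₗ[ℝ] T) : Prop where
  left : IsHermitianPair B I
  right : IsHermitianPair B J
  anti : ∀ v, J (I v) = -I (J v)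

variable {B : T →ₗ[ℝ] T →ₗ[ℝ] ℝ} {I J : T →ₗ[ℝ] T}

variable (B I J) in
/-- The form `Ω = ½ (ω_J + i ω_{IJ})`. -/
def holSympForm : CExt T :=
  (1 / 2 : ℂ) • ((twoForm fun v w => B v (J w)) + Complex.I • twoForm fun v w => B v (I (J w)))

theorem scale_holSympForm (t : ℂ) : scale t (holSympForm B I J) = t ^ 2 • holSympForm B I J := by
  rw [holSympForm, map_smul, map_add, map_smul, scale_twoForm, scale_twoForm, smul_comm (t ^ 2)]
  congr 1
  rw [smul_add, smul_comm (t ^ 2)]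

omit [Module.Finite ℝ T] in
theorem IsHermitianPair.right_skew {I : T →ₗ[ℝ] T} (h : IsHermitianPair B I) (v w : T) :
    B v (I w) = -B w (I v) := by
  rw [h.symm w, h.skew, neg_neg]

omit [Module.Finite ℝ T] in
theorem IsQuaternionHermitian.pair_mul (h : IsQuaternionHermitian B I J) :
    IsHermitianPair B (I ∘ₗ J) where
  symm := h.left.symm
  pos := h.left.pos
  sq v := by
    rw [LinearMap.comp_apply, LinearMap.comp_apply, h.anti, map_neg, h.left.sq, h.right.sq]
    simp
  inv v w := by rw [LinearMap.comp_apply, LinearMap.comp_apply, h.left.inv, h.right.inv]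

/-- The contraction of `Ω`. -/
theorem intProd_holSympForm (h : IsQuaternionHermitian B I J) (a : CDual T) :
    intProd (dualMetric (fun v w => B v w) a) (holSympForm B I J) =
      (1 / 2 : ℂ) • ι ℂ (covPull J a + Complex.I • covPull J (covPull I a)) := by
  have key : ∀ {K : T →ₗ[ℝ] T}, IsHermitianPair B K →
      intProd (dualMetric (fun v w => B v w) a) (twoForm fun v w => B v (K w)) =
      ι ℂ (covPull K a) := fun {K} hK => by
    refine (intProd_twoForm (B.compl₂ K) (fun v w => hK.right_skew v w) _).trans ?_
    conv_rhs => rw [← sum_dualMetric_coBasis h.left a, map_sum, map_sum]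
    refine Finset.sum_congr rfl fun i _ => ?_
    rw [map_smul, map_smul]
    rfl
  rw [holSympForm, map_smul, map_add, map_smul, key h.right]
  have := key h.pair_mul
  simp only [LinearMap.comp_apply] at this
  rw [this, map_add, map_smul]
  rfl

/-- The contraction of `Ω` with a covector of type `(0,1)` is the action of `-J`. -/
theorem intProd_holSympForm_proj01 (h : IsQuaternionHermitian B I J) (a : CDual T) :
    intProd (dualMetric (fun v w => B v w) (proj01 I a)) (holSympForm B I J) =
      ι ℂ (covPull J (proj01 I a)) := by
  -- On a (0,1)-covector, composition with I is multiplication by -i, so the ω_J and ω_K halves of Ω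
  -- contribute equally; on a (1,0)-covector they would cancel.
  have h1 : covPull I (proj01 I a) = -Complex.I • proj01 I a := by
    rw [← proj10_neg]
    have h2 := mem_type10.1 (proj10_mem (I := -I) (fun v => by simp [h.left.sq]) a)
    rw [covPull_neg] at h2
    rw [neg_smul, ← h2, neg_neg]
  rw [intProd_holSympForm h, h1, map_smul, smul_smul, mul_neg, Complex.I_mul_I, neg_neg, one_smul,
    ← two_smul ℂ, map_smul, smul_smul]
  norm_num

end Omega

/-! ### Naturality of types and of the star operator -/

section Naturality

variable {T T' : Type*} [AddCommGroup T] [Module ℝ T] [AddCommGroup T'] [Module ℝ T']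

theorem covPull_proj10 {A : T →ₗ[ℝ] T'} {I : T →ₗ[ℝ] T} {I' : T' →ₗ[ℝ] T'}
    (hA : ∀ v, I' (A v) = A (I v)) (α : CDual T') :
    covPull A (proj10 I' α) = proj10 I (covPull A α) := by
  ext v
  simp [proj10_apply_eq, covPull_apply, hA]

theorem covPull_proj01 {A : T →ₗ[ℝ] T'} {I : T →ₗ[ℝ] T} {I' : T' →ₗ[ℝ] T'}
    (hA : ∀ v, I' (A v) = A (I v)) (α : CDual T') :
    covPull A (proj01 I' α) = proj01 I (covPull A α) := by
  ext v
  simp [proj01_apply_eq, covPull_apply, hA]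

theorem extPull_holPart {A : T →ₗ[ℝ] T'} {I : T →ₗ[ℝ] T} {I' : T' →ₗ[ℝ] T'}
    (hA : ∀ v, I' (A v) = A (I v)) (p : ℕ) (ξ : CExt T') :
    extPull A (holPart I' p ξ) = holPart I p (extPull A ξ) := by
  induction ξ using left_induction generalizing p with
  | scalar r =>
    rw [AlgHom.commutes]
    cases p with
    | zero => rw [holPart_algebraMap_zero, holPart_algebraMap_zero, AlgHom.commutes]
    | succ p => rw [holPart_algebraMap_succ, holPart_algebraMap_succ, map_zero]
  | add x y hx hy => rw [holPart_add, map_add, hx, hy, map_add, holPart_add]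
  | ι_mul m x hx =>
    cases p with
    | zero =>
      rw [holPart_zero_ι_mul, map_mul, map_mul, extPull_ι, extPull_ι, holPart_zero_ι_mul, hx,
        covPull_proj01 hA]
    | succ p =>
      rw [holPart_succ_ι_mul, map_add, map_mul, map_mul, map_mul, extPull_ι, extPull_ι, extPull_ι,
        holPart_succ_ι_mul, hx, hx, covPull_proj01 hA, covPull_proj10 hA]

theorem extPull_mem_extStar0 {A : T →ₗ[ℝ] T'} {I : T →ₗ[ℝ] T} {I' : T' →ₗ[ℝ] T'}
    (hA : ∀ v, I' (A v) = A (I v)) (hI : ∀ v, I (I v) = -v) {ξ : CExt T'}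
    (hξ : ξ ∈ extStar0 I') : extPull A ξ ∈ extStar0 I := by
  have h1 : extPull A (map (proj10 I') ξ) = map (proj10 I) (extPull A ξ) := by
    rw [extPull, map_map_apply, map_map_apply]
    congr 2
    exact LinearMap.ext fun α => covPull_proj10 hA α
  rw [← map_proj10_of_mem hξ, h1]
  exact map_proj10_mem hI _

theorem extPull_symm_extPull (A : T ≃ₗ[ℝ] T') (ξ : CExt T) :
    extPull A.toLinearMap (extPull A.symm.toLinearMap ξ) = ξ := by
  rw [extPull_extPull]
  convert extPull_id ξ
  ext v
  simp

theorem extPull_extPull_symm (A : T ≃ₗ[ℝ] T') (ξ : CExt T') :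
    extPull A.symm.toLinearMap (extPull A.toLinearMap ξ) = ξ := extPull_symm_extPull A.symm ξ

variable [Module.Finite ℝ T] [Module.Finite ℝ T']

/-- An I-linear isometry matches volume forms and dual metrics, and * is built from these alone. -/
theorem extPull_hodgeL {B : T →ₗ[ℝ] T →ₗ[ℝ] ℝ} {B' : T' →ₗ[ℝ] T' →ₗ[ℝ] ℝ} {I : T →ₗ[ℝ] T}
    {I' : T' →ₗ[ℝ] T'} (h' : IsHermitianPair B' I') (h : IsHermitianPair B I) (A : T ≃ₗ[ℝ] T')
    (hB : ∀ v w, B v w = B' (A v) (A w)) (hA : ∀ v, I' (A v) = A (I v)) (η : CExt T') :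
    extPull A.toLinearMap (hodgeL B' I' η) = hodgeL B I (extPull A.toLinearMap η) := by
  have hvol : extPull A.toLinearMap (volForm (fun v w => B' v w) I') =
      volForm (fun v w => B v w) I := by
    rw [volForm, volForm, map_smul, map_pow, A.finrank_eq]
    congr 2
    refine (extPull_twoForm (B' ∘ₗ I') A.toLinearMap).trans ?_
    congr 1
    funext v w
    simp [hB, hA]
  have h1 := ctr_map (fun a b => (dualMetric_covPull h' h A hB a b).symm) η (volForm (fun v w => B v w) I)
  have h2 := congrArg (extPull A.toLinearMap) h1
  have h3 : ∀ ξ : CExt T, map (covPull A.symm.toLinearMap) ξ = extPull A.symm.toLinearMap ξ :=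
    fun ξ => rfl
  rw [h3, h3, extPull_symm_extPull, ← hvol, extPull_extPull_symm, hvol] at h2
  exact h2

end Naturality

/-! ### Calculus of forms on a vector space -/

section Norms

variable (T : Type*) [AddCommGroup T] [Module ℝ T] [Module.Finite ℝ T]

/-- The norm on forms given by the coefficients. -/
@[reducible] def extNormed : NormedAddCommGroup (CExt T) :=
  NormedAddCommGroup.induced (CExt T) (Finset (Fin (finrank ℝ T)) → ℂ) (extCoord T)
    (extCoord T).injective

attribute [local instance] extNormed

/-- The complex normed space of forms. -/
@[reducible] def extNormedSpaceC : NormedSpace ℂ (CExt T) :=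
  NormedSpace.induced ℂ (CExt T) (Finset (Fin (finrank ℝ T)) → ℂ) (extCoord T).toLinearMap

/-- The real normed space of forms. -/
@[reducible] def extNormedSpaceR : NormedSpace ℝ (CExt T) :=
  NormedSpace.induced ℝ (CExt T) (Finset (Fin (finrank ℝ T)) → ℂ)
    ((extCoord T).toLinearMap.restrictScalars ℝ)

theorem ext_finite_complex : Module.Finite ℂ (CExt T) := Module.Finite.equiv (extCoord T).symm

attribute [local instance] ext_finite_complex

theorem ext_finite_real : Module.Finite ℝ (CExt T) := Module.Finite.trans ℂ _

end Norms

attribute [local instance] extNormed extNormedSpaceC extNormedSpaceR ext_finite_complex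
  ext_finite_real

/-! ### Exterior derivatives, products and pull-backs. -/

section Calculus

variable {E : Type*} [NormedAddCommGroup E] [NormedSpace ℝ E] [FiniteDimensional ℝ E]

variable (E) in
/-- The coefficients of a form, as a continuous linear equivalence. -/
def extCoordCLE : CExt E ≃L[ℝ] (Finset (Fin (finrank ℝ E)) → ℂ) :=
  ((extCoord E).restrictScalars ℝ).toContinuousLinearEquiv

variable (E) in
/-- Multiplication of forms as a continuous bilinear map. -/
def extMul : CExt E →L[ℝ] CExt E →L[ℝ] CExt E :=
  (LinearMap.mul ℝ (CExt E)).toContinuousBilinearMap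

/-- A complex linear map of forms as a continuous linear map. -/
def extCLM {X : Type*} [NormedAddCommGroup X] [NormedSpace ℝ X] [NormedSpace ℂ X]
    [IsScalarTower ℝ ℂ X] (L : CExt E →ₗ[ℂ] X) : CExt E →L[ℝ] X :=
  (L.restrictScalars ℝ).toContinuousLinearMap

theorem contDiffOn_extCoord_iff {S : Set E} {f : E → CExt E} :
    ContDiffOn ℝ ∞ (fun y => extCoord E (f y)) S ↔ ContDiffOn ℝ ∞ f S :=
  (extCoordCLE E).comp_contDiffOn_iff

theorem extDerivE_eq (f : E → CExt E) (y : E) :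
    extDerivE f y = ∑ i, ι ℂ (coBasis E i) * fderiv ℝ f y (finBasis ℝ E i) := by
  refine Finset.sum_congr rfl fun i _ => ?_
  have h1 : (fun z => extCoord E (f z)) = extCoordCLE E ∘ f := rfl
  rw [h1, ContinuousLinearEquiv.comp_fderiv]
  congr 1
  exact (extCoord E).symm_apply_apply _

theorem extDerivE_congr {f g : E → CExt E} {y : E} (h : f =ᶠ[nhds y] g) :
    extDerivE f y = extDerivE g y := by
  rw [extDerivE_eq, extDerivE_eq, h.fderiv_eq]

theorem extDerivE_zero (y : E) : extDerivE (fun _ => (0 : CExt E)) y = 0 := by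
  rw [extDerivE_eq]
  simp

theorem extDerivE_add {f g : E → CExt E} {y : E} (hf : DifferentiableAt ℝ f y)
    (hg : DifferentiableAt ℝ g y) :
    extDerivE (fun z => f z + g z) y = extDerivE f y + extDerivE g y := by
  simp only [extDerivE_eq, fderiv_fun_add hf hg, add_apply, mul_add,
    Finset.sum_add_distrib]

theorem extDerivE_const_smul {f : E → CExt E} {y : E} (c : ℂ) (hf : DifferentiableAt ℝ f y) :
    extDerivE (fun z => c • f z) y = c • extDerivE f y := by
  simp only [extDerivE_eq, fderiv_fun_const_smul hf, Finset.smul_sum]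
  exact Finset.sum_congr rfl fun i _ => mul_smul_comm c _ _

theorem extDerivE_sum {J : Type*} (s : Finset J) {f : J → E → CExt E} {y : E}
    (hf : ∀ j ∈ s, DifferentiableAt ℝ (f j) y) :
    extDerivE (fun z => ∑ j ∈ s, f j z) y = ∑ j ∈ s, extDerivE (f j) y := by
  simp only [extDerivE_eq, fderiv_fun_sum hf, sum_apply, Finset.mul_sum]
  exact Finset.sum_comm

theorem DifferentiableAt.ext_mul {f g : E → CExt E} {y : E} (hf : DifferentiableAt ℝ f y)
    (hg : DifferentiableAt ℝ g y) : DifferentiableAt ℝ (fun z => f z * g z) y :=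
  ((extMul E).hasFDerivAt_of_bilinear hf.hasFDerivAt hg.hasFDerivAt).differentiableAt

theorem fderiv_ext_mul {f g : E → CExt E} {y : E} (hf : DifferentiableAt ℝ f y)
    (hg : DifferentiableAt ℝ g y) (v : E) :
    fderiv ℝ (fun z => f z * g z) y v = fderiv ℝ f y v * g y + f y * fderiv ℝ g y v := by
  have h := ((extMul E).hasFDerivAt_of_bilinear hf.hasFDerivAt hg.hasFDerivAt).fderiv
  refine (congrArg (fun L => L v) h).trans ?_
  exact add_comm _ _

theorem fderiv_ext_smul {h : E → ℂ} {g : E → CExt E} {y : E} (hh : DifferentiableAt ℝ h y)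
    (hg : DifferentiableAt ℝ g y) (v : E) :
    fderiv ℝ (fun z => h z • g z) y v = fderiv ℝ h y v • g y + h y • fderiv ℝ g y v := by
  rw [fderiv_fun_smul hh hg]
  exact add_comm _ _

/-- The differential of a function, as a covector. -/
def dfun (h : E → ℂ) (y : E) : CDual E := (fderiv ℝ h y).toLinearMap

theorem extDerivE_smul {h : E → ℂ} {g : E → CExt E} {y : E} (hh : DifferentiableAt ℝ h y)
    (hg : DifferentiableAt ℝ g y) :
    extDerivE (fun z => h z • g z) y = ι ℂ (dfun h y) * g y + h y • extDerivE g y := by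
  simp only [extDerivE_eq, fderiv_ext_smul hh hg, mul_add, Finset.sum_add_distrib,
    mul_smul_comm, Finset.smul_sum]
  congr 1
  rw [← sum_map_coBasis (ι ℂ) (dfun h y), Finset.sum_mul]
  exact Finset.sum_congr rfl fun i _ => (smul_mul_assoc _ _ _).symm

theorem extDerivE_ι_mul {β : E → CDual E} {g : E → CExt E} {y : E}
    (hβ : DifferentiableAt ℝ (fun z => ι ℂ (β z)) y) (hg : DifferentiableAt ℝ g y) :
    extDerivE (fun z => ι ℂ (β z) * g z) y =
      extDerivE (fun z => ι ℂ (β z)) y * g y - ι ℂ (β y) * extDerivE g y := by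
  simp only [extDerivE_eq, fderiv_ext_mul hβ hg, mul_add, Finset.sum_add_distrib,
    Finset.sum_mul, Finset.mul_sum, sub_eq_add_neg, ← Finset.sum_neg_distrib]
  congr 1
  · exact Finset.sum_congr rfl fun i _ => (mul_assoc _ _ _).symm
  · refine Finset.sum_congr rfl fun i _ => ?_
    rw [← mul_assoc, ← mul_assoc, ← neg_mul,
      eq_neg_of_add_eq_zero_left (ι_add_mul_swap (coBasis E i) (β y))]

theorem DifferentiableAt.extCLM {X : Type*} [NormedAddCommGroup X] [NormedSpace ℝ X]
    [NormedSpace ℂ X] [IsScalarTower ℝ ℂ X] (L : CExt E →ₗ[ℂ] X) {f : E → CExt E} {y : E}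
    (hf : DifferentiableAt ℝ f y) : DifferentiableAt ℝ (fun z => L (f z)) y :=
  (_root_.extCLM L).differentiableAt.comp y hf

theorem fderiv_extCLM {X : Type*} [NormedAddCommGroup X] [NormedSpace ℝ X]
    [NormedSpace ℂ X] [IsScalarTower ℝ ℂ X] (L : CExt E →ₗ[ℂ] X) {f : E → CExt E} {y : E}
    (hf : DifferentiableAt ℝ f y) (v : E) :
    fderiv ℝ (fun z => L (f z)) y v = L (fderiv ℝ f y v) := by
  have h1 := ((extCLM L).hasFDerivAt.comp y hf.hasFDerivAt).fderiv
  exact congrArg (fun L => L v) h1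

/-- A form of the statement that d raises the degree by one which needs no homogeneous argument. -/
theorem extDerivE_scale {f : E → CExt E} {y : E} (t : ℂ) (hf : DifferentiableAt ℝ f y) :
    scale t (extDerivE f y) = t • extDerivE (fun z => scale t (f z)) y := by
  have h := fderiv_extCLM (scale t : CExt E →ₐ[ℂ] CExt E).toLinearMap hf
  simp only [AlgHom.toLinearMap_apply] at h
  simp only [extDerivE_eq, h, map_sum, map_mul, scale_ι, smul_mul_assoc, Finset.smul_sum]

/-- A coefficient of a form. -/
def extCoeff (S : Finset (Fin (finrank ℝ E))) : CExt E →ₗ[ℂ] ℂ :=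
  LinearMap.proj S ∘ₗ (extCoord E).toLinearMap

theorem sum_extCoeff (ξ : CExt E) :
    ∑ S, extCoeff S ξ • (coBasis E).ExteriorAlgebra S = ξ :=
  (coBasis E).ExteriorAlgebra.sum_equivFun ξ

/-! #### Pull-back by smooth maps -/

theorem ι_covPull_eq (A : E →ₗ[ℝ] E) (a : CDual E) :
    ι ℂ (covPull A a) = ∑ j, a (A (finBasis ℝ E j)) • ι ℂ (coBasis E j) :=
  (sum_map_coBasis (ι ℂ) (covPull A a)).symm

theorem hasFDerivAt_ι_covPull {τ : E → E} {y : E} (hτ : ContDiffAt ℝ 2 τ y) (a : CDual E) :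
    HasFDerivAt (fun z => ι ℂ (covPull (fderiv ℝ τ z).toLinearMap a))
      (∑ j, ((a.toContinuousLinearMap ∘L
        (ContinuousLinearMap.apply ℝ E (finBasis ℝ E j)) ∘L fderiv ℝ (fderiv ℝ τ) y).smulRight
          (ι ℂ (coBasis E j)))) y := by
  simp only [ι_covPull_eq]
  have h1 : DifferentiableAt ℝ (fderiv ℝ τ) y :=
    (hτ.fderiv_right (m := 1) (by norm_num)).differentiableAt (by norm_num)
  refine HasFDerivAt.fun_sum fun j _ => ?_
  have h2 := ((a.toContinuousLinearMap ∘L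
    (ContinuousLinearMap.apply ℝ E (finBasis ℝ E j))).hasFDerivAt.comp y h1.hasFDerivAt)
  exact h2.smul_const _

/-- The pull-back of a constant form is closed. -/
theorem extDerivE_extPull_const {τ : E → E} {y : E} (hτ : ContDiffAt ℝ 2 τ y) (ξ : CExt E) :
    DifferentiableAt ℝ (fun z => extPull (fderiv ℝ τ z).toLinearMap ξ) y ∧
      extDerivE (fun z => extPull (fderiv ℝ τ z).toLinearMap ξ) y = 0 := by
  induction ξ using left_induction with
  | scalar r =>
    simp only [AlgHom.commutes]
    refine ⟨differentiableAt_const _, ?_⟩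
    rw [extDerivE_eq]
    simp
  | add ξ ξ' h h' =>
    simp only [map_add]
    exact ⟨h.1.add h'.1, by rw [extDerivE_add h.1 h'.1, h.2, h'.2, add_zero]⟩
  | ι_mul a ξ h =>
    simp only [map_mul, extPull_ι]
    have ha := hasFDerivAt_ι_covPull hτ a
    refine ⟨ha.differentiableAt.ext_mul h.1, ?_⟩
    rw [extDerivE_ι_mul ha.differentiableAt h.1, h.2, mul_zero, sub_zero]
    have h0 : extDerivE (fun z => ι ℂ (covPull (fderiv ℝ τ z).toLinearMap a)) y = 0 := by
      -- The coefficients of d(τ*a) for a constant covector a are the second derivatives of τ paired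
      -- with a; their symmetry cancels them against e^i ∧ e^j.
      have hsymm : IsSymmSndFDerivAt ℝ τ y := hτ.isSymmSndFDerivAt (by simp)
      rw [extDerivE_eq, ha.fderiv]
      set c : Fin (finrank ℝ E) → Fin (finrank ℝ E) → ℂ := fun i j =>
        a (fderiv ℝ (fderiv ℝ τ) y (finBasis ℝ E i) (finBasis ℝ E j)) with hc
      have hcs : ∀ i j, c i j = c j i := fun i j => by
        rw [hc]; exact congrArg a (hsymm _ _)
      have h1 : ∀ i, ι ℂ (coBasis E i) * (∑ j, ((a.toContinuousLinearMap ∘L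
          (ContinuousLinearMap.apply ℝ E (finBasis ℝ E j)) ∘L fderiv ℝ (fderiv ℝ τ) y).smulRight
          (ι ℂ (coBasis E j)))) (finBasis ℝ E i) =
          ∑ j, c i j • (ι ℂ (coBasis E i) * ι ℂ (coBasis E j)) := fun i => by
        rw [sum_apply, Finset.mul_sum]
        refine Finset.sum_congr rfl fun j _ => ?_
        rw [← mul_smul_comm]
        rfl
      simp only [h1]
      have h2 : ∑ i, ∑ j, c i j • (ι ℂ (coBasis E i) * ι ℂ (coBasis E j)) =
          -∑ i, ∑ j, c i j • (ι ℂ (coBasis E i) * ι ℂ (coBasis E j)) := by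
        conv_lhs => rw [Finset.sum_comm]
        simp only [← Finset.sum_neg_distrib]
        refine Finset.sum_congr rfl fun i _ => Finset.sum_congr rfl fun j _ => ?_
        rw [hcs j i, ← smul_neg, eq_neg_of_add_eq_zero_left (ι_add_mul_swap _ _)]
      have h3 := eq_neg_iff_add_eq_zero.1 h2
      rw [← two_smul ℂ] at h3
      exact (smul_eq_zero.1 h3).resolve_left two_ne_zero
    rw [h0, zero_mul]

/-- The exterior derivative commutes with pull-backs. -/
theorem extDerivE_extPull {τ : E → E} {y : E} (hτ : ContDiffAt ℝ 2 τ y) {g : E → CExt E}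
    (hg : DifferentiableAt ℝ g (τ y)) :
    extDerivE (fun z => extPull (fderiv ℝ τ z).toLinearMap (g (τ z))) y =
      extPull (fderiv ℝ τ y).toLinearMap (extDerivE g (τ y)) := by
  have hτ1 : DifferentiableAt ℝ τ y := hτ.differentiableAt (by norm_num)
  have hc : ∀ S, DifferentiableAt ℝ (fun z => extCoeff S (g z)) (τ y) := fun S => hg.extCLM _
  have hc' : ∀ S, DifferentiableAt ℝ (fun z => extCoeff S (g (τ z))) y := fun S =>
    (hc S).comp y hτ1
  have hchain : ∀ S, dfun (fun z => extCoeff S (g (τ z))) y =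
      covPull (fderiv ℝ τ y).toLinearMap (dfun (fun z => extCoeff S (g z)) (τ y)) := fun S => by
    have h1 := ((hc S).hasFDerivAt.comp y hτ1.hasFDerivAt).fderiv
    exact congrArg ContinuousLinearMap.toLinearMap h1
  have hconst := fun S => extDerivE_extPull_const hτ ((coBasis E).ExteriorAlgebra S)
  -- The form is expanded with function coefficients in constant monomials. Pull-backs of the latter
  -- are closed, so d falls only on the coefficients, where the chain rule applies.
  have e1 : (fun z => extPull (fderiv ℝ τ z).toLinearMap (g (τ z))) = fun z =>
      ∑ S, extCoeff S (g (τ z)) •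
        extPull (fderiv ℝ τ z).toLinearMap ((coBasis E).ExteriorAlgebra S) := by
    funext z
    conv_lhs => rw [← sum_extCoeff (g (τ z)), map_sum]
    simp only [map_smul]
  have e2 : g = fun z => ∑ S, extCoeff S (g z) • (coBasis E).ExteriorAlgebra S := by
    funext z
    exact (sum_extCoeff (g z)).symm
  have e3 : extDerivE g (τ y) = ∑ S, ι ℂ (dfun (fun z => extCoeff S (g z)) (τ y)) *
      (coBasis E).ExteriorAlgebra S := by
    conv_lhs => rw [e2]
    rw [extDerivE_sum _ fun S _ => (hc S).fun_smul (differentiableAt_const _)]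
    refine Finset.sum_congr rfl fun S _ => ?_
    rw [extDerivE_smul (hc S) (differentiableAt_const _), extDerivE_eq]
    simp
  rw [e1, extDerivE_sum _ fun S _ => (hc' S).fun_smul (hconst S).1, e3, map_sum]
  refine Finset.sum_congr rfl fun S _ => ?_
  rw [extDerivE_smul (hc' S) (hconst S).1, (hconst S).2, smul_zero, add_zero, hchain, map_mul,
    extPull_ι]

end Calculus

/-! ### Smooth families of operators on forms -/

section Families

variable {E : Type*} [NormedAddCommGroup E] [NormedSpace ℝ E] [FiniteDimensional ℝ E]
variable {U : Set E}

theorem ContDiffOn.ext_mul {f g : E → CExt E} (hf : ContDiffOn ℝ ∞ f U)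
    (hg : ContDiffOn ℝ ∞ g U) : ContDiffOn ℝ ∞ (fun y => f y * g y) U :=
  (extMul E).isBoundedBilinearMap.contDiff.comp_contDiffOn (hf.prodMk hg)

theorem ContDiffOn.ext_linear {X : Type*} [NormedAddCommGroup X] [NormedSpace ℝ X]
    [NormedSpace ℂ X] [IsScalarTower ℝ ℂ X] (L : CExt E →ₗ[ℂ] X) {f : E → CExt E}
    (hf : ContDiffOn ℝ ∞ f U) : ContDiffOn ℝ ∞ (fun y => L (f y)) U :=
  (extCLM L).contDiff.comp_contDiffOn hf

theorem ContDiffOn.ext_smul {h : E → ℂ} {f : E → CExt E} (hh : ContDiffOn ℝ ∞ h U)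
    (hf : ContDiffOn ℝ ∞ f U) : ContDiffOn ℝ ∞ (fun y => h y • f y) U := hh.smul hf

theorem ctr_sum_smul {J : Type*} (s : E → E → ℝ) (S : Finset J) (c : J → ℂ) (b : J → CExt E)
    (ξ : CExt E) : ctr s (∑ j ∈ S, c j • b j) ξ = ∑ j ∈ S, c j • ctr s (b j) ξ := by
  have hlin : ∀ η, ctr s η ξ = (LinearMap.applyₗ ξ ∘ₗ
      (MulOpposite.opLinearEquiv ℂ).symm.toLinearMap ∘ₗ (contract s).toLinearMap) η := fun η => rfl
  simp only [hlin, map_sum, map_smul]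

/-- A family of linear operators that is smooth on constant forms is smooth on smooth forms. -/
theorem ContDiffOn.ext_family {F : E → CExt E →ₗ[ℂ] CExt E}
    (hF : ∀ ξ, ContDiffOn ℝ ∞ (fun y => F y ξ) U) {f : E → CExt E} (hf : ContDiffOn ℝ ∞ f U) :
    ContDiffOn ℝ ∞ (fun y => F y (f y)) U := by
  have h1 : ∀ y, F y (f y) = ∑ S, extCoeff S (f y) • F y ((coBasis E).ExteriorAlgebra S) :=
    fun y => by
      conv_lhs => rw [← sum_extCoeff (f y), map_sum]
      simp only [map_smul]
  simp only [h1]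
  exact ContDiffOn.sum fun S _ => (hf.ext_linear (extCoeff S)).ext_smul (hF _)

theorem contDiffOn_ι {β : E → CDual E} (hβ : ∀ v, ContDiffOn ℝ ∞ (fun y => β y v) U) :
    ContDiffOn ℝ ∞ (fun y => ι ℂ (β y)) U := by
  have h1 : ∀ y, ι ℂ (β y) = ∑ i, β y (finBasis ℝ E i) • ι ℂ (coBasis E i) := fun y =>
    (sum_map_coBasis (ι ℂ) (β y)).symm
  simp only [h1]
  exact ContDiffOn.sum fun i _ => (hβ _).ext_smul contDiffOn_const

theorem dual_eq_sum (d : Module.Dual ℂ (CDual E)) :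
    d = ∑ i, d (coBasis E i) • covEval (finBasis ℝ E i) := by
  ext α
  rw [← sum_map_coBasis d α, LinearMap.sum_apply]
  exact Finset.sum_congr rfl fun i _ => mul_comm _ _

theorem intProd_eq_sum (d : Module.Dual ℂ (CDual E)) (ξ : CExt E) :
    intProd d ξ = ∑ i, d (coBasis E i) • intProd (covEval (finBasis ℝ E i)) ξ := by
  conv_lhs => rw [dual_eq_sum d, intProd, map_sum, LinearMap.sum_apply]
  exact Finset.sum_congr rfl fun i _ => intProd_smul_left _ _ _

theorem ContDiffOn.intProd {d : E → Module.Dual ℂ (CDual E)}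
    (hd : ∀ a, ContDiffOn ℝ ∞ (fun y => d y a) U) {f : E → CExt E} (hf : ContDiffOn ℝ ∞ f U) :
    ContDiffOn ℝ ∞ (fun y => ExteriorAlgebra.intProd (d y) (f y)) U := by
  simp only [intProd_eq_sum (d _)]
  exact ContDiffOn.sum fun i _ => (hd _).ext_smul (hf.ext_linear _)

/-- A complex-valued covector as a smooth function of its argument. -/
theorem ContDiffOn.covector {X : Type*} [NormedAddCommGroup X] [NormedSpace ℝ X]
    (a : E →ₗ[ℝ] X) {f : E → E} (hf : ContDiffOn ℝ ∞ f U) :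
    ContDiffOn ℝ ∞ (fun y => a (f y)) U :=
  a.toContinuousLinearMap.contDiff.comp_contDiffOn hf

theorem ContDiffOn.extDerivE (hU : IsOpen U) {f : E → CExt E} (hf : ContDiffOn ℝ ∞ f U) :
    ContDiffOn ℝ ∞ (fun y => _root_.extDerivE f y) U := by
  simp only [extDerivE_eq]
  have h1 : ContDiffOn ℝ ∞ (fderiv ℝ f) U := hf.fderiv_of_isOpen hU (by simp)
  exact ContDiffOn.sum fun i _ => contDiffOn_const.ext_mul (h1.clm_apply contDiffOn_const)

/-- Smooth almost Hermitian structures on an open set of a vector space. -/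
structure IsLocalHermitian (U : Set E) (B : E → E →ₗ[ℝ] E →ₗ[ℝ] ℝ) (I : E → E →ₗ[ℝ] E) :
    Prop where
  isOpen : IsOpen U
  pair : ∀ y ∈ U, IsHermitianPair (B y) (I y)
  smooth_metric : ∀ v w, ContDiffOn ℝ ∞ (fun y => B y v w) U
  smooth_structure : ∀ v, ContDiffOn ℝ ∞ (fun y => I y v) U

theorem contDiffOn_proj10 {I : E → E →ₗ[ℝ] E} (hI : ∀ v, ContDiffOn ℝ ∞ (fun y => I y v) U)
    (a : CDual E) (v : E) : ContDiffOn ℝ ∞ (fun y => proj10 (I y) a v) U :=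
  contDiffOn_const.smul (contDiffOn_const.sub (contDiffOn_const.smul ((hI v).covector a)))

theorem contDiffOn_proj01 {I : E → E →ₗ[ℝ] E} (hI : ∀ v, ContDiffOn ℝ ∞ (fun y => I y v) U)
    (a : CDual E) (v : E) : ContDiffOn ℝ ∞ (fun y => proj01 (I y) a v) U :=
  contDiffOn_const.smul (contDiffOn_const.add (contDiffOn_const.smul ((hI v).covector a)))

theorem ContDiffOn.holPart {I : E → E →ₗ[ℝ] E} (hI : ∀ v, ContDiffOn ℝ ∞ (fun y => I y v) U)
    (p : ℕ) {f : E → CExt E} (hf : ContDiffOn ℝ ∞ f U) :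
    ContDiffOn ℝ ∞ (fun y => _root_.holPart (I y) p (f y)) U := by
  refine ContDiffOn.ext_family (F := fun y => holPartL (I y) p) (fun ξ => ?_) hf
  show ContDiffOn ℝ ∞ (fun y => _root_.holPart (I y) p ξ) U
  have h10 := fun a => contDiffOn_ι (fun v => contDiffOn_proj10 hI a v)
  have h01 := fun a => contDiffOn_ι (fun v => contDiffOn_proj01 hI a v)
  induction ξ using left_induction generalizing p with
  | scalar r =>
    cases p with
    | zero => simp only [holPart_algebraMap_zero]; exact contDiffOn_const
    | succ p => simp only [holPart_algebraMap_succ]; exact contDiffOn_const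
  | add x y hx hy => simp only [holPart_add]; exact (hx p).add (hy p)
  | ι_mul m x hx =>
    cases p with
    | zero =>
      simp only [holPart_zero_ι_mul]
      exact (h01 m).ext_mul (hx 0)
    | succ p =>
      simp only [holPart_succ_ι_mul]
      exact ((h10 m).ext_mul (hx p)).add ((h01 m).ext_mul (hx (p + 1)))

variable {B : E → E →ₗ[ℝ] E →ₗ[ℝ] ℝ} {I : E → E →ₗ[ℝ] E}

/-- By Cramer's rule the inverse has smooth entries where the determinant does not vanish. -/
theorem contDiffOn_gram_inv (h : IsLocalHermitian U B I) (i j : Fin (finrank ℝ E)) :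
    ContDiffOn ℝ ∞ (fun y => (gram fun v w => B y v w)⁻¹ i j) U := by
  have hdet : ∀ (A : E → Matrix (Fin (finrank ℝ E)) (Fin (finrank ℝ E)) ℝ),
      (∀ i j, ContDiffOn ℝ ∞ (fun y => A y i j) U) → ContDiffOn ℝ ∞ (fun y => (A y).det) U := by
    intro A hA
    simp only [Matrix.det_apply]
    exact ContDiffOn.sum fun σ _ => (contDiffOn_prod fun k _ => hA _ _).const_smul _
  have hg : ∀ i j, ContDiffOn ℝ ∞ (fun y => (gram fun v w => B y v w) i j) U := fun i j =>
    h.smooth_metric _ _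
  have h1 : ∀ y, (gram fun v w => B y v w)⁻¹ i j = ((gram fun v w => B y v w).det)⁻¹ *
      (gram fun v w => B y v w).adjugate i j := fun y => by
    rw [Matrix.inv_def, Matrix.smul_apply, Ring.inverse_eq_inv', smul_eq_mul]
  simp only [h1, Matrix.adjugate_apply]
  refine ContDiffOn.mul ((hdet _ hg).inv fun y hy => (isUnit_det_gram (h.pair y hy)).ne_zero) ?_
  refine hdet _ fun k l => ?_
  simp only [Matrix.updateRow_apply]
  split_ifs
  · exact contDiffOn_const
  · exact hg k l

theorem contDiffOn_dualMetric (h : IsLocalHermitian U B I) {α β : E → CDual E}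
    (hα : ∀ v, ContDiffOn ℝ ∞ (fun y => α y v) U) (hβ : ∀ v, ContDiffOn ℝ ∞ (fun y => β y v) U) :
    ContDiffOn ℝ ∞ (fun y => dualMetric (fun v w => B y v w) (α y) (β y)) U := by
  simp only [dualMetric_apply]
  exact ContDiffOn.sum fun i _ => ContDiffOn.sum fun j _ =>
    (Complex.ofRealCLM.contDiff.comp_contDiffOn (contDiffOn_gram_inv h i j)).mul
      ((hα _).mul (hβ _))

theorem ContDiffOn.ctr (h : IsLocalHermitian U B I) {f g : E → CExt E}
    (hf : ContDiffOn ℝ ∞ f U) (hg : ContDiffOn ℝ ∞ g U) :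
    ContDiffOn ℝ ∞ (fun y => _root_.ctr (fun v w => B y v w) (f y) (g y)) U := by
  have key : ∀ (ξ : CExt E) (g : E → CExt E), ContDiffOn ℝ ∞ g U →
      ContDiffOn ℝ ∞ (fun y => _root_.ctr (fun v w => B y v w) ξ (g y)) U := by
    intro ξ
    induction ξ using left_induction with
    | scalar r => intro g hg; simp only [ctr_algebraMap]; exact contDiffOn_const.ext_smul hg
    | add x y hx hy => intro g hg; simp only [ctr_add]; exact (hx g hg).add (hy g hg)
    | ι_mul m x hx =>
      intro g hg
      simp only [ctr_mul, ctr_ι]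
      exact hx _ (ContDiffOn.intProd
        (fun a => contDiffOn_dualMetric h (fun v => contDiffOn_const) fun v => contDiffOn_const) hg)
  have h1 : ∀ y, _root_.ctr (fun v w => B y v w) (f y) (g y) =
      ∑ S, extCoeff S (f y) • _root_.ctr (fun v w => B y v w) ((coBasis E).ExteriorAlgebra S) (g y) :=
    fun y => by
      conv_lhs => rw [← sum_extCoeff (f y)]
      rw [ctr_sum_smul]
  simp only [h1]
  exact ContDiffOn.sum fun S _ => (hf.ext_linear (extCoeff S)).ext_smul (key _ g hg)

theorem contDiffOn_bilin {B : E → E →ₗ[ℝ] E →ₗ[ℝ] ℝ}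
    (hB : ∀ v w, ContDiffOn ℝ ∞ (fun y => B y v w) U) {f g : E → E} (hf : ContDiffOn ℝ ∞ f U)
    (hg : ContDiffOn ℝ ∞ g U) : ContDiffOn ℝ ∞ (fun y => B y (f y) (g y)) U := by
  have h1 : ∀ y, B y (f y) (g y) = ∑ i, ∑ j, (finBasis ℝ E).coord i (f y) *
      ((finBasis ℝ E).coord j (g y) * B y (finBasis ℝ E i) (finBasis ℝ E j)) := fun y => by
    conv_lhs => rw [← (finBasis ℝ E).sum_repr (f y), ← (finBasis ℝ E).sum_repr (g y)]
    simp only [map_sum, map_smul, LinearMap.sum_apply, LinearMap.smul_apply, smul_eq_mul,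
      Basis.coord_apply, Finset.mul_sum]
    rw [Finset.sum_comm]
    exact Finset.sum_congr rfl fun i _ => Finset.sum_congr rfl fun j _ => by ring
  simp only [h1]
  exact ContDiffOn.sum fun i _ => ContDiffOn.sum fun j _ =>
    (hf.covector _).mul ((hg.covector _).mul (hB _ _))

theorem contDiffOn_twoForm {G : E → E → E → ℝ} (hG : ∀ v w, ContDiffOn ℝ ∞ (fun y => G y v w) U) :
    ContDiffOn ℝ ∞ (fun y => twoForm (G y)) U := by
  unfold twoForm
  exact ContDiffOn.sum fun i _ => ContDiffOn.sum fun j _ => (contDiffOn_const.mul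
    (Complex.ofRealCLM.contDiff.comp_contDiffOn (hG _ _))).ext_smul contDiffOn_const

theorem ContDiffOn.ext_pow {f : E → CExt E} (hf : ContDiffOn ℝ ∞ f U) (n : ℕ) :
    ContDiffOn ℝ ∞ (fun y => f y ^ n) U := by
  induction n with
  | zero => simp only [pow_zero]; exact contDiffOn_const
  | succ n ih => simp only [pow_succ]; exact ih.ext_mul hf

theorem ContDiffOn.hodgeL (h : IsLocalHermitian U B I) {f : E → CExt E}
    (hf : ContDiffOn ℝ ∞ f U) : ContDiffOn ℝ ∞ (fun y => _root_.hodgeL (B y) (I y) (f y)) U := by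
  refine ContDiffOn.ctr h hf ?_
  unfold volForm
  exact contDiffOn_const.ext_smul ((contDiffOn_twoForm fun v w =>
    contDiffOn_bilin h.smooth_metric (h.smooth_structure v) contDiffOn_const).ext_pow _)

/-! #### Operators on local forms -/

/-- The Dolbeault operator of an almost complex structure on a vector space. -/
def dbarE (I : E → E →ₗ[ℝ] E) (f : E → CExt E) (y : E) : CExt E :=
  ∑ p ∈ Finset.range (finrank ℝ E + 1),
    holPart (I y) p (extDerivE (fun z => holPart (I z) p (f z)) y)

theorem ContDiffOn.dbarE (hU : IsOpen U) (hI : ∀ v, ContDiffOn ℝ ∞ (fun y => I y v) U)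
    {f : E → CExt E} (hf : ContDiffOn ℝ ∞ f U) : ContDiffOn ℝ ∞ (_root_.dbarE I f) U :=
  ContDiffOn.sum fun p _ => (((hf.holPart hI p).extDerivE hU).holPart hI p)

/-- On forms of holomorphic degree `n`, `∂̄` is the part of holomorphic degree `n` of the
exterior derivative. -/
theorem dbarE_eq (hU : IsOpen U) {f : E → CExt E} {n : ℕ} (hn : n ≤ finrank ℝ E)
    (hf : ∀ z ∈ U, holPart (I z) n (f z) = f z)
    (hf' : ∀ z ∈ U, ∀ p, p ≠ n → holPart (I z) p (f z) = 0) {y : E} (hy : y ∈ U) :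
    dbarE I f y = holPart (I y) n (extDerivE f y) := by
  rw [dbarE, Finset.sum_eq_single n]
  · congr 1
    refine extDerivE_congr ?_
    filter_upwards [hU.mem_nhds hy] with z hz using hf z hz
  · intro p _ hp
    have : extDerivE (fun z => holPart (I z) p (f z)) y = 0 := by
      rw [← extDerivE_zero y]
      refine extDerivE_congr ?_
      filter_upwards [hU.mem_nhds hy] with z hz using hf' z hz p hp
    rw [this, holPart_zero]
  · intro h
    exact absurd (Finset.mem_range.2 (by omega)) h

end Families

/-! ### Lie derivatives -/

section Lie

variable {E : Type*} [NormedAddCommGroup E] [NormedSpace ℝ E] [FiniteDimensional ℝ E]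

/-- The Lie derivative of a form along a complex vector field, by Cartan's formula. -/
def lieD (V : E → Module.Dual ℂ (CDual E)) (f : E → CExt E) (y : E) : CExt E :=
  extDerivE (fun z => intProd (V z) (f z)) y + intProd (V y) (extDerivE f y)

/-- The derivative of a complex vector field in direction `v`. -/
def vecDeriv (V : E → Module.Dual ℂ (CDual E)) (y v : E) : Module.Dual ℂ (CDual E) :=
  ∑ j, fderiv ℝ (fun z => V z (coBasis E j)) y v • covEval (finBasis ℝ E j)

theorem differentiableAt_intProd {V : E → Module.Dual ℂ (CDual E)} {f : E → CExt E} {y : E}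
    (hV : ∀ a, DifferentiableAt ℝ (fun z => V z a) y) (hf : DifferentiableAt ℝ f y) :
    DifferentiableAt ℝ (fun z => intProd (V z) (f z)) y := by
  simp only [intProd_eq_sum (V _)]
  exact DifferentiableAt.fun_sum fun i _ => (hV _).smul (hf.extCLM _)

theorem fderiv_intProd {V : E → Module.Dual ℂ (CDual E)} {f : E → CExt E} {y : E}
    (hV : ∀ a, DifferentiableAt ℝ (fun z => V z a) y) (hf : DifferentiableAt ℝ f y) (v : E) :
    fderiv ℝ (fun z => intProd (V z) (f z)) y v =
      intProd (vecDeriv V y v) (f y) + intProd (V y) (fderiv ℝ f y v) := by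
  rw [intProd_eq_sum (V y)]
  simp only [intProd_eq_sum (V _)]
  rw [fderiv_fun_sum fun i _ => (hV _).fun_smul (hf.extCLM (intProd (covEval (finBasis ℝ E i)))),
    sum_apply]
  simp only [fderiv_ext_smul (hV _) (hf.extCLM (intProd (covEval (finBasis ℝ E _)))),
    Finset.sum_add_distrib, fderiv_extCLM _ hf]
  congr 1
  rw [vecDeriv, intProd, map_sum, LinearMap.sum_apply]
  exact Finset.sum_congr rfl fun i _ => (intProd_smul_left _ _ _).symm

/-- In Cartan's formula the terms that contract a derivative of f after multiplication by e^i
cancel. What remains differentiates f only along V and is otherwise algebraic. -/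
theorem lieD_eq {V : E → Module.Dual ℂ (CDual E)} {f : E → CExt E} {y : E}
    (hV : ∀ a, DifferentiableAt ℝ (fun z => V z a) y) (hf : DifferentiableAt ℝ f y) :
    lieD V f y = ∑ i, (ι ℂ (coBasis E i) * intProd (vecDeriv V y (finBasis ℝ E i)) (f y) +
      V y (coBasis E i) • fderiv ℝ f y (finBasis ℝ E i)) := by
  rw [lieD, extDerivE_eq, extDerivE_eq, map_sum, ← Finset.sum_add_distrib]
  refine Finset.sum_congr rfl fun i _ => ?_
  rw [fderiv_intProd hV hf, intProd_ι_mul, mul_add]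
  abel

theorem lieD_smul {V : E → Module.Dual ℂ (CDual E)} {f : E → CExt E} {y : E}
    (hV : ∀ a, DifferentiableAt ℝ (fun z => V z a) y) (hf : DifferentiableAt ℝ f y) {h : E → ℂ}
    (hh : DifferentiableAt ℝ h y) :
    lieD V (fun z => h z • f z) y = h y • lieD V f y + V y (dfun h y) • f y := by
  rw [lieD_eq hV hf, lieD_eq hV (hh.fun_smul hf), ← sum_map_coBasis (V y) (dfun h y),
    Finset.smul_sum, Finset.sum_smul, ← Finset.sum_add_distrib]
  refine Finset.sum_congr rfl fun i _ => ?_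
  rw [fderiv_ext_smul hh hf, map_smul, mul_smul_comm, smul_add, smul_add, add_assoc,
    add_comm (_ • _ • fderiv ℝ f y _), smul_smul, smul_smul, smul_smul, mul_comm (h y) (V y _),
    smul_eq_mul, mul_comm (V y _) (fderiv ℝ h y _)]
  rfl

/-- The commutator of a Lie derivative and a contraction is a contraction. -/
theorem lieD_intProd {V W : E → Module.Dual ℂ (CDual E)} {y : E}
    (hV : ∀ a, DifferentiableAt ℝ (fun z => V z a) y)
    (hW : ∀ a, DifferentiableAt ℝ (fun z => W z a) y) :
    ∃ Z : Module.Dual ℂ (CDual E), ∀ f : E → CExt E, DifferentiableAt ℝ f y →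
      lieD V (fun z => intProd (W z) (f z)) y =
        intProd (W y) (lieD V f y) + intProd Z (f y) := by
  -- The witness is the Lie bracket [V, W] in coordinates.
  refine ⟨∑ i, (V y (coBasis E i) • vecDeriv W y (finBasis ℝ E i) -
    W y (coBasis E i) • vecDeriv V y (finBasis ℝ E i)), fun f hf => ?_⟩
  have hsum : ∀ d : Fin (finrank ℝ E) → Module.Dual ℂ (CDual E),
      intProd (∑ i, d i) (f y) = ∑ i, intProd (d i) (f y) := fun d => by
    rw [intProd, map_sum, LinearMap.sum_apply]
  have hsub : ∀ d d' : Module.Dual ℂ (CDual E),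
      intProd (d - d') (f y) = intProd d (f y) - intProd d' (f y) := fun d d' => by
    rw [intProd, map_sub, LinearMap.sub_apply]
  rw [lieD_eq hV hf, lieD_eq hV (differentiableAt_intProd hW hf), map_sum, hsum,
    ← Finset.sum_add_distrib]
  refine Finset.sum_congr rfl fun i _ => ?_
  rw [fderiv_intProd hW hf, map_add, intProd_ι_mul, map_smul, hsub, intProd_smul_left,
    intProd_smul_left, intProd_comm (vecDeriv V y _) (W y), mul_neg, smul_add]
  abel

end Lie

/-! ### Local forms of type `(*,0)` -/

section LocalForms

variable {E : Type*} [NormedAddCommGroup E] [NormedSpace ℝ E] [FiniteDimensional ℝ E]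
variable {U : Set E} {B : E → E →ₗ[ℝ] E →ₗ[ℝ] ℝ} {I : E → E →ₗ[ℝ] E}

/-- Smooth forms of type `(*,0)` on an open set of a vector space. -/
def IsHolForm (U : Set E) (I : E → E →ₗ[ℝ] E) (f : E → CExt E) : Prop :=
  ContDiffOn ℝ ∞ f U ∧ ∀ y ∈ U, f y ∈ extStar0 (I y)

/-- Smooth covector fields of type `(1,0)` on an open set of a vector space. -/
def IsHolCov (U : Set E) (I : E → E →ₗ[ℝ] E) (θ : E → CDual E) : Prop :=
  (∀ v, ContDiffOn ℝ ∞ (fun y => θ y v) U) ∧ ∀ y ∈ U, θ y ∈ type10 (I y)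

theorem IsHolForm.add {f g : E → CExt E} (hf : IsHolForm U I f) (hg : IsHolForm U I g) :
    IsHolForm U I (fun y => f y + g y) :=
  ⟨hf.1.add hg.1, fun y hy => add_mem (hf.2 y hy) (hg.2 y hy)⟩

theorem IsHolForm.mul {f g : E → CExt E} (hf : IsHolForm U I f) (hg : IsHolForm U I g) :
    IsHolForm U I (fun y => f y * g y) :=
  ⟨hf.1.ext_mul hg.1, fun y hy => mul_mem (hf.2 y hy) (hg.2 y hy)⟩

theorem IsHolForm.smul {c : E → ℂ} {g : E → CExt E} (hc : ContDiffOn ℝ ∞ c U)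
    (hg : IsHolForm U I g) : IsHolForm U I (fun y => c y • g y) :=
  ⟨hc.ext_smul hg.1, fun y hy => Subalgebra.smul_mem _ (hg.2 y hy) _⟩

theorem isHolForm_one : IsHolForm U I (fun _ => 1) :=
  ⟨contDiffOn_const, fun _ _ => one_mem _⟩

theorem isHolForm_algebraMap {c : E → ℂ} (hc : ContDiffOn ℝ ∞ c U) :
    IsHolForm U I (fun y => algebraMap ℂ _ (c y)) := by
  simp only [Algebra.algebraMap_eq_smul_one]
  exact isHolForm_one.smul hc

theorem IsHolCov.isHolForm {θ : E → CDual E} (hθ : IsHolCov U I θ) :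
    IsHolForm U I (fun y => ι ℂ (θ y)) :=
  ⟨contDiffOn_ι hθ.1, fun y hy => Algebra.subset_adjoin ⟨_, hθ.2 y hy, rfl⟩⟩

theorem IsLocalHermitian.isHolCov_proj10 (h : IsLocalHermitian U B I) (a : CDual E) :
    IsHolCov U I (fun y => proj10 (I y) a) :=
  ⟨fun v => contDiffOn_proj10 h.smooth_structure a v, fun y hy => proj10_mem (h.pair y hy).sq a⟩

/-- Near a point, forms of type `(*,0)` are generated by functions and covector fields. -/
theorem IsLocalHermitian.holForm_induction (h : IsLocalHermitian U B I) {y : E} (hy : y ∈ U)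
    {P : (E → CExt E) → Prop}
    (congr : ∀ b b', b =ᶠ[nhds y] b' → P b → P b')
    (add : ∀ b b', IsHolForm U I b → IsHolForm U I b' → P b → P b' → P (fun z => b z + b' z))
    (mul : ∀ b b', IsHolForm U I b → IsHolForm U I b' → P b → P b' → P (fun z => b z * b' z))
    (scalar : ∀ c : E → ℂ, ContDiffOn ℝ ∞ c U → P (fun z => algebraMap ℂ _ (c z)))
    (cov : ∀ θ, IsHolCov U I θ → P (fun z => ι ℂ (θ z)))
    {b : E → CExt E} (hb : IsHolForm U I b) : P b := by
  -- The (1,0)-projections of constant forms are products of projected constant covectors, and they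
  -- supply global generators on U.
  have h1 : ∀ ξ : CExt E, IsHolForm U I (fun z => map (proj10 (I z)) ξ) ∧
      P (fun z => map (proj10 (I z)) ξ) := by
    intro ξ
    induction ξ using left_induction with
    | scalar r =>
      simp only [AlgHom.commutes]
      exact ⟨isHolForm_algebraMap contDiffOn_const, scalar _ contDiffOn_const⟩
    | add x x' hx hx' =>
      simp only [map_add]
      exact ⟨hx.1.add hx'.1, add _ _ hx.1 hx'.1 hx.2 hx'.2⟩
    | ι_mul m x hx =>
      simp only [map_mul, map_apply_ι]
      have hm := h.isHolCov_proj10 m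
      exact ⟨hm.isHolForm.mul hx.1, mul _ _ hm.isHolForm hx.1 (cov _ hm) hx.2⟩
  have h2 : ∀ S : Finset (Finset (Fin (finrank ℝ E))),
      IsHolForm U I (fun z => ∑ s ∈ S, algebraMap ℂ (CExt E) (extCoeff s (b z)) *
        map (proj10 (I z)) ((coBasis E).ExteriorAlgebra s)) ∧
      P (fun z => ∑ s ∈ S, algebraMap ℂ (CExt E) (extCoeff s (b z)) *
        map (proj10 (I z)) ((coBasis E).ExteriorAlgebra s)) := by
    intro S
    classical
    induction S using Finset.induction_on with
    | empty =>
      simp only [Finset.sum_empty]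
      have h0 := scalar (fun _ => 0) contDiffOn_const
      simp only [map_zero] at h0
      exact ⟨⟨contDiffOn_const, fun _ _ => zero_mem _⟩, h0⟩
    | insert s S hs ih =>
      simp only [Finset.sum_insert hs]
      have hc : ContDiffOn ℝ ∞ (fun z => extCoeff s (b z)) U := hb.1.ext_linear _
      have hs1 := isHolForm_algebraMap (I := I) hc
      have hs2 := h1 ((coBasis E).ExteriorAlgebra s)
      have hs3 := mul _ _ hs1 hs2.1 (scalar _ hc) hs2.2
      exact ⟨(hs1.mul hs2.1).add ih.1, add _ _ (hs1.mul hs2.1) ih.1 hs3 ih.2⟩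
  -- On U the projection fixes b, so expanding b in constant monomials and projecting recovers b.
  -- Outside U the two sides may differ, hence the passage to germs.
  refine congr _ _ ?_ (h2 Finset.univ).2
  filter_upwards [h.isOpen.mem_nhds hy] with z hz
  conv_rhs => rw [← map_proj10_of_mem (hb.2 z hz), ← sum_extCoeff (b z), map_sum]
  refine Finset.sum_congr rfl fun s _ => ?_
  rw [map_smul, Algebra.smul_def]

/-! #### The star operator and the adjoint of `∂` -/

/-- The star operator on local forms. -/
def starE (B : E → E →ₗ[ℝ] E →ₗ[ℝ] ℝ) (I : E → E →ₗ[ℝ] E) (f : E → CExt E) (y : E) : CExt E :=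
  hodgeL (B y) (I y) (f y)

/-- The operator `∂* = - * ∂̄ *` on local forms. -/
def delStarE (B : E → E →ₗ[ℝ] E →ₗ[ℝ] ℝ) (I : E → E →ₗ[ℝ] E) (f : E → CExt E) (y : E) : CExt E :=
  -hodgeL (B y) (I y) (dbarE I (starE B I f) y)

theorem ContDiffOn.starE (h : IsLocalHermitian U B I) {f : E → CExt E}
    (hf : ContDiffOn ℝ ∞ f U) : ContDiffOn ℝ ∞ (_root_.starE B I f) U := hf.hodgeL h

omit [FiniteDimensional ℝ E] in
theorem IsLocalHermitian.differentiableAt (h : IsLocalHermitian U B I) {X : Type*}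
    [NormedAddCommGroup X] [NormedSpace ℝ X] {f : E → X} (hf : ContDiffOn ℝ ∞ f U) {y : E}
    (hy : y ∈ U) : DifferentiableAt ℝ f y :=
  (hf.differentiableOn (by simp)).differentiableAt (h.isOpen.mem_nhds hy)

/-- Since *f has pure holomorphic degree m, a single summand of ∂̄ survives; d itself is then
available for Cartan's formula. -/
theorem delStarE_eq (h : IsLocalHermitian U B I) {f : E → CExt E} (hf : IsHolForm U I f)
    {y : E} (hy : y ∈ U) : delStarE B I f y =
      -hodgeL (B y) (I y) (holPart (I y) (finrank ℝ E / 2) (extDerivE (starE B I f) y)) := by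
  rw [delStarE, dbarE_eq (f := starE B I f) h.isOpen (Nat.div_le_self _ 2)
    (fun z hz => holPart_hodgeL (h.pair z hz) (hf.2 z hz))
    (fun z hz p hp => holPart_hodgeL_of_ne (h.pair z hz) (hf.2 z hz) hp) hy]

theorem IsHolForm.delStarE (h : IsLocalHermitian U B I) {f : E → CExt E} (hf : IsHolForm U I f) :
    IsHolForm U I (_root_.delStarE B I f) := by
  refine ⟨(((hf.1.starE h).dbarE h.isOpen h.smooth_structure).hodgeL h).neg, fun y hy => ?_⟩
  rw [delStarE_eq h hf hy]
  exact neg_mem (hodgeL_mem_extStar0 (h.pair y hy) _)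

theorem dbarE_congr {I : E → E →ₗ[ℝ] E} {f g : E → CExt E} {y : E} (hfg : f =ᶠ[nhds y] g) :
    dbarE I f y = dbarE I g y := by
  rw [dbarE, dbarE]
  refine Finset.sum_congr rfl fun p _ => ?_
  congr 1
  refine extDerivE_congr ?_
  filter_upwards [hfg] with z hz
  rw [hz]

theorem delStarE_congr {f g : E → CExt E} {y : E} (hfg : f =ᶠ[nhds y] g) :
    delStarE B I f y = delStarE B I g y := by
  have h1 : starE B I f =ᶠ[nhds y] starE B I g := by
    filter_upwards [hfg] with z hz
    rw [starE, starE, hz]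
  rw [delStarE, delStarE, dbarE_congr h1]

theorem delStarE_add (h : IsLocalHermitian U B I) {f g : E → CExt E} (hf : IsHolForm U I f)
    (hg : IsHolForm U I g) {y : E} (hy : y ∈ U) :
    delStarE B I (fun z => f z + g z) y = delStarE B I f y + delStarE B I g y := by
  have h1 : starE B I (fun z => f z + g z) = fun z => starE B I f z + starE B I g z :=
    funext fun z => map_add _ _ _
  rw [delStarE_eq h (hf.add hg) hy, h1, extDerivE_add (h.differentiableAt (hf.1.starE h) hy)
    (h.differentiableAt (hg.1.starE h) hy), holPart_add, map_add, neg_add,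
    delStarE_eq h hf hy, delStarE_eq h hg hy]

theorem holPart_ι_mul_of_pure {T : Type*} [AddCommGroup T] [Module ℝ T] {I : T →ₗ[ℝ] T} {n : ℕ}
    {ξ : CExt T} (h1 : holPart I n ξ = ξ)
    (h2 : ∀ p, p ≠ n → holPart I p ξ = 0) (a : CDual T) :
    holPart I n (ι ℂ a * ξ) = ι ℂ (proj01 I a) * ξ := by
  cases n with
  | zero => rw [holPart_zero_ι_mul, h1]
  | succ n => rw [holPart_succ_ι_mul, h1, h2 n (by omega), mul_zero, zero_add]

/-- The extra term of d(c *f) is dc ∧ *f, whose part of holomorphic degree m is ∂̄c ∧ *f;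
conjugation by * turns the multiplication into contraction with (∂̄c)♯. -/
theorem delStarE_smul (h : IsLocalHermitian U B I) {f : E → CExt E} (hf : IsHolForm U I f)
    {c : E → ℂ} (hc : ContDiffOn ℝ ∞ c U) {y : E} (hy : y ∈ U) :
    delStarE B I (fun z => c z • f z) y = c y • delStarE B I f y -
      intProd (dualMetric (fun v w => B y v w) (proj01 (I y) (dfun c y))) (f y) := by
  have h1 : starE B I (fun z => c z • f z) = fun z => c z • starE B I f z :=
    funext fun z => map_smul _ _ _
  have hp := h.pair y hy
  have h3 : starE B I f y = hodgeL (B y) (I y) (f y) := rfl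
  rw [delStarE_eq h (hf.smul hc) hy, h1, extDerivE_smul (h.differentiableAt hc hy)
    (h.differentiableAt (hf.1.starE h) hy), holPart_add, holPart_smul, map_add, map_smul, h3,
    holPart_ι_mul_of_pure (holPart_hodgeL hp (hf.2 y hy))
      (fun p hne => holPart_hodgeL_of_ne hp (hf.2 y hy) hne), delStarE_eq h hf hy]
  rw [ι_mul_hodgeL hp, smul_neg]
  abel

/-- The vector field dual to a covector field. -/
def sharp (B : E → E →ₗ[ℝ] E →ₗ[ℝ] ℝ) (θ : E → CDual E) (y : E) : Module.Dual ℂ (CDual E) :=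
  dualMetric (fun v w => B y v w) (θ y)

/-- The Lie derivative along a complex vector field, conjugated by the star operator. -/
def lieStar (B : E → E →ₗ[ℝ] E →ₗ[ℝ] ℝ) (I : E → E →ₗ[ℝ] E) (V : E → Module.Dual ℂ (CDual E))
    (f : E → CExt E) (y : E) : CExt E :=
  hodgeL (B y) (I y) (holPart (I y) (finrank ℝ E / 2) (lieD V (starE B I f) y))

theorem IsLocalHermitian.differentiableAt_sharp (h : IsLocalHermitian U B I) {θ : E → CDual E}
    (hθ : IsHolCov U I θ) {y : E} (hy : y ∈ U) (a : CDual E) :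
    DifferentiableAt ℝ (fun z => sharp B θ z a) y :=
  h.differentiableAt (contDiffOn_dualMetric h hθ.1 fun _ => contDiffOn_const) hy

/-- The supercommutator of `∂*` with a covector field of type `(1,0)`. -/
theorem delStarE_mul_ι (h : IsLocalHermitian U B I) {f : E → CExt E} (hf : IsHolForm U I f)
    {θ : E → CDual E} (hθ : IsHolCov U I θ) {y : E} (hy : y ∈ U) :
    delStarE B I (fun z => f z * ι ℂ (θ z)) y =
      delStarE B I f y * ι ℂ (θ y) - lieStar B I (sharp B θ) f y := by
  have hp := h.pair y hy
  have h1 : starE B I (fun z => f z * ι ℂ (θ z)) =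
      fun z => intProd (sharp B θ z) (starE B I f z) := funext fun z => hodgeL_mul_ι _ _
  have h2 : sharp B θ y = dualMetric (fun v w => B y v w) (θ y) := rfl
  -- Under *, multiplication by θ is contraction with V = θ♯. Cartan's formula rewrites d i_V as L_V
  -- - i_V d, and i_V commutes with the projection to holomorphic degree m.
  rw [delStarE_eq h (hf.mul hθ.isHolForm) hy, h1, delStarE_eq h hf hy, lieStar, lieD,
    holPart_add, map_add, h2, holPart_intProd_of_proj10 _ (dualMetric_of_mem hp (hθ.2 y hy)),
    hodgeL_intProd hp, neg_mul]
  abel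

/-- A graded commutator of `∂*` with two covector fields is a multiplication. -/
theorem lieStar_mul_ι (h : IsLocalHermitian U B I) {θ φ : E → CDual E}
    (hθ : IsHolCov U I θ) (hφ : IsHolCov U I φ) {y : E} (hy : y ∈ U) :
    ∃ κ, ∀ f, IsHolForm U I f → lieStar B I (sharp B θ) (fun z => f z * ι ℂ (φ z)) y =
      -(lieStar B I (sharp B θ) f y * ι ℂ (φ y)) + invol (f y) * κ := by
  have hp := h.pair y hy
  obtain ⟨Z, hZ⟩ := lieD_intProd (h.differentiableAt_sharp hθ hy) (h.differentiableAt_sharp hφ hy)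
  -- Only the part of the bracket that preserves the holomorphic degree contributes: the other part
  -- would lower degree m + 1, where *f has no component. Representing that part by a covector turns
  -- the contraction into a multiplication.
  obtain ⟨a, ha⟩ := exists_dualMetric hp (Z ∘ₗ proj01 (I y))
  refine ⟨-ι ℂ a, fun f hf => ?_⟩
  have h1 : starE B I (fun z => f z * ι ℂ (φ z)) =
      fun z => intProd (sharp B φ z) (starE B I f z) := funext fun z => hodgeL_mul_ι _ _
  have h2 : sharp B φ y = dualMetric (fun v w => B y v w) (φ y) := rfl
  have h3 : starE B I f y = hodgeL (B y) (I y) (f y) := rfl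
  rw [lieStar, h1, hZ _ (h.differentiableAt (hf.1.starE h) hy), holPart_add, map_add, h2,
    holPart_intProd_of_proj10 _ (dualMetric_of_mem hp (hφ.2 y hy)), hodgeL_intProd hp,
    holPart_intProd_split Z hp.sq, h3, holPart_hodgeL hp (hf.2 y hy),
    holPart_hodgeL_of_ne hp (hf.2 y hy) (Nat.succ_ne_self _), map_zero, add_zero, ha,
    hodgeL_intProd hp, hodgeL_hodgeL hp, mul_neg]
  rfl

/-- The Lie derivative has scalar symbol; the grade involution comes from ** = (-1)^k. -/
theorem lieStar_smul (h : IsLocalHermitian U B I) {θ : E → CDual E}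
    (hθ : IsHolCov U I θ) {f : E → CExt E} (hf : IsHolForm U I f)
    {c : E → ℂ} (hc : ContDiffOn ℝ ∞ c U) {y : E} (hy : y ∈ U) :
    lieStar B I (sharp B θ) (fun z => c z • f z) y =
      c y • lieStar B I (sharp B θ) f y + sharp B θ y (dfun c y) • invol (f y) := by
  have hp := h.pair y hy
  have h1 : starE B I (fun z => c z • f z) = fun z => c z • starE B I f z :=
    funext fun z => map_smul _ _ _
  have h3 : starE B I f y = hodgeL (B y) (I y) (f y) := rfl
  rw [lieStar, h1, lieD_smul (h.differentiableAt_sharp hθ hy)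
    (h.differentiableAt (hf.1.starE h) hy) (h.differentiableAt hc hy), holPart_add, holPart_smul,
    holPart_smul, map_add, map_smul, map_smul, h3, holPart_hodgeL hp (hf.2 y hy),
    hodgeL_hodgeL hp]
  rfl

theorem lieStar_add (h : IsLocalHermitian U B I) {θ : E → CDual E}
    (hθ : IsHolCov U I θ) {f g : E → CExt E} (hf : IsHolForm U I f) (hg : IsHolForm U I g)
    {y : E} (hy : y ∈ U) :
    lieStar B I (sharp B θ) (fun z => f z + g z) y =
      lieStar B I (sharp B θ) f y + lieStar B I (sharp B θ) g y := by
  have h1 : starE B I (fun z => f z + g z) = fun z => starE B I f z + starE B I g z :=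
    funext fun z => map_add _ _ _
  have hV := h.differentiableAt_sharp hθ hy
  have hf' := h.differentiableAt (hf.1.starE h) hy
  have hg' := h.differentiableAt (hg.1.starE h) hy
  have h2 : lieD (sharp B θ) (fun z => starE B I f z + starE B I g z) y =
      lieD (sharp B θ) (starE B I f) y + lieD (sharp B θ) (starE B I g) y := by
    rw [lieD, lieD, lieD, extDerivE_add hf' hg', map_add]
    simp only [map_add]
    rw [extDerivE_add (differentiableAt_intProd hV hf') (differentiableAt_intProd hV hg')]
    abel
  rw [lieStar, h1, h2, holPart_add, map_add]
  rfl

theorem lieStar_congr {V : E → Module.Dual ℂ (CDual E)} {f g : E → CExt E} {y : E}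
    (hfg : f =ᶠ[nhds y] g) : lieStar B I V f y = lieStar B I V g y := by
  have h1 : starE B I f =ᶠ[nhds y] starE B I g := by
    filter_upwards [hfg] with z hz
    rw [starE, starE, hz]
  have h2 : (fun z => intProd (V z) (starE B I f z)) =ᶠ[nhds y]
      fun z => intProd (V z) (starE B I g z) := by
    filter_upwards [h1] with z hz
    rw [hz]
  rw [lieStar, lieStar, lieD, lieD, extDerivE_congr h1, extDerivE_congr h2]

/-- The commutator of `∂*` with a covector field is an operator of first order. -/
theorem lieStar_mul (h : IsLocalHermitian U B I) {θ : E → CDual E}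
    (hθ : IsHolCov U I θ) {b : E → CExt E} (hb : IsHolForm U I b) {y : E} (hy : y ∈ U) :
    ∃ κ, ∀ f, IsHolForm U I f → lieStar B I (sharp B θ) (fun z => f z * b z) y =
      lieStar B I (sharp B θ) f y * invol (b y) + invol (f y) * κ := by
  refine h.holForm_induction hy (P := fun b => ∃ κ, ∀ f, IsHolForm U I f →
    lieStar B I (sharp B θ) (fun z => f z * b z) y =
      lieStar B I (sharp B θ) f y * invol (b y) + invol (f y) * κ) ?_ ?_ ?_ ?_ ?_ hb
  · rintro b b' hbb ⟨κ, hκ⟩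
    refine ⟨κ, fun f hf => ?_⟩
    rw [← hbb.self_of_nhds, ← hκ f hf]
    refine lieStar_congr ?_
    filter_upwards [hbb] with z hz
    rw [hz]
  · rintro b b' hb hb' ⟨κ, hκ⟩ ⟨κ', hκ'⟩
    refine ⟨κ + κ', fun f hf => ?_⟩
    simp only [mul_add]
    rw [lieStar_add h hθ (hf.mul hb) (hf.mul hb') hy, hκ f hf, hκ' f hf, map_add, mul_add]
    abel
  · rintro b b' hb hb' ⟨κ, hκ⟩ ⟨κ', hκ'⟩
    -- The constants compose by applying the rule for b' to the form f b and then the rule for b to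
    -- f.
    refine ⟨κ * invol (b' y) + invol (b y) * κ', fun f hf => ?_⟩
    simp only [← mul_assoc]
    rw [hκ' _ (hf.mul hb), hκ f hf, map_mul, map_mul, add_mul, mul_add, mul_assoc, mul_assoc,
      mul_assoc, add_assoc]
  · intro c hc
    refine ⟨algebraMap ℂ _ (sharp B θ y (dfun c y)), fun f hf => ?_⟩
    simp only [← Algebra.commutes, ← Algebra.smul_def]
    rw [lieStar_smul h hθ hf hc hy, AlgHom.commutes, ← Algebra.commutes, ← Algebra.smul_def]
  · intro φ hφ
    obtain ⟨κ, hκ⟩ := lieStar_mul_ι h hθ hφ hy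
    refine ⟨κ, fun f hf => ?_⟩
    rw [hκ f hf, invol_ι, mul_neg]

/-! #### The commutator of `∂*` with an even form -/

/-- The operator `-[L_Ω, ∂*]`. -/
def deltaE (B : E → E →ₗ[ℝ] E →ₗ[ℝ] ℝ) (I : E → E →ₗ[ℝ] E) (Ω : E → CExt E) (f : E → CExt E)
    (y : E) : CExt E :=
  -(Ω y * delStarE B I f y - delStarE B I (fun z => Ω z * f z) y)

variable {Ω : E → CExt E}

theorem IsHolForm.deltaE (h : IsLocalHermitian U B I) (hΩ : IsHolForm U I Ω) {f : E → CExt E}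
    (hf : IsHolForm U I f) : IsHolForm U I (_root_.deltaE B I Ω f) := by
  have h1 := hΩ.mul (hf.delStarE h)
  have h2 := (hΩ.mul hf).delStarE h
  exact ⟨(h1.1.sub h2.1).neg, fun y hy => neg_mem (sub_mem (h1.2 y hy) (h2.2 y hy))⟩

theorem deltaE_congr {f g : E → CExt E} {y : E} (hfg : f =ᶠ[nhds y] g) :
    deltaE B I Ω f y = deltaE B I Ω g y := by
  have h1 : (fun z => Ω z * f z) =ᶠ[nhds y] fun z => Ω z * g z := by
    filter_upwards [hfg] with z hz
    rw [hz]
  rw [deltaE, deltaE, delStarE_congr hfg, delStarE_congr h1]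

theorem deltaE_add (h : IsLocalHermitian U B I) (hΩ : IsHolForm U I Ω) {f g : E → CExt E}
    (hf : IsHolForm U I f) (hg : IsHolForm U I g) {y : E} (hy : y ∈ U) :
    deltaE B I Ω (fun z => f z + g z) y = deltaE B I Ω f y + deltaE B I Ω g y := by
  rw [deltaE, delStarE_add h hf hg hy]
  simp only [mul_add]
  rw [delStarE_add h (hΩ.mul hf) (hΩ.mul hg) hy, deltaE, deltaE]
  abel

/-- The symbol of `-[L_Ω, ∂*]`. -/
theorem deltaE_smul (h : IsLocalHermitian U B I) (hΩ : IsHolForm U I Ω)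
    {y : E} (hy : y ∈ U) (hΩ' : invol (Ω y) = Ω y) {f : E → CExt E} (hf : IsHolForm U I f)
    {c : E → ℂ} (hc : ContDiffOn ℝ ∞ c U) :
    deltaE B I Ω (fun z => c z • f z) y = c y • deltaE B I Ω f y -
      intProd (dualMetric (fun v w => B y v w) (proj01 (I y) (dfun c y))) (Ω y) * f y := by
  rw [deltaE, delStarE_smul h hf hc hy]
  simp only [mul_smul_comm]
  -- Contraction is an antiderivation and Ω is even, so the contractions of f cancel and only the
  -- contraction of Ω is left.
  rw [delStarE_smul h (hΩ.mul hf) hc hy, intProd_mul, hΩ', deltaE, mul_sub, mul_smul_comm,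
    smul_neg, smul_sub]
  abel

/-- A form of type `(2,0)` that is suitable for the commutator with `∂*`. -/
structure IsHolTwoForm (U : Set E) (B : E → E →ₗ[ℝ] E →ₗ[ℝ] ℝ) (I : E → E →ₗ[ℝ] E)
    (Ω : E → CExt E) : Prop where
  isHolForm : IsHolForm U I Ω
  scale_eq : ∀ y ∈ U, ∀ t, scale t (Ω y) = t ^ 2 • Ω y
  contraction : ∀ y ∈ U, ∀ a, ∃ b,
    intProd (dualMetric (fun v w => B y v w) (proj01 (I y) a)) (Ω y) = ι ℂ b

theorem IsHolTwoForm.invol_eq (hΩ : IsHolTwoForm U B I Ω) {y : E} (hy : y ∈ U) :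
    invol (Ω y) = Ω y := by
  rw [invol, hΩ.scale_eq y hy]
  norm_num

/-- The Jacobi identity: Ω is central, so the commutator of [Ω, ∂*] with θ is that of Ω with [∂*,
θ]. The latter is of first order by `lieStar_mul`, so commuting it with Ω leaves a multiplication.
-/
theorem deltaE_mul_ι (h : IsLocalHermitian U B I) (hΩ : IsHolTwoForm U B I Ω)
    {y : E} (hy : y ∈ U) {θ : E → CDual E} (hθ : IsHolCov U I θ) :
    ∃ κ, ∀ f, IsHolForm U I f → deltaE B I Ω (fun z => f z * ι ℂ (θ z)) y =
      deltaE B I Ω f y * ι ℂ (θ y) + invol (f y) * κ := by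
  obtain ⟨κ, hκ⟩ := lieStar_mul h hθ hΩ.isHolForm hy
  refine ⟨-κ, fun f hf => ?_⟩
  have hcomm : (fun z => Ω z * f z) =ᶠ[nhds y] (fun z => f z * Ω z) := by
    filter_upwards [h.isOpen.mem_nhds hy] with z hz
    have := mul_comm_of_invol (hΩ.invol_eq hz) (f z)
    simp only [this]
  have h1 : (fun z => Ω z * (f z * ι ℂ (θ z))) = fun z => (Ω z * f z) * ι ℂ (θ z) :=
    funext fun z => (mul_assoc _ _ _).symm
  rw [deltaE, h1, delStarE_mul_ι h hf hθ hy, delStarE_mul_ι h (hΩ.isHolForm.mul hf) hθ hy,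
    lieStar_congr hcomm, hκ f hf, deltaE, hΩ.invol_eq hy,
    ← mul_comm_of_invol (hΩ.invol_eq hy) (lieStar B I (sharp B θ) f y)]
  noncomm_ring

/-- The operator `-[L_Ω, ∂*]` is of first order. -/
theorem deltaE_mul (h : IsLocalHermitian U B I) (hΩ : IsHolTwoForm U B I Ω)
    {y : E} (hy : y ∈ U) {b : E → CExt E} (hb : IsHolForm U I b) :
    ∃ κ, ∀ f, IsHolForm U I f → deltaE B I Ω (fun z => f z * b z) y =
      deltaE B I Ω f y * b y + invol (f y) * κ := by
  refine h.holForm_induction hy (P := fun b => ∃ κ, ∀ f, IsHolForm U I f →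
    deltaE B I Ω (fun z => f z * b z) y =
      deltaE B I Ω f y * b y + invol (f y) * κ) ?_ ?_ ?_ ?_ ?_ hb
  · rintro b b' hbb ⟨κ, hκ⟩
    refine ⟨κ, fun f hf => ?_⟩
    have h1 : (fun z => f z * b z) =ᶠ[nhds y] fun z => f z * b' z := by
      filter_upwards [hbb] with z hz
      rw [hz]
    rw [← deltaE_congr h1, hκ f hf, hbb.eq_of_nhds]
  · rintro b b' hb hb' ⟨κ, hκ⟩ ⟨κ', hκ'⟩
    refine ⟨κ + κ', fun f hf => ?_⟩
    simp only [mul_add]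
    rw [deltaE_add h hΩ.isHolForm (hf.mul hb) (hf.mul hb') hy, hκ f hf, hκ' f hf]
    abel
  · rintro b b' hb hb' ⟨κ, hκ⟩ ⟨κ', hκ'⟩
    refine ⟨κ * b' y + invol (b y) * κ', fun f hf => ?_⟩
    simp only [← mul_assoc]
    rw [hκ' _ (hf.mul hb), hκ f hf, map_mul, add_mul, mul_add, mul_assoc, mul_assoc,
      mul_assoc, add_assoc]
  · intro c hc
    obtain ⟨b, hb⟩ := hΩ.contraction y hy (dfun c y)
    -- The symbol multiplies from the left by the covector b; moving it to the right of f produces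
    -- the grade involution.
    refine ⟨-ι ℂ b, fun f hf => ?_⟩
    simp only [← Algebra.commutes, ← Algebra.smul_def]
    rw [deltaE_smul h hΩ.isHolForm hy (hΩ.invol_eq hy) hf hc, hb, ι_mul_eq, mul_neg,
      sub_eq_add_neg]
  · intro φ hφ
    exact deltaE_mul_ι h hΩ hy hφ

/-- The unknown multiplier depends only on b, so it can be read off by putting a = 1. -/
theorem deltaE_mul_eq (h : IsLocalHermitian U B I) (hΩ : IsHolTwoForm U B I Ω)
    {y : E} (hy : y ∈ U) {a b : E → CExt E} (ha : IsHolForm U I a) (hb : IsHolForm U I b) :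
    deltaE B I Ω (fun z => a z * b z) y = deltaE B I Ω a y * b y +
      invol (a y) * (deltaE B I Ω b y - deltaE B I Ω (fun _ => 1) y * b y) := by
  obtain ⟨κ, hκ⟩ := deltaE_mul h hΩ hy hb
  have h1 := hκ _ isHolForm_one
  simp only [one_mul, map_one] at h1
  rw [hκ a ha, h1, add_sub_cancel_left]

/-- A form of the statement that ∂* lowers the degree by one: for c = t^k the factor t on the left
avoids the exponent k - 1. A general c lets the same statement serve f and Ω f. -/
theorem scale_delStarE (h : IsLocalHermitian U B I) {f : E → CExt E} (hf : IsHolForm U I f)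
    {t c : ℂ} (ht : t ≠ 0) (hs : ∀ z ∈ U, scale t (f z) = c • f z) {y : E} (hy : y ∈ U) :
    t • scale t (delStarE B I f y) = c • delStarE B I f y := by
  have hp := h.pair y hy
  have h1 : ∀ z ∈ U, c • scale t (starE B I f z) = t ^ finrank ℝ E • starE B I f z := fun z hz => by
    have := hodgeL_scale (h.pair z hz) t (f z)
    rwa [hs z hz, map_smul, map_smul] at this
  have hd := h.differentiableAt (hf.1.starE h) hy
  have hd' : DifferentiableAt ℝ (fun z => scale t (starE B I f z)) y :=
    hd.extCLM (scale t : CExt E →ₐ[ℂ] CExt E).toLinearMap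
  have h2 : c • scale t (extDerivE (starE B I f) y) =
      t ^ (finrank ℝ E + 1) • extDerivE (starE B I f) y := by
    rw [extDerivE_scale t hd, smul_comm, ← extDerivE_const_smul c hd', pow_succ', mul_smul,
      ← extDerivE_const_smul _ hd]
    congr 1
    refine extDerivE_congr ?_
    filter_upwards [h.isOpen.mem_nhds hy] with z hz using h1 z hz
  rw [delStarE_eq h hf hy]
  set X := holPart (I y) (finrank ℝ E / 2) (extDerivE (starE B I f) y) with hX
  have h3 : c • scale t X = t ^ (finrank ℝ E + 1) • X := by
    rw [hX, scale_holPart, ← holPart_smul, h2, holPart_smul]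
  have h4 := congrArg (c • ·) (hodgeL_scale hp t X)
  rw [← map_smul, ← map_smul, h3, map_smul, map_smul, smul_comm c, pow_succ, mul_smul] at h4
  rw [map_neg, smul_neg, smul_neg, smul_right_injective _ (pow_ne_zero _ ht) h4]

theorem scale_deltaE (h : IsLocalHermitian U B I) (hΩ : IsHolTwoForm U B I Ω) {f : E → CExt E}
    (hf : IsHolForm U I f) {t c : ℂ} (ht : t ≠ 0) (hs : ∀ z ∈ U, scale t (f z) = c • f z)
    {y : E} (hy : y ∈ U) : scale t (deltaE B I Ω f y) = (c * t) • deltaE B I Ω f y := by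
  have h1 := scale_delStarE h hf ht hs hy
  have h2 := scale_delStarE h (hΩ.isHolForm.mul hf) ht (c := t ^ 2 * c) (fun z hz => by
    rw [map_mul, hs z hz, hΩ.scale_eq z hz, smul_mul_smul_comm]) hy
  refine smul_right_injective _ ht ?_
  simp only
  rw [deltaE, map_neg, map_sub, map_mul, hΩ.scale_eq y hy, smul_neg, smul_sub, ← mul_smul_comm,
    h1, h2, smul_mul_smul_comm]
  module

end LocalForms

/-! ### The type of Ω, and the exchange of types by J. -/

section HolSympForm

variable {T : Type*} [AddCommGroup T] [Module ℝ T] [Module.Finite ℝ T]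
variable {B : T →ₗ[ℝ] T →ₗ[ℝ] ℝ} {I J : T →ₗ[ℝ] T}

theorem map_proj10_twoForm (G : T →ₗ[ℝ] T →ₗ[ℝ] ℝ) :
    map (proj10 I) (twoForm fun v w => G v w) = (1 / 4 : ℂ) • ((twoForm fun v w => G v w) -
      Complex.I • ((twoForm fun v w => G v (I w)) + twoForm fun v w => G (I v) w) -
      twoForm fun v w => G (I v) (I w)) := by
  have e1 := sum_covPull_mul_covPull G LinearMap.id I
  have e2 := sum_covPull_mul_covPull G I LinearMap.id
  have e3 := sum_covPull_mul_covPull G I I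
  have hid : ∀ α : CDual T, covPull LinearMap.id α = α := fun α => rfl
  simp only [LinearMap.id_apply, hid] at e1 e2 e3
  have t1 := twoForm_eq (G.compl₂ I)
  have t2 := twoForm_eq (G ∘ₗ I)
  have t3 := twoForm_eq (G.compl₁₂ I I)
  simp only [LinearMap.compl₂_apply, LinearMap.comp_apply, LinearMap.compl₁₂_apply] at t1 t2 t3
  rw [t1, t2, t3, ← e1, ← e2, ← e3, twoForm_eq]
  simp only [map_smul, map_sum, map_mul, map_apply_ι, Finset.smul_sum, ← Finset.sum_add_distrib,
    ← Finset.sum_sub_distrib]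
  refine Finset.sum_congr rfl fun i _ => Finset.sum_congr rfl fun j _ => ?_
  simp only [proj10_apply_eq, map_sub, map_smul, sub_mul, mul_sub, smul_mul_assoc, mul_smul_comm,
    smul_sub, smul_add, smul_smul]
  have hI : Complex.I * Complex.I = -1 := Complex.I_mul_I
  match_scalars <;> first
    | ring1
    | linear_combination ((1 / 8 : ℂ) * (G (finBasis ℝ T i) (finBasis ℝ T j))) * hI

theorem twoForm_neg (G : T → T → ℝ) : (twoForm fun v w => -G v w) = -twoForm G := by
  simp only [twoForm, Complex.ofReal_neg, mul_neg, neg_smul, Finset.sum_neg_distrib]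

/-- The form `Ω` is of type `(2,0)`. -/
theorem holSympForm_mem (h : IsQuaternionHermitian B I J) : holSympForm B I J ∈ extStar0 I := by
  have h0 := map_proj10_mem h.left.sq (holSympForm B I J)
  have e1 := map_proj10_twoForm (I := I) (B.compl₂ J)
  have e2 := map_proj10_twoForm (I := I) (B.compl₂ (I ∘ₗ J))
  simp only [LinearMap.compl₂_apply, LinearMap.comp_apply, h.left.skew, h.anti,
    h.left.sq, map_neg, twoForm_neg, neg_neg] at e1 e2
  -- The anticommutation of I and J gives (2,0)-parts Ω for ω_J and -iΩ for ω_K, so the combination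
  -- ½(ω_J + iω_K) reproduces Ω.
  have h1 : map (proj10 I) (holSympForm B I J) = holSympForm B I J := by
    rw [holSympForm, map_smul, map_add, map_smul, e1, e2]
    have hI : Complex.I * Complex.I = -1 := Complex.I_mul_I
    match_scalars <;> first | ring1 | linear_combination (-1 / 4 : ℂ) * hI
  rwa [h1] at h0

omit [Module.Finite ℝ T] in
theorem extPull_neg_extPull {ξ : CExt T} (hJ : ∀ v, J (J v) = -v) :
    extPull (-J) (extPull J ξ) = ξ := by
  rw [extPull_extPull]
  have : J ∘ₗ (-J) = LinearMap.id := LinearMap.ext fun v => by simp [hJ]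
  rw [this, extPull_id]

omit [Module.Finite ℝ T] in
/-- `J` maps forms of type `(*,0)` to forms of type `(0,*)`. -/
theorem holPart_extPull_of_mem {ξ : CExt T} (hI : ∀ v, I (I v) = -v)
    (hJ : ∀ v, J (I v) = -I (J v)) (hξ : ξ ∈ extStar0 I) :
    holPart I 0 (extPull J ξ) = extPull J ξ := by
  have h1 : extPull J ξ ∈ extStar0 (-I) :=
    extPull_mem_extStar0 (fun v => by simp [hJ]) (fun v => by simp [hI]) hξ
  have h2 := map_proj10_of_mem h1
  rw [proj10_neg] at h2
  rw [holPart_zero_eq, h2]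

omit [Module.Finite ℝ T] in
theorem extPull_holPart_zero_mem (ξ : CExt T) (hI : ∀ v, I (I v) = -v)
    (hJ : ∀ v, J (I v) = -I (J v)) :
    extPull (-J) (holPart I 0 ξ) ∈ extStar0 I := by
  have h1 := map_proj10_mem (I := -I) (fun v => by simp [hI]) ξ
  rw [proj10_neg, ← holPart_zero_eq] at h1
  exact extPull_mem_extStar0 (fun v => by simp [hJ]) hI h1

end HolSympForm

/-! ### The operators ∂_J and δ_J* on an open subset of a vector space. -/

section LocalQuaternion

variable {E : Type*} [NormedAddCommGroup E] [NormedSpace ℝ E] [FiniteDimensional ℝ E]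
variable {U : Set E} {B : E → E →ₗ[ℝ] E →ₗ[ℝ] ℝ} {I J : E → E →ₗ[ℝ] E}

/-- Smooth almost quaternion-Hermitian structures on an open set of a vector space. -/
structure IsLocalQuaternionHermitian (U : Set E) (B : E → E →ₗ[ℝ] E →ₗ[ℝ] ℝ)
    (I J : E → E →ₗ[ℝ] E) : Prop where
  isOpen : IsOpen U
  pair : ∀ y ∈ U, IsQuaternionHermitian (B y) (I y) (J y)
  smooth_metric : ∀ v w, ContDiffOn ℝ ∞ (fun y => B y v w) U
  smooth_left : ∀ v, ContDiffOn ℝ ∞ (fun y => I y v) U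
  smooth_right : ∀ v, ContDiffOn ℝ ∞ (fun y => J y v) U

omit [FiniteDimensional ℝ E] in
theorem IsLocalQuaternionHermitian.toHermitian (h : IsLocalQuaternionHermitian U B I J) :
    IsLocalHermitian U B I :=
  ⟨h.isOpen, fun y hy => (h.pair y hy).left, h.smooth_metric, h.smooth_left⟩

/-- The form `Ω` of a family of quaternion-Hermitian structures. -/
def sympE (B : E → E →ₗ[ℝ] E →ₗ[ℝ] ℝ) (I J : E → E →ₗ[ℝ] E) (y : E) : CExt E :=
  holSympForm (B y) (I y) (J y)

theorem IsLocalQuaternionHermitian.isHolTwoForm (h : IsLocalQuaternionHermitian U B I J) :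
    IsHolTwoForm U B I (sympE B I J) where
  isHolForm := by
    refine ⟨?_, fun y hy => holSympForm_mem (h.pair y hy)⟩
    have h1 : ∀ K : E → E →ₗ[ℝ] E, (∀ v, ContDiffOn ℝ ∞ (fun y => K y v) U) →
        ContDiffOn ℝ ∞ (fun y => twoForm fun v w => B y v (K y w)) U := fun K hK =>
      contDiffOn_twoForm fun v w => contDiffOn_bilin h.smooth_metric contDiffOn_const (hK w)
    refine contDiffOn_const.ext_smul ((h1 J h.smooth_right).add (contDiffOn_const.ext_smul
      (h1 (fun y => I y ∘ₗ J y) fun v => ?_)))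
    have h2 : ∀ y, (I y ∘ₗ J y) v = ∑ i, (finBasis ℝ E).coord i (J y v) • I y (finBasis ℝ E i) :=
      fun y => by
        conv_lhs => rw [LinearMap.comp_apply, ← (finBasis ℝ E).sum_repr (J y v)]
        simp only [map_sum, map_smul, Basis.coord_apply]
    simp only [h2]
    exact ContDiffOn.sum fun i _ => ((h.smooth_right v).covector _).smul (h.smooth_left _)
  scale_eq := fun y _ t => scale_holSympForm t
  contraction := fun y hy a => ⟨_, intProd_holSympForm_proj01 (h.pair y hy) a⟩

theorem ContDiffOn.extPull (hJ : ∀ v, ContDiffOn ℝ ∞ (fun y => J y v) U) {f : E → CExt E}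
    (hf : ContDiffOn ℝ ∞ f U) : ContDiffOn ℝ ∞ (fun y => _root_.extPull (J y) (f y)) U := by
  refine ContDiffOn.ext_family (F := fun y => (_root_.extPull (J y)).toLinearMap) (fun ξ => ?_) hf
  simp only [AlgHom.toLinearMap_apply]
  induction ξ using left_induction with
  | scalar r => simp only [AlgHom.commutes]; exact contDiffOn_const
  | add x y hx hy => simp only [map_add]; exact hx.add hy
  | ι_mul m x hx =>
    simp only [map_mul, extPull_ι]
    exact (contDiffOn_ι fun v => (hJ v).covector m).ext_mul hx

/-- The operator `J ∘ ∂̄ ∘ J⁻¹`. -/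
def delJE (I J : E → E →ₗ[ℝ] E) (f : E → CExt E) (y : E) : CExt E :=
  extPull (-J y) (dbarE I (fun z => extPull (J z) (f z)) y)

/-- J anticommutes with I, so it carries (*,0)-forms to (0,*)-forms, on which ∂̄ is the holomorphic
degree 0 part of d. -/
theorem delJE_eq (h : IsLocalQuaternionHermitian U B I J) {f : E → CExt E} (hf : IsHolForm U I f)
    {y : E} (hy : y ∈ U) : delJE I J f y =
      extPull (-J y) (holPart (I y) 0 (extDerivE (fun z => extPull (J z) (f z)) y)) := by
  have h1 : ∀ z ∈ U, holPart (I z) 0 (extPull (J z) (f z)) = extPull (J z) (f z) := fun z hz =>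
    holPart_extPull_of_mem (h.pair z hz).left.sq (h.pair z hz).anti (hf.2 z hz)
  rw [delJE, dbarE_eq (f := fun z => extPull (J z) (f z)) h.isOpen (Nat.zero_le _) h1
    (fun z hz p hp => ?_) hy]
  rw [← h1 z hz, holPart_holPart_of_ne (h.pair z hz).left.sq hp]

theorem IsHolForm.delJE (h : IsLocalQuaternionHermitian U B I J) {f : E → CExt E}
    (hf : IsHolForm U I f) : IsHolForm U I (_root_.delJE I J f) := by
  refine ⟨((hf.1.extPull h.smooth_right).dbarE h.isOpen h.smooth_left).extPull
    (J := fun y => -J y) fun v => (h.smooth_right v).neg, fun y hy => ?_⟩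
  rw [delJE_eq h hf hy]
  exact extPull_holPart_zero_mem _ (h.pair y hy).left.sq (h.pair y hy).anti

theorem IsLocalQuaternionHermitian.differentiableAt_extPull
    (h : IsLocalQuaternionHermitian U B I J) {f : E → CExt E}
    (hf : IsHolForm U I f) {y : E} (hy : y ∈ U) :
    DifferentiableAt ℝ (fun z => extPull (J z) (f z)) y :=
  h.toHermitian.differentiableAt (hf.1.extPull h.smooth_right) hy

theorem delJE_add (h : IsLocalQuaternionHermitian U B I J) {f g : E → CExt E}
    (hf : IsHolForm U I f) (hg : IsHolForm U I g) {y : E} (hy : y ∈ U) :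
    delJE I J (fun z => f z + g z) y = delJE I J f y + delJE I J g y := by
  rw [delJE_eq h (hf.add hg) hy, delJE_eq h hf hy, delJE_eq h hg hy]
  simp only [map_add]
  rw [extDerivE_add (h.differentiableAt_extPull hf hy) (h.differentiableAt_extPull hg hy),
    holPart_add, map_add]

/-- The symbol of `J ∘ ∂̄ ∘ J⁻¹`. -/
theorem delJE_smul (h : IsLocalQuaternionHermitian U B I J) {f : E → CExt E}
    (hf : IsHolForm U I f) {c : E → ℂ} (hc : ContDiffOn ℝ ∞ c U) {y : E} (hy : y ∈ U) :
    delJE I J (fun z => c z • f z) y = c y • delJE I J f y -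
      ι ℂ (covPull (J y) (proj01 (I y) (dfun c y))) * f y := by
  have hp := h.pair y hy
  rw [delJE_eq h (hf.smul hc) hy, delJE_eq h hf hy]
  simp only [map_smul]
  -- The minus sign arises because J acts on covectors by precomposition with J⁻¹ = -J.
  rw [extDerivE_smul (h.toHermitian.differentiableAt hc hy) (h.differentiableAt_extPull hf hy),
    holPart_add, holPart_smul, map_add, map_smul, holPart_zero_ι_mul,
    holPart_extPull_of_mem hp.left.sq hp.anti (hf.2 y hy), map_mul,
    extPull_neg_extPull hp.right.sq, extPull_ι, covPull_neg, map_neg, neg_mul,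
    neg_add_eq_sub]

theorem scale_delJE (h : IsLocalQuaternionHermitian U B I J) {f : E → CExt E}
    (hf : IsHolForm U I f) {t c : ℂ} (hs : ∀ z ∈ U, scale t (f z) = c • f z)
    {y : E} (hy : y ∈ U) : scale t (delJE I J f y) = (c * t) • delJE I J f y := by
  have hd := h.differentiableAt_extPull hf hy
  have h1 : extDerivE (fun z => scale t (extPull (J z) (f z))) y =
      c • extDerivE (fun z => extPull (J z) (f z)) y := by
    rw [← extDerivE_const_smul c hd]
    refine extDerivE_congr ?_
    filter_upwards [h.isOpen.mem_nhds hy] with z hz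
    rw [extPull, scale_map, hs z hz, map_smul]
  rw [delJE_eq h hf hy, extPull, scale_map, scale_holPart, extDerivE_scale t hd, h1, smul_smul,
    holPart_smul, map_smul, mul_comm]

/-- The correction term is the one in `delJE_smul`; this is the equality of symbols. -/
theorem deltaE_symp_smul (h : IsLocalQuaternionHermitian U B I J) {f : E → CExt E}
    (hf : IsHolForm U I f) {c : E → ℂ} (hc : ContDiffOn ℝ ∞ c U) {y : E} (hy : y ∈ U) :
    deltaE B I (sympE B I J) (fun z => c z • f z) y = c y • deltaE B I (sympE B I J) f y -
      ι ℂ (covPull (J y) (proj01 (I y) (dfun c y))) * f y := by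
  rw [deltaE_smul h.toHermitian h.isHolTwoForm.isHolForm hy (h.isHolTwoForm.invol_eq hy) hf hc,
    sympE, intProd_holSympForm_proj01 (h.pair y hy)]

end LocalQuaternion

/-! ### Forms in charts -/

section Charts

variable {E : Type*} [NormedAddCommGroup E] [NormedSpace ℝ E]
variable {M : Type*} [TopologicalSpace M] [ChartedSpace E M]

/-- The differential of the chart at `x₀` at the point `x`. -/
def chartDiffAt (x₀ x : M) : TangentSpace 𝓘(ℝ, E) x →ₗ[ℝ] E :=
  (mfderiv 𝓘(ℝ, E) 𝓘(ℝ, E) (extChartAt 𝓘(ℝ, E) x₀) x).toLinearMap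

variable [IsManifold 𝓘(ℝ, E) ∞ M]

theorem chartDiffAt_chartSymmDiff {x₀ : M} {y : E} (hy : y ∈ (extChartAt 𝓘(ℝ, E) x₀).target)
    (v : E) : chartDiffAt x₀ ((extChartAt 𝓘(ℝ, E) x₀).symm y) (chartSymmDiff x₀ y v) = v := by
  have : IsManifold 𝓘(ℝ, E) 1 M := IsManifold.of_le (n := ∞) (by simp)
  have h := mfderiv_extChartAt_comp_mfderivWithin_extChartAt_symm (I := 𝓘(ℝ, E)) hy
  simp only [modelWithCornersSelf_coe, Set.range_id, mfderivWithin_univ] at h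
  exact DFunLike.congr_fun h v

theorem chartSymmDiff_chartDiffAt {x₀ : M} {y : E} (hy : y ∈ (extChartAt 𝓘(ℝ, E) x₀).target)
    (v : TangentSpace 𝓘(ℝ, E) ((extChartAt 𝓘(ℝ, E) x₀).symm y)) :
    chartSymmDiff x₀ y (chartDiffAt x₀ ((extChartAt 𝓘(ℝ, E) x₀).symm y) v) = v := by
  have : IsManifold 𝓘(ℝ, E) 1 M := IsManifold.of_le (n := ∞) (by simp)
  have h := mfderivWithin_extChartAt_symm_comp_mfderiv_extChartAt (I := 𝓘(ℝ, E)) hy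
  simp only [modelWithCornersSelf_coe, Set.range_id, mfderivWithin_univ] at h
  exact DFunLike.congr_fun h v

/-- The differential of the inverse of a chart, as an isomorphism. -/
def chartSymmEquiv {x₀ : M} {y : E} (hy : y ∈ (extChartAt 𝓘(ℝ, E) x₀).target) :
    E ≃ₗ[ℝ] TangentSpace 𝓘(ℝ, E) ((extChartAt 𝓘(ℝ, E) x₀).symm y) :=
  { chartSymmDiff x₀ y with
    invFun := chartDiffAt x₀ ((extChartAt 𝓘(ℝ, E) x₀).symm y)
    left_inv := chartDiffAt_chartSymmDiff hy
    right_inv := chartSymmDiff_chartDiffAt hy }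

theorem chartSymmEquiv_toLinearMap {x₀ : M} {y : E} (hy : y ∈ (extChartAt 𝓘(ℝ, E) x₀).target) :
    (chartSymmEquiv hy).toLinearMap = chartSymmDiff x₀ y := rfl

omit [IsManifold 𝓘(ℝ, E) ∞ M] in
theorem forall_of_forall_chart {P : M → Prop}
    (h : ∀ (x₀ : M), ∀ y ∈ (extChartAt 𝓘(ℝ, E) x₀).target, P ((extChartAt 𝓘(ℝ, E) x₀).symm y))
    (x : M) : P x := by
  have := h x _ (mem_extChartAt_target (I := 𝓘(ℝ, E)) x)
  rwa [extChartAt_to_inv] at this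

theorem extPull_chartSymmDiff_injective {x₀ : M} {y : E}
    (hy : y ∈ (extChartAt 𝓘(ℝ, E) x₀).target) :
    Function.Injective (extPull (chartSymmDiff (M := M) x₀ y)) := by
  intro a b hab
  have := congrArg (extPull (chartSymmEquiv hy).symm.toLinearMap) hab
  rwa [← chartSymmEquiv_toLinearMap hy, extPull_extPull_symm, extPull_extPull_symm] at this

theorem CForm.ext_inChart {η ζ : CForm E M}
    (h : ∀ x₀ : M, ∀ y ∈ (extChartAt 𝓘(ℝ, E) x₀).target,
      CForm.inChart x₀ η y = CForm.inChart x₀ ζ y) : η = ζ :=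
  funext <| forall_of_forall_chart (E := E) fun x₀ y hy =>
    extPull_chartSymmDiff_injective hy (h x₀ y hy)

variable [FiniteDimensional ℝ E]

omit [IsManifold 𝓘(ℝ, E) ∞ M] in
theorem CForm.isSmooth_iff {η : CForm E M} : CForm.IsSmooth η ↔
    ∀ x₀ : M, ContDiffOn ℝ ∞ (CForm.inChart x₀ η) (extChartAt 𝓘(ℝ, E) x₀).target :=
  forall_congr' fun _ => contDiffOn_extCoord_iff

omit [FiniteDimensional ℝ E] in
-- The chart followed by its inverse returns p only up to a propositional equality, so tangent
-- spaces at p cannot be identified definitionally. Any left inverse of the chart differential at p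
-- serves instead.
theorem inChart_eq_extPull {x p : M} (hp : p ∈ (extChartAt 𝓘(ℝ, E) x).source) (η : CForm E M)
    {L : E →ₗ[ℝ] TangentSpace 𝓘(ℝ, E) p} (hL : ∀ w, L (chartDiffAt x p w) = w) :
    CForm.inChart x η (extChartAt 𝓘(ℝ, E) x p) = extPull L (η p) := by
  have key : ∀ (q : M) (A : E →ₗ[ℝ] TangentSpace 𝓘(ℝ, E) q) (_ : q = p)
      (_ : ∀ v, chartDiffAt x q (A v) = v), extPull A (η q) = extPull L (η p) := by
    rintro q A rfl hA
    have : A = L := LinearMap.ext fun v => by rw [← hL (A v), hA]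
    rw [this]
  exact key _ (chartSymmDiff x (extChartAt 𝓘(ℝ, E) x p)) ((extChartAt 𝓘(ℝ, E) x).left_inv hp)
    (chartDiffAt_chartSymmDiff ((extChartAt 𝓘(ℝ, E) x).map_source hp))

omit [FiniteDimensional ℝ E] in
theorem fderiv_transition {x₀ x : M} {y : E} (hy : y ∈ (extChartAt 𝓘(ℝ, E) x₀).target)
    (hx : (extChartAt 𝓘(ℝ, E) x₀).symm y ∈ (extChartAt 𝓘(ℝ, E) x).source) :
    (fderiv ℝ (extChartAt 𝓘(ℝ, E) x ∘ (extChartAt 𝓘(ℝ, E) x₀).symm) y).toLinearMap =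
      chartDiffAt x ((extChartAt 𝓘(ℝ, E) x₀).symm y) ∘ₗ chartSymmDiff x₀ y := by
  have : IsManifold 𝓘(ℝ, E) 1 M := IsManifold.of_le (n := ∞) (by simp)
  have h1 : MDifferentiableAt 𝓘(ℝ, E) 𝓘(ℝ, E) (extChartAt 𝓘(ℝ, E) x)
      ((extChartAt 𝓘(ℝ, E) x₀).symm y) :=
    mdifferentiableAt_extChartAt (by rwa [extChartAt_source] at hx)
  have h2 := mdifferentiableWithinAt_extChartAt_symm (I := 𝓘(ℝ, E)) hy
  simp only [modelWithCornersSelf_coe, Set.range_id, mdifferentiableWithinAt_univ] at h2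
  have h3 := mfderiv_comp y h1 h2
  rw [mfderiv_eq_fderiv] at h3
  exact congrArg ContinuousLinearMap.toLinearMap h3

/-- The de Rham differential in a chart. -/
theorem CForm.IsSmooth.inChart_d {η : CForm E M} (hη : CForm.IsSmooth η) {x₀ : M} {y : E}
    (hy : y ∈ (extChartAt 𝓘(ℝ, E) x₀).target) :
    CForm.inChart x₀ (CForm.d η) y = extDerivE (CForm.inChart x₀ η) y := by
  set x := (extChartAt 𝓘(ℝ, E) x₀).symm y with hx
  set τ := extChartAt 𝓘(ℝ, E) x ∘ (extChartAt 𝓘(ℝ, E) x₀).symm with hτ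
  have hsrc : x ∈ (extChartAt 𝓘(ℝ, E) x).source := mem_extChartAt_source x
  have hU := (isOpen_extChartAt_target (I := 𝓘(ℝ, E)) x₀).mem_nhds hy
  have hcont : ContinuousAt (extChartAt 𝓘(ℝ, E) x₀).symm y :=
    (continuousOn_extChartAt_symm (I := 𝓘(ℝ, E)) x₀).continuousAt hU
  have hsm : ContDiffAt ℝ 2 τ y := by
    have h1 : ContMDiffAt 𝓘(ℝ, E) 𝓘(ℝ, E) ∞ (extChartAt 𝓘(ℝ, E) x₀).symm y :=
      (contMDiffOn_extChartAt_symm x₀).contMDiffAt hU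
    have h2 : ContMDiffAt 𝓘(ℝ, E) 𝓘(ℝ, E) ∞ (extChartAt 𝓘(ℝ, E) x) x := contMDiffAt_extChartAt
    exact ((h2.comp y h1).contDiffAt).of_le (by exact ENat.LEInfty.out)
  have hd : DifferentiableAt ℝ (CForm.inChart x η) (τ y) :=
    (((CForm.isSmooth_iff.1 hη x).differentiableOn (by simp)).differentiableAt
      ((isOpen_extChartAt_target (I := 𝓘(ℝ, E)) x).mem_nhds (mem_extChartAt_target x)))
  -- By definition d at the point x uses the chart at x. Near y the two local expressions of the
  -- form differ by pull-back along the transition map τ, with which the exterior derivative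
  -- commutes.
  have hloc : (CForm.inChart x₀ η) =ᶠ[nhds y]
      fun z => extPull (fderiv ℝ τ z).toLinearMap (CForm.inChart x η (τ z)) := by
    filter_upwards [hU, hcont.preimage_mem_nhds
      ((isOpen_extChartAt_source (I := 𝓘(ℝ, E)) x).mem_nhds hsrc)] with z hz hz'
    set p := (extChartAt 𝓘(ℝ, E) x₀).symm z
    obtain ⟨L, hL⟩ : ∃ L : E →ₗ[ℝ] TangentSpace 𝓘(ℝ, E) p, ∀ w, L (chartDiffAt x p w) = w := by
      have hq : ∃ q ∈ (extChartAt 𝓘(ℝ, E) x).target, (extChartAt 𝓘(ℝ, E) x).symm q = p :=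
        ⟨_, (extChartAt 𝓘(ℝ, E) x).map_source hz', (extChartAt 𝓘(ℝ, E) x).left_inv hz'⟩
      obtain ⟨q, hq, hqp⟩ := hq
      rw [← hqp]
      exact ⟨chartSymmDiff x q, chartSymmDiff_chartDiffAt hq⟩
    have e1 : CForm.inChart x η (τ z) = extPull L (η p) := inChart_eq_extPull hz' η hL
    rw [e1, hτ, fderiv_transition hz hz', extPull_extPull, ← LinearMap.comp_assoc]
    have e2 : L ∘ₗ chartDiffAt x p = LinearMap.id := LinearMap.ext hL
    rw [e2, LinearMap.id_comp]
    rfl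
  rw [extDerivE_congr hloc, extDerivE_extPull hsm hd, hτ, fderiv_transition hy hsrc,
    ← extPull_extPull]
  rfl

end Charts

/-! ### Hypercomplex Hermitian structures in charts -/

section HermitianCharts

variable {E : Type*} [NormedAddCommGroup E] [NormedSpace ℝ E]
variable {M : Type*} [TopologicalSpace M] [ChartedSpace E M] [IsManifold 𝓘(ℝ, E) ∞ M]

theorem contMDiffOn_chartFrame (x₀ : M) (v : E) :
    ContMDiffOn 𝓘(ℝ, E) (𝓘(ℝ, E).prod 𝓘(ℝ, E)) ∞ (fun x => (TotalSpace.mk' E x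
      ((trivializationAt E (TangentSpace 𝓘(ℝ, E)) x₀).symmL ℝ x v) : TangentBundle 𝓘(ℝ, E) M))
      (trivializationAt E (TangentSpace 𝓘(ℝ, E)) x₀).baseSet := by
  rw [Trivialization.contMDiffOn_section_baseSet_iff]
  refine (contMDiffOn_const (c := v)).congr fun x hx => ?_
  rw [Trivialization.symmL_apply, Trivialization.apply_mk_symm _ hx]
  exact hx

theorem contDiffOn_of_contMDiffOn_source {F : Type*} [NormedAddCommGroup F] [NormedSpace ℝ F]
    {x₀ : M} {f : M → F} (hf : ContMDiffOn 𝓘(ℝ, E) 𝓘(ℝ, F) ∞ f (extChartAt 𝓘(ℝ, E) x₀).source) :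
    ContDiffOn ℝ ∞ (fun y => f ((extChartAt 𝓘(ℝ, E) x₀).symm y))
      (extChartAt 𝓘(ℝ, E) x₀).target := by
  rw [← contMDiffOn_iff_contDiffOn]
  exact hf.comp (contMDiffOn_extChartAt_symm x₀) (extChartAt 𝓘(ℝ, E) x₀).mapsTo_symm

/-- Identifies the frame of the bundle trivialization, in which smoothness of the structure is
given, with the coordinate frame used for local expressions. -/
theorem symmL_trivializationAt_eq {x₀ : M} {y : E}
    (hy : y ∈ (extChartAt 𝓘(ℝ, E) x₀).target) (v : E) :
    (trivializationAt E (TangentSpace 𝓘(ℝ, E)) x₀).symmL ℝ ((extChartAt 𝓘(ℝ, E) x₀).symm y) v =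
      chartSymmDiff x₀ y v := by
  have : IsManifold 𝓘(ℝ, E) 1 M := IsManifold.of_le (n := ∞) (by simp)
  have hx : (extChartAt 𝓘(ℝ, E) x₀).symm y ∈ (chartAt E x₀).source := by
    rw [← extChartAt_source 𝓘(ℝ, E)]
    exact (extChartAt 𝓘(ℝ, E) x₀).map_target hy
  have h := TangentBundle.symmL_trivializationAt (I := 𝓘(ℝ, E)) hx
  rw [(extChartAt 𝓘(ℝ, E) x₀).right_inv hy, modelWithCornersSelf_coe, Set.range_id,
    mfderivWithin_univ] at h
  exact DFunLike.congr_fun h v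

theorem baseSet_trivializationAt_eq (x₀ : M) :
    (trivializationAt E (TangentSpace 𝓘(ℝ, E)) x₀).baseSet =
      (extChartAt 𝓘(ℝ, E) x₀).source := by
  rw [extChartAt_source]
  rfl

namespace HypercomplexHermitian

variable (H : HypercomplexHermitian E M)

/-- The action of a quaternion in the chart at `x₀`. -/
def opE (q : ℍ[ℝ]) (x₀ : M) (y : E) : E →ₗ[ℝ] E :=
  chartDiffAt x₀ ((extChartAt 𝓘(ℝ, E) x₀).symm y) ∘ₗ
    H.op q ((extChartAt 𝓘(ℝ, E) x₀).symm y) ∘ₗ chartSymmDiff x₀ y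

/-- The metric as a bilinear map. -/
def metricL (x : M) : TangentSpace 𝓘(ℝ, E) x →ₗ[ℝ] TangentSpace 𝓘(ℝ, E) x →ₗ[ℝ] ℝ :=
  LinearMap.mk₂ ℝ (H.s x) (fun _ _ _ => by simp [s]) (fun _ _ _ => by simp [s])
    (fun _ _ _ => by simp [s]) (fun _ _ _ => by simp [s])

/-- The metric in the chart at `x₀`. -/
def metricE (x₀ : M) (y : E) : E →ₗ[ℝ] E →ₗ[ℝ] ℝ :=
  (H.metricL ((extChartAt 𝓘(ℝ, E) x₀).symm y)).compl₁₂ (chartSymmDiff x₀ y) (chartSymmDiff x₀ y)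

theorem op_chartSymmDiff (q : ℍ[ℝ]) {x₀ : M} {y : E} (hy : y ∈ (extChartAt 𝓘(ℝ, E) x₀).target)
    (v : E) : H.op q _ (chartSymmDiff x₀ y v) = chartSymmDiff x₀ y (H.opE q x₀ y v) :=
  (chartSymmDiff_chartDiffAt hy _).symm

theorem op_mul (p q : ℍ[ℝ]) (x : M) (v : TangentSpace 𝓘(ℝ, E) x) :
    H.op (p * q) x v = H.op p x (H.op q x v) := by
  simp only [op, map_mul]
  rfl

theorem op_neg_one (x : M) (v : TangentSpace 𝓘(ℝ, E) x) : H.op (-1) x v = -v := by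
  simp only [op, map_neg, map_one]
  rfl

theorem op_neg (q : ℍ[ℝ]) (x : M) : H.op (-q) x = -H.op q x := by
  simp only [op, map_neg]
  rfl

theorem isHermitianPair {q : ℍ[ℝ]} (hq : q * q = -1) (x : M) :
    IsHermitianPair (H.metricL x) (H.op q x) where
  symm v w := H.metric.symm x v w
  pos v hv := H.metric.pos x v hv
  sq v := by rw [← op_mul, hq, op_neg_one]
  inv v w := H.hermitian q hq x v w

theorem quatI_mul_quatI : quatI * quatI = -1 := by
  apply Quaternion.ext <;> simp only [Quaternion.re_mul, Quaternion.imI_mul,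
    Quaternion.imJ_mul, Quaternion.imK_mul] <;> simp [quatI]

theorem quatJ_mul_quatJ : quatJ * quatJ = -1 := by
  apply Quaternion.ext <;> simp only [Quaternion.re_mul, Quaternion.imI_mul,
    Quaternion.imJ_mul, Quaternion.imK_mul] <;> simp [quatJ]

theorem quatI_mul_quatJ : quatI * quatJ = quatK := by
  apply Quaternion.ext <;> simp only [Quaternion.re_mul, Quaternion.imI_mul,
    Quaternion.imJ_mul, Quaternion.imK_mul] <;> simp [quatI, quatJ, quatK]

theorem quatJ_mul_quatI : quatJ * quatI = -1 * (quatI * quatJ) := by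
  rw [neg_one_mul]
  apply Quaternion.ext <;>
    simp only [Quaternion.re_mul, Quaternion.imI_mul,
    Quaternion.imJ_mul, Quaternion.imK_mul, Quaternion.re_neg, Quaternion.imI_neg, Quaternion.imJ_neg, Quaternion.imK_neg] <;>
    simp [quatI, quatJ]

theorem quatJ_inv : quatJ⁻¹ = -quatJ := by
  refine inv_eq_of_mul_eq_one_right ?_
  rw [mul_neg, quatJ_mul_quatJ, neg_neg]

theorem isQuaternionHermitian (x : M) :
    IsQuaternionHermitian (H.metricL x) (H.op quatI x) (H.op quatJ x) where
  left := H.isHermitianPair quatI_mul_quatI x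
  right := H.isHermitianPair quatJ_mul_quatJ x
  anti v := by rw [← op_mul, ← op_mul, quatJ_mul_quatI, op_mul, op_neg_one]

theorem isHermitianPair_chart {q : ℍ[ℝ]} (hq : q * q = -1) {x₀ : M} {y : E}
    (hy : y ∈ (extChartAt 𝓘(ℝ, E) x₀).target) :
    IsHermitianPair (H.metricE x₀ y) (H.opE q x₀ y) where
  symm v w := (H.isHermitianPair hq _).symm _ _
  pos v hv := (H.isHermitianPair hq _).pos _ fun h0 => hv ((chartSymmEquiv hy).map_eq_zero_iff.1 h0)
  sq v := by
    refine (chartSymmEquiv hy).injective ?_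
    show chartSymmDiff x₀ y _ = chartSymmDiff x₀ y _
    rw [← op_chartSymmDiff _ _ hy, ← op_chartSymmDiff _ _ hy, (H.isHermitianPair hq _).sq, map_neg]
  inv v w := by
    show H.metricL _ (chartSymmDiff x₀ y _) (chartSymmDiff x₀ y _) = _
    rw [← op_chartSymmDiff _ _ hy, ← op_chartSymmDiff _ _ hy, (H.isHermitianPair hq _).inv]
    rfl

/-- Smoothness of the bundle endomorphism is tested by applying it to the smooth chart frame and
reading the result in the trivialization. -/
theorem contDiffOn_opE (q : ℍ[ℝ]) (x₀ : M) (v : E) :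
    ContDiffOn ℝ ∞ (fun y => H.opE q x₀ y v) (extChartAt 𝓘(ℝ, E) x₀).target := by
  have : IsManifold 𝓘(ℝ, E) 1 M := IsManifold.of_le (n := ∞) (by simp)
  have h1 := (H.smooth q).contMDiffOn.clm_bundle_apply (contMDiffOn_chartFrame x₀ v)
  rw [Trivialization.contMDiffOn_section_baseSet_iff, baseSet_trivializationAt_eq] at h1
  refine (contDiffOn_of_contMDiffOn_source h1).congr fun y hy => ?_
  have hx := (extChartAt 𝓘(ℝ, E) x₀).map_target hy
  have h2 := TangentBundle.continuousLinearMapAt_trivializationAt (I := 𝓘(ℝ, E))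
    (by rwa [extChartAt_source] at hx)
  rw [symmL_trivializationAt_eq hy]
  rw [← Trivialization.continuousLinearMapAt_apply_of_mem (R := ℝ) _
    (by rwa [baseSet_trivializationAt_eq]), h2]
  rfl

theorem contDiffOn_metricE (x₀ : M) (v w : E) :
    ContDiffOn ℝ ∞ (fun y => H.metricE x₀ y v w) (extChartAt 𝓘(ℝ, E) x₀).target := by
  have h1 : ContMDiffOn 𝓘(ℝ, E) (𝓘(ℝ, E).prod 𝓘(ℝ)) ∞ (fun x => TotalSpace.mk' ℝ
      (E := Bundle.Trivial M ℝ) x (H.metric.inner x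
        ((trivializationAt E (TangentSpace 𝓘(ℝ, E)) x₀).symmL ℝ x v)
        ((trivializationAt E (TangentSpace 𝓘(ℝ, E)) x₀).symmL ℝ x w)))
      (trivializationAt E (TangentSpace 𝓘(ℝ, E)) x₀).baseSet :=
    ContMDiffOn.clm_bundle_apply₂ (F₁ := E) (F₂ := E) H.metric.contMDiff.contMDiffOn
      (contMDiffOn_chartFrame x₀ v) (contMDiffOn_chartFrame x₀ w)
  have h2 : ContMDiffOn 𝓘(ℝ, E) 𝓘(ℝ) ∞ (fun x => H.metric.inner x
        ((trivializationAt E (TangentSpace 𝓘(ℝ, E)) x₀).symmL ℝ x v)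
        ((trivializationAt E (TangentSpace 𝓘(ℝ, E)) x₀).symmL ℝ x w))
      (trivializationAt E (TangentSpace 𝓘(ℝ, E)) x₀).baseSet := fun x hx => by
    have := h1 x hx
    simp only [contMDiffWithinAt_totalSpace] at this
    exact this.2
  rw [baseSet_trivializationAt_eq] at h2
  refine (contDiffOn_of_contMDiffOn_source h2).congr fun y hy => ?_
  rw [symmL_trivializationAt_eq hy, symmL_trivializationAt_eq hy]
  rfl

theorem isLocalQuaternionHermitian (x₀ : M) :
    IsLocalQuaternionHermitian (extChartAt 𝓘(ℝ, E) x₀).target (H.metricE x₀) (H.opE quatI x₀)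
      (H.opE quatJ x₀) where
  isOpen := isOpen_extChartAt_target x₀
  pair y hy :=
    { left := H.isHermitianPair_chart quatI_mul_quatI hy
      right := H.isHermitianPair_chart quatJ_mul_quatJ hy
      anti := fun v => by
        refine (chartSymmEquiv hy).injective ?_
        show chartSymmDiff x₀ y _ = chartSymmDiff x₀ y _
        rw [← op_chartSymmDiff _ _ hy, ← op_chartSymmDiff _ _ hy, map_neg,
          ← op_chartSymmDiff _ _ hy, ← op_chartSymmDiff _ _ hy, (H.isQuaternionHermitian _).anti] }
  smooth_metric := H.contDiffOn_metricE x₀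
  smooth_left := H.contDiffOn_opE quatI x₀
  smooth_right := H.contDiffOn_opE quatJ x₀

end HypercomplexHermitian

end HermitianCharts

/-! ### Operators on forms in charts -/

section OperatorCharts

variable {E : Type*} [NormedAddCommGroup E] [NormedSpace ℝ E] [FiniteDimensional ℝ E]

variable {M : Type*} [TopologicalSpace M] [ChartedSpace E M] [IsManifold 𝓘(ℝ, E) ∞ M]

namespace HypercomplexHermitian

variable (H : HypercomplexHermitian E M) {x₀ : M} {y : E}

omit [FiniteDimensional ℝ E] in
theorem inChart_holPart (hy : y ∈ (extChartAt 𝓘(ℝ, E) x₀).target) (p : ℕ) (η : CForm E M) :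
    CForm.inChart x₀ (fun x => holPart (H.op quatI x) p (η x)) y =
      holPart (H.opE quatI x₀ y) p (CForm.inChart x₀ η y) :=
  extPull_holPart (fun v => H.op_chartSymmDiff quatI hy v) p _

theorem isSmooth_holPart (p : ℕ) {η : CForm E M} (hη : CForm.IsSmooth η) :
    CForm.IsSmooth (E := E) (fun x => holPart (H.op quatI x) p (η x)) := by
  rw [CForm.isSmooth_iff] at hη ⊢
  exact fun x₀ => ((hη x₀).holPart (H.contDiffOn_opE quatI x₀) p).congr
    fun y hy => H.inChart_holPart hy p η

theorem inChart_dbar (hy : y ∈ (extChartAt 𝓘(ℝ, E) x₀).target) {η : CForm E M}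
    (hη : CForm.IsSmooth η) :
    CForm.inChart x₀ (H.dbar η) y = dbarE (H.opE quatI x₀) (CForm.inChart x₀ η) y := by
  have h1 : CForm.inChart x₀ (H.dbar η) y = ∑ p ∈ Finset.range (finrank ℝ E + 1),
      CForm.inChart x₀ (fun x => holPart (H.op quatI x) p
        (CForm.d (fun z => holPart (H.op quatI z) p (η z)) x)) y :=
    map_sum (extPull (chartSymmDiff x₀ y)) _ _
  rw [h1, dbarE]
  refine Finset.sum_congr rfl fun p _ => ?_
  rw [H.inChart_holPart hy, (H.isSmooth_holPart p hη).inChart_d hy]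
  congr 1
  -- The exterior derivative depends only on the germ, so agreement of the local expressions on the
  -- chart target suffices. The same passage to germs recurs for the composite operators below.
  refine extDerivE_congr ?_
  filter_upwards [(isOpen_extChartAt_target (I := 𝓘(ℝ, E)) x₀).mem_nhds hy] with z hz
  exact H.inChart_holPart hz p η

theorem inChart_star (hy : y ∈ (extChartAt 𝓘(ℝ, E) x₀).target) (η : CForm E M) :
    CForm.inChart x₀ (H.star η) y =
      starE (H.metricE x₀) (H.opE quatI x₀) (CForm.inChart x₀ η) y :=
  extPull_hodgeL (B' := H.metricL _) (H.isHermitianPair quatI_mul_quatI _)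
    (H.isHermitianPair_chart quatI_mul_quatI hy) (chartSymmEquiv hy) (fun _ _ => rfl)
    (fun v => H.op_chartSymmDiff quatI hy v) _

theorem isSmooth_star {η : CForm E M} (hη : CForm.IsSmooth η) : CForm.IsSmooth (H.star η) := by
  rw [CForm.isSmooth_iff] at hη ⊢
  exact fun x₀ => ((hη x₀).starE (H.isLocalQuaternionHermitian x₀).toHermitian).congr
    fun y hy => H.inChart_star hy η

theorem inChart_delStar (hy : y ∈ (extChartAt 𝓘(ℝ, E) x₀).target) {η : CForm E M}
    (hη : CForm.IsSmooth η) : CForm.inChart x₀ (H.delStar η) y =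
      delStarE (H.metricE x₀) (H.opE quatI x₀) (CForm.inChart x₀ η) y := by
  have h1 : CForm.inChart x₀ (H.delStar η) y =
      -CForm.inChart x₀ (H.star (H.dbar (H.star η))) y :=
    map_neg (extPull (chartSymmDiff x₀ y)) _
  have h2 : dbarE (H.opE quatI x₀) (CForm.inChart x₀ (H.star η)) y = dbarE (H.opE quatI x₀)
      (starE (H.metricE x₀) (H.opE quatI x₀) (CForm.inChart x₀ η)) y := by
    refine dbarE_congr ?_
    filter_upwards [(isOpen_extChartAt_target (I := 𝓘(ℝ, E)) x₀).mem_nhds hy] with z hz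
    exact H.inChart_star hz η
  rw [h1, H.inChart_star hy, delStarE, starE, H.inChart_dbar hy (H.isSmooth_star hη), h2]

omit [FiniteDimensional ℝ E] [IsManifold 𝓘(ℝ, E) ∞ M] in
theorem inChart_mul (η ζ : CForm E M) : CForm.inChart x₀ (η * ζ) y =
    CForm.inChart x₀ η y * CForm.inChart x₀ ζ y :=
  map_mul (extPull (chartSymmDiff x₀ y)) _ _

theorem inChart_omegaForm (hy : y ∈ (extChartAt 𝓘(ℝ, E) x₀).target) (q : ℍ[ℝ]) :
    CForm.inChart x₀ (H.omegaForm q) y =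
      twoForm fun v w => H.metricE x₀ y v (H.opE q x₀ y w) := by
  refine (extPull_twoForm ((H.metricL _).compl₂ (H.op q _)) _).trans ?_
  congr 1
  ext v w
  rw [LinearMap.compl₂_apply, H.op_chartSymmDiff q hy]
  rfl

omit [FiniteDimensional ℝ E] in
theorem opE_quatK (hy : y ∈ (extChartAt 𝓘(ℝ, E) x₀).target) (v : E) :
    H.opE quatK x₀ y v = H.opE quatI x₀ y (H.opE quatJ x₀ y v) := by
  refine (chartSymmEquiv hy).injective ?_
  show chartSymmDiff x₀ y _ = chartSymmDiff x₀ y _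
  rw [← op_chartSymmDiff _ _ hy, ← op_chartSymmDiff _ _ hy, ← op_chartSymmDiff _ _ hy, ← op_mul,
    quatI_mul_quatJ]

theorem inChart_Omega (hy : y ∈ (extChartAt 𝓘(ℝ, E) x₀).target) :
    CForm.inChart x₀ H.Omega y =
      sympE (H.metricE x₀) (H.opE quatI x₀) (H.opE quatJ x₀) y := by
  have h1 : CForm.inChart x₀ H.Omega y = (1 / 2 : ℂ) • (CForm.inChart x₀ (H.omegaForm quatJ) y +
      Complex.I • CForm.inChart x₀ (H.omegaForm quatK) y) := by
    show extPull (chartSymmDiff x₀ y) ((1 / 2 : ℂ) • (_ + Complex.I • _)) = _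
    rw [map_smul, map_add, map_smul]
    rfl
  rw [h1, H.inChart_omegaForm hy, H.inChart_omegaForm hy, sympE, holSympForm]
  simp only [H.opE_quatK hy]

theorem isSmooth_Omega : CForm.IsSmooth H.Omega := by
  rw [CForm.isSmooth_iff]
  exact fun x₀ => (H.isLocalQuaternionHermitian x₀).isHolTwoForm.isHolForm.1.congr
    fun y hy => H.inChart_Omega hy

theorem inChart_deltaJStar (hy : y ∈ (extChartAt 𝓘(ℝ, E) x₀).target) {η : CForm E M}
    (hη : CForm.IsSmooth η) : CForm.inChart x₀ (H.deltaJStar η) y =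
      deltaE (H.metricE x₀) (H.opE quatI x₀)
        (sympE (H.metricE x₀) (H.opE quatI x₀) (H.opE quatJ x₀)) (CForm.inChart x₀ η) y := by
  have h1 : CForm.inChart x₀ (H.deltaJStar η) y = -(CForm.inChart x₀ H.Omega y *
      CForm.inChart x₀ (H.delStar η) y - CForm.inChart x₀ (H.delStar (H.Omega * η)) y) := by
    show extPull (chartSymmDiff x₀ y) (-(_ * _ - _)) = _
    rw [map_neg, map_sub, map_mul]
    rfl
  have h2 : CForm.inChart x₀ (H.Omega * η) =ᶠ[nhds y] fun z =>
      sympE (H.metricE x₀) (H.opE quatI x₀) (H.opE quatJ x₀) z * CForm.inChart x₀ η z := by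
    filter_upwards [(isOpen_extChartAt_target (I := 𝓘(ℝ, E)) x₀).mem_nhds hy] with z hz
    rw [inChart_mul, H.inChart_Omega hz]
  rw [h1, H.inChart_delStar hy hη, H.inChart_delStar hy (H.isSmooth_Omega.mul hη),
    H.inChart_Omega hy, deltaE, delStarE_congr h2]

omit [FiniteDimensional ℝ E] in
theorem inChart_formAct (hy : y ∈ (extChartAt 𝓘(ℝ, E) x₀).target) (q : ℍ[ℝ]) (η : CForm E M) :
    CForm.inChart x₀ (H.formAct q η) y =
      extPull (H.opE q⁻¹ x₀ y) (CForm.inChart x₀ η y) := by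
  show extPull (chartSymmDiff x₀ y) (extPull (H.op q⁻¹ _) _) = extPull _ (extPull _ _)
  rw [extPull_extPull, extPull_extPull]
  congr 1
  exact congrArg extPull (LinearMap.ext fun v => H.op_chartSymmDiff q⁻¹ hy v)

omit [FiniteDimensional ℝ E] in
theorem opE_neg (q : ℍ[ℝ]) : H.opE (-q) x₀ y = -H.opE q x₀ y := by
  rw [opE, op_neg, LinearMap.neg_comp, LinearMap.comp_neg, opE]

theorem isSmooth_formAct (q : ℍ[ℝ]) {η : CForm E M} (hη : CForm.IsSmooth η) :
    CForm.IsSmooth (H.formAct q η) := by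
  rw [CForm.isSmooth_iff] at hη ⊢
  exact fun x₀ => ((hη x₀).extPull (H.contDiffOn_opE q⁻¹ x₀)).congr
    fun y hy => H.inChart_formAct hy q η

theorem inChart_delJ (hy : y ∈ (extChartAt 𝓘(ℝ, E) x₀).target) {η : CForm E M}
    (hη : CForm.IsSmooth η) : CForm.inChart x₀ (H.delJ η) y =
      delJE (H.opE quatI x₀) (H.opE quatJ x₀) (CForm.inChart x₀ η) y := by
  have h1 : dbarE (H.opE quatI x₀) (CForm.inChart x₀ (H.formAct quatJ⁻¹ η)) y =
      dbarE (H.opE quatI x₀) (fun z => extPull (H.opE quatJ x₀ z) (CForm.inChart x₀ η z)) y := by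
    refine dbarE_congr ?_
    filter_upwards [(isOpen_extChartAt_target (I := 𝓘(ℝ, E)) x₀).mem_nhds hy] with z hz
    rw [H.inChart_formAct hz, inv_inv]
  have h2 : H.opE quatJ⁻¹ x₀ y = -H.opE quatJ x₀ y := by rw [quatJ_inv, opE_neg]
  rw [delJ, H.inChart_formAct hy, H.inChart_dbar hy (H.isSmooth_formAct _ hη), h1, h2, delJE]

/-! #### Forms of type `(*,0)` in charts -/

theorem isHolForm_inChart (x₀ : M) (η : LambdaStar0 H) :
    IsHolForm (extChartAt 𝓘(ℝ, E) x₀).target (H.opE quatI x₀) (CForm.inChart x₀ (η : CForm E M)) :=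
  ⟨CForm.isSmooth_iff.1 η.2.1 x₀, fun _ hy => extPull_mem_extStar0
    (fun v => H.op_chartSymmDiff quatI hy v) (H.isHermitianPair_chart quatI_mul_quatI hy).sq
    (η.2.2 _)⟩

omit [FiniteDimensional ℝ E] in
/-- Membership in `Λ^{*,0}` can be tested in a chart. -/
theorem mem_extStar0_of_inChart (hy : y ∈ (extChartAt 𝓘(ℝ, E) x₀).target) {η : CForm E M}
    (h : CForm.inChart x₀ η y ∈ extStar0 (H.opE quatI x₀ y)) :
    η ((extChartAt 𝓘(ℝ, E) x₀).symm y) ∈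
      extStar0 (H.op quatI ((extChartAt 𝓘(ℝ, E) x₀).symm y)) := by
  have h1 := extPull_mem_extStar0 (A := (chartSymmEquiv hy).symm.toLinearMap)
    (I := H.op quatI _) (fun v => ?_) (H.isHermitianPair quatI_mul_quatI _).sq h
  · rwa [CForm.inChart, ← chartSymmEquiv_toLinearMap hy, extPull_extPull_symm] at h1
  · refine (chartSymmEquiv hy).injective ?_
    refine Eq.trans ?_ ((chartSymmEquiv hy).apply_symm_apply _).symm
    refine (H.op_chartSymmDiff quatI hy _).symm.trans ?_
    exact congrArg _ ((chartSymmEquiv hy).apply_symm_apply v)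

theorem mem_lambdaStar0_of_inChart {η : CForm E M}
    (h : ∀ x₀, IsHolForm (extChartAt 𝓘(ℝ, E) x₀).target (H.opE quatI x₀) (CForm.inChart x₀ η)) :
    η ∈ LambdaStar0 H :=
  ⟨CForm.isSmooth_iff.2 fun x₀ => (h x₀).1, forall_of_forall_chart (E := E) fun x₀ _ hy =>
    H.mem_extStar0_of_inChart hy ((h x₀).2 _ hy)⟩

theorem _root_.IsHolForm.congr {U : Set E} {I : E → E →ₗ[ℝ] E} {f g : E → CExt E}
    (hf : IsHolForm U I f) (h : Set.EqOn g f U) : IsHolForm U I g :=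
  ⟨hf.1.congr h, fun y hy => by rw [h hy]; exact hf.2 y hy⟩

theorem deltaJStar_mem (η : LambdaStar0 H) : H.deltaJStar η ∈ LambdaStar0 H := by
  refine H.mem_lambdaStar0_of_inChart fun x₀ => ?_
  have h := H.isLocalQuaternionHermitian x₀
  exact (IsHolForm.deltaE h.toHermitian h.isHolTwoForm.isHolForm (H.isHolForm_inChart x₀ η)).congr
    fun _ hy => H.inChart_deltaJStar hy η.2.1

theorem delJ_mem (η : LambdaStar0 H) : H.delJ η ∈ LambdaStar0 H := by
  refine H.mem_lambdaStar0_of_inChart fun x₀ => ?_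
  have h1 := (H.isHolForm_inChart x₀ η).delJE (H.isLocalQuaternionHermitian x₀)
  exact h1.congr fun _ hy => H.inChart_delJ hy η.2.1

omit [FiniteDimensional ℝ E] [IsManifold 𝓘(ℝ, E) ∞ M] in
theorem inChart_add (η ζ : CForm E M) : CForm.inChart x₀ (η + ζ) y =
    CForm.inChart x₀ η y + CForm.inChart x₀ ζ y :=
  map_add (extPull (chartSymmDiff x₀ y)) _ _

omit [FiniteDimensional ℝ E] [IsManifold 𝓘(ℝ, E) ∞ M] in
theorem inChart_smul (c : ℂ) (η : CForm E M) : CForm.inChart x₀ (c • η) y =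
    c • CForm.inChart x₀ η y :=
  map_smul (extPull (chartSymmDiff x₀ y)) _ _

omit [FiniteDimensional ℝ E] [IsManifold 𝓘(ℝ, E) ∞ M] in
theorem inChart_ofFun (f : M → ℂ) : CForm.inChart x₀ (CForm.ofFun f : CForm E M) y =
    algebraMap ℂ _ (f ((extChartAt 𝓘(ℝ, E) x₀).symm y)) :=
  AlgHom.commutes (extPull (chartSymmDiff x₀ y)) _

end HypercomplexHermitian

end OperatorCharts

/-! ### The operators on the algebra of forms of type `(*,0)` -/

section GlobalOperators

variable {E : Type*} [NormedAddCommGroup E] [NormedSpace ℝ E] [FiniteDimensional ℝ E]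
variable {M : Type*} [TopologicalSpace M] [ChartedSpace E M] [IsManifold 𝓘(ℝ, E) ∞ M]

omit [FiniteDimensional ℝ E] in
theorem dfun_const (c : ℂ) (y : E) : dfun (fun _ : E => c) y = 0 := by
  rw [dfun, fderiv_const_apply]
  rfl

namespace HypercomplexHermitian

variable (H : HypercomplexHermitian E M) {x₀ : M} {y : E}

/-- The action of `J` on the `(0,1)`-part of the differential of a function, in a chart. -/
def symbolE (f : M → ℂ) (x₀ : M) (y : E) : CExt E :=
  ι ℂ (covPull (H.opE quatJ x₀ y) (proj01 (H.opE quatI x₀ y)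
    (dfun (fun z => f ((extChartAt 𝓘(ℝ, E) x₀).symm z)) y)))

omit [FiniteDimensional ℝ E] in
theorem symbolE_const (c : ℂ) : H.symbolE (fun _ => c) x₀ y = 0 := by
  rw [symbolE, dfun_const, map_zero, map_zero, map_zero]

omit [FiniteDimensional ℝ E] in
theorem contDiffOn_inChart {f : M → ℂ} (hf : ContMDiff 𝓘(ℝ, E) 𝓘(ℝ, ℂ) ∞ f) (x₀ : M) :
    ContDiffOn ℝ ∞ (fun z => f ((extChartAt 𝓘(ℝ, E) x₀).symm z))
      (extChartAt 𝓘(ℝ, E) x₀).target :=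
  contDiffOn_of_contMDiffOn_source hf.contMDiffOn

omit [FiniteDimensional ℝ E] [IsManifold 𝓘(ℝ, E) ∞ M] in
theorem inChart_ofFun_mul (f : M → ℂ) (η : CForm E M) :
    CForm.inChart x₀ (CForm.ofFun f * η) = fun z =>
      f ((extChartAt 𝓘(ℝ, E) x₀).symm z) • CForm.inChart x₀ η z :=
  funext fun z => by rw [inChart_mul, inChart_ofFun, Algebra.smul_def]

theorem inChart_deltaJStar_ofFun_mul (hy : y ∈ (extChartAt 𝓘(ℝ, E) x₀).target) {f : M → ℂ}
    (hf : ContMDiff 𝓘(ℝ, E) 𝓘(ℝ, ℂ) ∞ f) (η : LambdaStar0 H) :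
    CForm.inChart x₀ (H.deltaJStar ((CForm.ofFun f : CForm E M) * (η : CForm E M))) y =
      CForm.inChart x₀ ((CForm.ofFun f : CForm E M) * H.deltaJStar η) y -
        H.symbolE f x₀ y * CForm.inChart x₀ (η : CForm E M) y := by
  rw [H.inChart_deltaJStar hy ((CForm.isSmooth_ofFun hf).mul η.2.1), inChart_ofFun_mul,
    deltaE_symp_smul (H.isLocalQuaternionHermitian x₀) (H.isHolForm_inChart x₀ η)
      (contDiffOn_inChart hf x₀) hy, inChart_ofFun_mul]
  beta_reduce
  rw [H.inChart_deltaJStar hy η.2.1]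
  rfl

theorem inChart_delJ_ofFun_mul (hy : y ∈ (extChartAt 𝓘(ℝ, E) x₀).target) {f : M → ℂ}
    (hf : ContMDiff 𝓘(ℝ, E) 𝓘(ℝ, ℂ) ∞ f) (η : LambdaStar0 H) :
    CForm.inChart x₀ (H.delJ ((CForm.ofFun f : CForm E M) * (η : CForm E M))) y =
      CForm.inChart x₀ ((CForm.ofFun f : CForm E M) * H.delJ η) y -
        H.symbolE f x₀ y * CForm.inChart x₀ (η : CForm E M) y := by
  rw [H.inChart_delJ hy ((CForm.isSmooth_ofFun hf).mul η.2.1), inChart_ofFun_mul,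
    delJE_smul (H.isLocalQuaternionHermitian x₀) (H.isHolForm_inChart x₀ η)
      (contDiffOn_inChart hf x₀) hy, inChart_ofFun_mul]
  beta_reduce
  rw [H.inChart_delJ hy η.2.1]
  rfl

theorem deltaJStar_add (η ζ : LambdaStar0 H) :
    H.deltaJStar ((η : CForm E M) + (ζ : CForm E M)) = H.deltaJStar η + H.deltaJStar ζ := by
  refine CForm.ext_inChart fun x₀ y hy => ?_
  have h := H.isLocalQuaternionHermitian x₀
  have h1 : CForm.inChart x₀ ((η : CForm E M) + (ζ : CForm E M)) =
      fun z => CForm.inChart x₀ (η : CForm E M) z + CForm.inChart x₀ (ζ : CForm E M) z :=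
    funext fun z => inChart_add _ _
  rw [inChart_add, H.inChart_deltaJStar hy (η.2.1.add ζ.2.1), H.inChart_deltaJStar hy η.2.1,
    H.inChart_deltaJStar hy ζ.2.1, h1, deltaE_add h.toHermitian h.isHolTwoForm.isHolForm
      (H.isHolForm_inChart x₀ η) (H.isHolForm_inChart x₀ ζ) hy]

theorem delJ_add (η ζ : LambdaStar0 H) : H.delJ ((η : CForm E M) + (ζ : CForm E M)) = H.delJ η + H.delJ ζ := by
  refine CForm.ext_inChart fun x₀ y hy => ?_
  have h1 : CForm.inChart x₀ ((η : CForm E M) + (ζ : CForm E M)) =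
      fun z => CForm.inChart x₀ (η : CForm E M) z + CForm.inChart x₀ (ζ : CForm E M) z :=
    funext fun z => inChart_add _ _
  rw [inChart_add, H.inChart_delJ hy (η.2.1.add ζ.2.1), H.inChart_delJ hy η.2.1,
    H.inChart_delJ hy ζ.2.1, h1, delJE_add (H.isLocalQuaternionHermitian x₀)
      (H.isHolForm_inChart x₀ η) (H.isHolForm_inChart x₀ ζ) hy]

omit [FiniteDimensional ℝ E] [IsManifold 𝓘(ℝ, E) ∞ M] in
-- Scalars are treated as constant functions, so that ℂ-linearity of both operators follows from the
-- symbol formula, the differential of a constant being zero.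
theorem smul_eq_ofFun_mul (c : ℂ) (η : CForm E M) : c • η = CForm.ofFun (fun _ => c) * η :=
  funext fun x => Algebra.smul_def c (η x)

theorem deltaJStar_smul (c : ℂ) (η : LambdaStar0 H) :
    H.deltaJStar (c • (η : CForm E M)) = c • H.deltaJStar η := by
  refine CForm.ext_inChart fun x₀ y hy => ?_
  rw [smul_eq_ofFun_mul, smul_eq_ofFun_mul, H.inChart_deltaJStar_ofFun_mul hy contMDiff_const,
    symbolE_const, zero_mul, sub_zero]

theorem delJ_smul (c : ℂ) (η : LambdaStar0 H) :
    H.delJ (c • (η : CForm E M)) = c • H.delJ η := by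
  refine CForm.ext_inChart fun x₀ y hy => ?_
  rw [smul_eq_ofFun_mul, smul_eq_ofFun_mul, H.inChart_delJ_ofFun_mul hy contMDiff_const,
    symbolE_const, zero_mul, sub_zero]

/-- The operator `δ_J*` on the algebra of forms of type `(*,0)`. -/
def deltaJStarEnd : Module.End ℂ (LambdaStar0 H) where
  toFun η := ⟨H.deltaJStar η, H.deltaJStar_mem η⟩
  map_add' η ζ := Subtype.ext (H.deltaJStar_add η ζ)
  map_smul' c η := Subtype.ext (H.deltaJStar_smul c η)

/-- The operator `∂_J` on the algebra of forms of type `(*,0)`. -/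
def delJEnd : Module.End ℂ (LambdaStar0 H) where
  toFun η := ⟨H.delJ η, H.delJ_mem η⟩
  map_add' η ζ := Subtype.ext (H.delJ_add η ζ)
  map_smul' c η := Subtype.ext (H.delJ_smul c η)

omit [FiniteDimensional ℝ E] [IsManifold 𝓘(ℝ, E) ∞ M] in
theorem inChart_sub (η ζ : CForm E M) : CForm.inChart x₀ (η - ζ) y =
    CForm.inChart x₀ η y - CForm.inChart x₀ ζ y :=
  map_sub (extPull (chartSymmDiff x₀ y)) _ _

theorem inChart_funComm_deltaJStarEnd (hy : y ∈ (extChartAt 𝓘(ℝ, E) x₀).target)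
    (f : C^∞⟮𝓘(ℝ, E), M; 𝓘(ℝ, ℂ), ℂ⟯) (η : LambdaStar0 H) :
    CForm.inChart x₀ (funComm H H.deltaJStarEnd f η : CForm E M) y =
      -H.symbolE f x₀ y * CForm.inChart x₀ (η : CForm E M) y := by
  have h1 : (funComm H H.deltaJStarEnd f η : CForm E M) =
      H.deltaJStar ((CForm.ofFun f : CForm E M) * (η : CForm E M)) - (CForm.ofFun f : CForm E M) * H.deltaJStar η := rfl
  rw [h1, inChart_sub, H.inChart_deltaJStar_ofFun_mul hy f.contMDiff, sub_sub_cancel_left, neg_mul]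

theorem inChart_funComm_delJEnd (hy : y ∈ (extChartAt 𝓘(ℝ, E) x₀).target)
    (f : C^∞⟮𝓘(ℝ, E), M; 𝓘(ℝ, ℂ), ℂ⟯) (η : LambdaStar0 H) :
    CForm.inChart x₀ (funComm H H.delJEnd f η : CForm E M) y =
      -H.symbolE f x₀ y * CForm.inChart x₀ (η : CForm E M) y := by
  have h1 : (funComm H H.delJEnd f η : CForm E M) =
      H.delJ ((CForm.ofFun f : CForm E M) * (η : CForm E M)) - (CForm.ofFun f : CForm E M) * H.delJ η := rfl
  rw [h1, inChart_sub, H.inChart_delJ_ofFun_mul hy f.contMDiff, sub_sub_cancel_left, neg_mul]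

theorem sameSymbol : SameSymbol H H.deltaJStarEnd H.delJEnd := fun f =>
  LinearMap.ext fun η => Subtype.ext <| CForm.ext_inChart fun x₀ y hy => by
    rw [H.inChart_funComm_deltaJStarEnd hy, H.inChart_funComm_delJEnd hy]

/-- An operator is of first order if its commutators with functions are multiplications. -/
theorem isDiffOpOverFun_one {D : Module.End ℂ (LambdaStar0 H)}
    {u : C^∞⟮𝓘(ℝ, E), M; 𝓘(ℝ, ℂ), ℂ⟯ → M → E → CExt E}
    (hu : ∀ f η x₀, ∀ y ∈ (extChartAt 𝓘(ℝ, E) x₀).target,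
      CForm.inChart x₀ (funComm H D f η : CForm E M) y =
        u f x₀ y * CForm.inChart x₀ (η : CForm E M) y) : IsDiffOpOverFun H 1 D := by
  intro f g
  refine LinearMap.ext fun η => Subtype.ext <| CForm.ext_inChart fun x₀ y hy => ?_
  have h1 : (funComm H (funComm H D f) g η : CForm E M) =
      funComm H D f (smoothFun H g * η) -
        (CForm.ofFun g : CForm E M) * (funComm H D f η : CForm E M) := rfl
  have h2 : ((smoothFun H g * η : LambdaStar0 H) : CForm E M) =
      (CForm.ofFun g : CForm E M) * (η : CForm E M) := rfl
  rw [h1, inChart_sub, hu f _ x₀ y hy, h2, inChart_ofFun_mul, inChart_ofFun_mul]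
  beta_reduce
  rw [hu f _ x₀ y hy, mul_smul_comm, sub_self]
  exact (map_zero (extPull (chartSymmDiff x₀ y))).symm

/-! #### Degrees -/

omit [IsManifold 𝓘(ℝ, E) ∞ M] in
theorem scale_inChart {t c : ℂ} {η : CForm E M} (h : ∀ x, scale t (η x) = c • η x) (z : E) :
    scale t (CForm.inChart x₀ η z) = c • CForm.inChart x₀ η z := by
  rw [CForm.inChart, extPull, scale_map, h, map_smul]

/-- Scaling commutes with pull-back, so the eigenvalue test for the degree can be carried out in
charts. -/
theorem mem_lambdaP0_of_scale_inChart {p : ℕ} {η : LambdaStar0 H}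
    (h : ∀ x₀, ∀ y ∈ (extChartAt 𝓘(ℝ, E) x₀).target,
      scale 2 (CForm.inChart x₀ (η : CForm E M) y) =
        (2 : ℂ) ^ p • CForm.inChart x₀ (η : CForm E M) y) : η ∈ LambdaP0 H p :=
  forall_of_forall_chart (E := E) fun x₀ y hy => by
    refine mem_extP0_of_scale (η.2.2 _) (extPull_chartSymmDiff_injective hy ?_)
    have h1 := h x₀ y hy
    rw [CForm.inChart, extPull, scale_map] at h1
    rw [extPull, h1, map_smul]

theorem scale_inChart_of_mem {p : ℕ} {η : LambdaStar0 H} (hη : η ∈ LambdaP0 H p) (t : ℂ) (z : E) :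
    scale t (CForm.inChart x₀ (η : CForm E M) z) =
      t ^ p • CForm.inChart x₀ (η : CForm E M) z :=
  scale_inChart (fun x => scale_of_mem_extP0 t (hη x)) z

theorem deltaJStarEnd_mem {p : ℕ} {η : LambdaStar0 H} (hη : η ∈ LambdaP0 H p) :
    H.deltaJStarEnd η ∈ LambdaP0 H (p + 1) := by
  refine H.mem_lambdaP0_of_scale_inChart fun x₀ y hy => ?_
  have h := H.isLocalQuaternionHermitian x₀
  show scale 2 (CForm.inChart x₀ (H.deltaJStar η) y) = _ • CForm.inChart x₀ (H.deltaJStar η) y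
  rw [H.inChart_deltaJStar hy η.2.1, scale_deltaE h.toHermitian h.isHolTwoForm
    (H.isHolForm_inChart x₀ η) two_ne_zero (fun z _ => H.scale_inChart_of_mem hη 2 z) hy, pow_succ]

theorem delJEnd_mem {p : ℕ} {η : LambdaStar0 H} (hη : η ∈ LambdaP0 H p) :
    H.delJEnd η ∈ LambdaP0 H (p + 1) := by
  refine H.mem_lambdaP0_of_scale_inChart fun x₀ y hy => ?_
  show scale 2 (CForm.inChart x₀ (H.delJ η) y) = _ • CForm.inChart x₀ (H.delJ η) y
  rw [H.inChart_delJ hy η.2.1, scale_delJE (H.isLocalQuaternionHermitian x₀)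
    (H.isHolForm_inChart x₀ η) (fun z _ => H.scale_inChart_of_mem hη 2 z) hy, pow_succ]

/-! #### Order in the sense of graded commutative algebras -/

theorem deltaJStarEnd_mul {a b : LambdaStar0 H} {c : ℂ}
    (ha : ∀ x, invol ((a : CForm E M) x) = c • (a : CForm E M) x) :
    H.deltaJStarEnd (a * b) = H.deltaJStarEnd a * b +
      c • (a * (H.deltaJStarEnd b - H.deltaJStarEnd 1 * b)) := by
  refine Subtype.ext <| CForm.ext_inChart fun x₀ y hy => ?_
  have h := H.isLocalQuaternionHermitian x₀
  show CForm.inChart x₀ (H.deltaJStar ((a : CForm E M) * (b : CForm E M))) y =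
    CForm.inChart x₀ (H.deltaJStar a * (b : CForm E M) + c • ((a : CForm E M) *
      (H.deltaJStar b - H.deltaJStar ((1 : LambdaStar0 H) : CForm E M) * (b : CForm E M)))) y
  have h1 : CForm.inChart x₀ ((a : CForm E M) * (b : CForm E M)) =
      fun z => CForm.inChart x₀ (a : CForm E M) z * CForm.inChart x₀ (b : CForm E M) z :=
    funext fun z => inChart_mul _ _
  have h2 : CForm.inChart x₀ ((1 : LambdaStar0 H) : CForm E M) = fun _ => 1 :=
    funext fun z => map_one (extPull (chartSymmDiff x₀ z))
  have h3 : invol (CForm.inChart x₀ (a : CForm E M) y) = c • CForm.inChart x₀ (a : CForm E M) y :=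
    scale_inChart ha y
  rw [inChart_add, inChart_smul, inChart_mul, inChart_mul, inChart_sub, inChart_mul,
    H.inChart_deltaJStar hy (a.2.1.mul b.2.1), H.inChart_deltaJStar hy a.2.1,
    H.inChart_deltaJStar hy b.2.1, H.inChart_deltaJStar hy (1 : LambdaStar0 H).2.1, h1, h2,
    deltaE_mul_eq h.toHermitian h.isHolTwoForm hy (H.isHolForm_inChart x₀ a)
      (H.isHolForm_inChart x₀ b), h3, smul_mul_assoc]

theorem _root_.neg_one_pow_eq_paritySign (p : ℕ) : (-1 : ℂ) ^ p = paritySign (p : ZMod 2) := by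
  rw [paritySign]
  rcases Nat.even_or_odd p with hp | hp
  · rw [if_pos ((ZMod.natCast_eq_zero_iff_even).2 hp), hp.neg_one_pow]
  · rw [if_neg (fun h => Nat.not_even_iff_odd.2 hp ((ZMod.natCast_eq_zero_iff_even).1 h)),
      hp.neg_one_pow]

theorem invol_of_mem_parityPart {c : ZMod 2} {a : LambdaStar0 H}
    (ha : a ∈ parityPart (LambdaP0 H) c) (x : M) :
    invol ((a : CForm E M) x) = paritySign c • (a : CForm E M) x := by
  -- The sign condition is linear, so it need only be checked on the homogeneous pieces that span
  -- the parity part.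
  let S : Submodule ℂ (LambdaStar0 H) :=
    { carrier := {a | ∀ x, invol ((a : CForm E M) x) = paritySign c • (a : CForm E M) x}
      add_mem' := fun {a b} ha hb x => by
        show invol ((a : CForm E M) x + (b : CForm E M) x) =
          paritySign c • ((a : CForm E M) x + (b : CForm E M) x)
        rw [map_add, ha, hb, smul_add]
      zero_mem' := fun x => by
        show invol (0 : CExt (TangentSpace 𝓘(ℝ, E) x)) = paritySign c • 0
        rw [map_zero, smul_zero]
      smul_mem' := fun r a ha x => by
        show invol (r • (a : CForm E M) x) = paritySign c • (r • (a : CForm E M) x)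
        rw [map_smul, ha, smul_comm] }
  have h : parityPart (LambdaP0 H) c ≤ S := by
    refine iSup_le fun p => iSup_le fun hp a ha x => ?_
    rw [invol, scale_of_mem_extP0 _ (ha x), neg_one_pow_eq_paritySign, hp]
  exact h ha x

theorem hasParity_deltaJStarEnd : HasParity (LambdaP0 H) 1 H.deltaJStarEnd := by
  intro c
  have h : parityPart (LambdaP0 H) c ≤
      (parityPart (LambdaP0 H) (c + 1)).comap H.deltaJStarEnd := by
    refine iSup_le fun p => iSup_le fun hp a ha => ?_
    have h1 : LambdaP0 H (p + 1) ≤ parityPart (LambdaP0 H) (c + 1) :=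
      le_iSup₂_of_le (p + 1) (by rw [Nat.cast_succ, hp]) le_rfl
    exact h1 (H.deltaJStarEnd_mem ha)
  exact h

theorem _root_.sub_smul_add_smul_eq {A : Type*} [Ring A] [Algebra ℂ A] {c : ℂ} (hc : c * c = 1)
    (a b u v w : A) : a * v - c • (u * b + c • (a * (v - w * b))) = (a * w - c • u) * b := by
  rw [smul_add, smul_smul, hc, one_smul, sub_mul, mul_sub, mul_assoc, smul_mul_assoc]
  abel

/-- In aδ(η) ∓ δ(aη) the terms aδ(η) cancel, since the square of the sign is 1; every remaining term
is a left multiplication applied to η. -/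
theorem superComm_deltaJStarEnd {c : ZMod 2} {a : LambdaStar0 H}
    (ha : a ∈ parityPart (LambdaP0 H) c) :
    superComm c 1 (LinearMap.mulLeft ℂ a) H.deltaJStarEnd =
      LinearMap.mulLeft ℂ (a * H.deltaJStarEnd 1 - paritySign c • H.deltaJStarEnd a) := by
  have hs : paritySign c * paritySign c = 1 := by
    rw [paritySign]
    split_ifs <;> norm_num
  refine LinearMap.ext fun η => ?_
  have h1 := H.deltaJStarEnd_mul (b := η) (H.invol_of_mem_parityPart ha)
  have h2 : superComm c 1 (LinearMap.mulLeft ℂ a) H.deltaJStarEnd η =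
      a * H.deltaJStarEnd η - paritySign c • H.deltaJStarEnd (a * η) := by
    rw [superComm, mul_one]
    rfl
  rw [h2, h1]
  exact sub_smul_add_smul_eq hs _ _ _ _ _

theorem _root_.superComm_zero {A : Type*} [Ring A] [Algebra ℂ A] (c e : ZMod 2)
    (P : Module.End ℂ A) : superComm c e P 0 = 0 := by
  simp [superComm]

theorem deltaJStarEnd_mem_gradedDiffOp : H.deltaJStarEnd ∈ gradedDiffOp (LambdaP0 H) 1 := by
  -- δ_J* raises the degree by one and is therefore purely odd, so its even part is taken to be
  -- zero.
  refine ⟨0, H.deltaJStarEnd, fun c a _ => zero_mem _, H.hasParity_deltaJStarEnd,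
    (zero_add _).symm, fun c a ha => ?_⟩
  have h0 : superComm c 0 (LinearMap.mulLeft ℂ a) (0 : Module.End ℂ (LambdaStar0 H)) = 0 :=
    superComm_zero _ _ _
  rw [h0, zero_add, H.superComm_deltaJStarEnd ha]
  exact ⟨_, rfl⟩

end HypercomplexHermitian

end GlobalOperators

end

theorem mainTheorem10 {E : Type*} [NormedAddCommGroup E] [NormedSpace ℝ E] [FiniteDimensional ℝ E]
    {M : Type*} [TopologicalSpace M] [T2Space M] [SecondCountableTopology M]
    [ChartedSpace E M] [IsManifold 𝓘(ℝ, E) ∞ M] (H : HypercomplexHermitian E M) :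
    ∃ δ D : Module.End ℂ (LambdaStar0 H),
      (∀ η : LambdaStar0 H, (δ η : CForm E M) = H.deltaJStar η) ∧
      (∀ η : LambdaStar0 H, (D η : CForm E M) = H.delJ η) ∧
      (∀ p : ℕ, ∀ η ∈ LambdaP0 H p, δ η ∈ LambdaP0 H (p + 1)) ∧
      (∀ p : ℕ, ∀ η ∈ LambdaP0 H p, D η ∈ LambdaP0 H (p + 1)) ∧
      IsDiffOpOverFun H 1 δ ∧
      IsDiffOpOverFun H 1 D ∧
      SameSymbol H δ D ∧
      δ ∈ gradedDiffOp (LambdaP0 H) 1 :=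
  ⟨H.deltaJStarEnd, H.delJEnd, fun _ => rfl, fun _ => rfl, fun _ _ => H.deltaJStarEnd_mem,
    fun _ _ => H.delJEnd_mem,
    H.isDiffOpOverFun_one fun f η _ _ hy => H.inChart_funComm_deltaJStarEnd hy f η,
    H.isDiffOpOverFun_one fun f η _ _ hy => H.inChart_funComm_delJEnd hy f η,
    H.sameSymbol, H.deltaJStarEnd_mem_gradedDiffOp⟩
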